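/- **Setting.** A partial monitoring game $\mathcal{G}=(\mathcal{L},\Phi)$ has $k\ge 3$ actions, $d$ outcomes, a loss matrix $\mathcal{L}\in[0,1]^{k\times d}$ and a feedback matrix $\Phi\in\Sigma^{k\times d}$ with $\Sigma$ finite. In each round $t\in[T]$ the environment picks $x_t\in[d]$ (possibly at random and depending on the history of rounds $1,\dots,t-1$), the learner, not knowing $x_t$, picks $A_t\in[k]$, suffers the unobserved loss $\mathcal{L}_{A_tx_t}$ and observes only $\sigma_t=\Phi_{A_tx_t}$. The regret is $\mathsf{Reg}_T=\mathbb{E}[\sum_{t=1}^T\mathcal{L}_{A_tx_t}]-\min_{a\in[k]}\mathbb{E}[\sum_{t=1}^T\mathcal{L}_{ax_t}]$. For an action $a$ let $\mathcal{C}_a$ be the set of probability vectors $u$ on $[d]$ under which $a$ has minimal expected loss. The rows of $\mathcal{L}$ are distinct, and every $\mathcal{C}_a$ is nonempty with $\dim\mathcal{C}_a=d-1$. Actions $a,b$ are neighbors if $\mathcal{C}_a\cap\mathcal{C}_b$ is nonempty of dimension $d-2$. The game is globally observable: for all neighbors $a,b$ there is $w:[k]\times\Sigma\to\mathbb{R}$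 with $\sum_{c=1}^k w(c,\Phi_{cx})=\mathcal{L}_{ax}-\mathcal{L}_{bx}$ for all $x\in[d]$. Fix an in-tree on $[k]$ with some root whose edges $e=(a,b)$ join neighbors, functions $w_e$ of this kind for its edges, put $G(a,\sigma)_b=\sum_{e}w_e(a,\sigma)$ with the sum over the edges of the path from $b$ to the root, and $c_{\mathcal{G}}=\max\{1,k\|G\|_\infty\}$ with $\|G\|_\infty=\max_{a,\sigma,b}|G(a,\sigma)_b|$. **Algorithm.** For $s\in(0,1)$ and a probability vector $p$ let $H_s(p)=\frac1s\sum_{i=1}^k(p_i^s-p_i)$. Let $\alpha=1-1/\ln k$, $\bar\alpha=1-\alpha$, $\beta_1\ge 64c_{\mathcal{G}}^2/(1-\alpha)$ and $\bar\beta=32c_{\mathcal{G}}\sqrt k/((1-\alpha)^2\sqrt{\beta_1})$. In round $t$ the algorithm computes the minimizer $q_t$ of $\sum_{s<t}\langle\hat y_s,p\rangle-\beta_tH_\alpha(p)-\bar\beta H_{\bar\alpha}(p)$ over all probability vectors $p$ on $[k]$; takes a maximal coordinate $\tilde I_t$ of $q_t$ and $q_{t*}=\min\{q_{t\tilde I_t},1-q_{t\tilde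 I_t}\}$; sets $$z_t=\tfrac{4c_{\mathcal{G}}^2}{1-\alpha}\Big(\sum_{i\ne\tilde I_t}q_{ti}^{2-\alpha}+q_{t*}^{2-\alpha}\Big),\quad u_t=\tfrac{8c_{\mathcal{G}}}{1-\alpha}q_{t*}^{1-\alpha},\quad \gamma_t=\sqrt{z_t/\beta_t}+u_t/\beta_t;$$ draws $A_t$ from $p_t=(1-\gamma_t)q_t+\gamma_t\mathbf 1/k$; sets $\hat y_t=G(A_t,\sigma_t)/p_{tA_t}\in\mathbb{R}^k$ and $\beta_{t+1}=\beta_t+\frac{1}{H_\alpha(q_t)}\big(2\sqrt{z_t/\beta_t}+u_t/\beta_t\big)$. Put $z_{\max}=4c_{\mathcal{G}}^2/(1-\alpha)$, $u_{\max}=8c_{\mathcal{G}}/(1-\alpha)$, $h_1=H_\alpha(\mathbf 1/k)$, $\bar h=H_{\bar\alpha}(\mathbf 1/k)$, and $$\kappa=\sqrt{z_{\max}/\beta_1}+u_{\max}/\beta_1+\beta_1h_1+\bar\beta\bar h .$$ **Claim.** There is a universal constant hidden in all $O(\cdot)$ below such that the following holds for all games, trees, functions $w_e$, ways of breaking ties,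 $\beta_1$ and $T$ as above. 1. (Adversarial regime.) For every environment, $\mathsf{Reg}_T=O\big((c_{\mathcal{G}}T)^{2/3}(\ln k)^{1/3}+\kappa\big)$. 2. (Adversarial regime with a $(\Delta,C,T)$ self-bounding constraint.) Let $\Delta\in[0,1]^k$ and $C\ge0$, and suppose that in the given environment $\mathsf{Reg}_T\ge\mathbb{E}[\sum_{t=1}^T\Delta_{A_t}-C]$ for every learner. Let $a^*$ be an action with $\Delta_a>0$ for all $a\ne a^*$, $\Delta_{\min}=\min_{a\ne a^*}\Delta_a$, $\tau=1/\Delta_{\min}^3+C/\Delta_{\min}$, and $T\ge\tau$. Then $$\mathsf{Reg}_T=O\Big(\frac{c_{\mathcal{G}}^2\ln k}{\Delta_{\min}^2}\ln(T\Delta_{\min}^3)+\Big(\frac{C^2c_{\mathcal{G}}^2\ln k}{\Delta_{\min}^2}\ln\frac{T\Delta_{\min}}{C}\Big)^{1/3}+\kappa'\Big),$$ where $\kappa'=\kappa+\big((z_{\max}h_1)^{1/3}+\sqrt{u_{\max}h_1}\big)\tau^{2/3}$, and the middle term is $0$ if $C=0$. 3. If $\beta_1=64c_{\mathcal{G}}^2/(1-\alpha)$,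 then $\kappa=O\big(c_{\mathcal{G}}^2\ln k+k^{3/2}(\ln k)^{5/2}\big)$, and for all $\Delta_{\min}>0$, $C\ge0$, $$\kappa'=\kappa+O\Big(\big(c_{\mathcal{G}}^{2/3}(\ln k)^{1/3}+\sqrt{c_{\mathcal{G}}\ln k}\big)\Big(\frac1{\Delta_{\min}^3}+\frac C{\Delta_{\min}}\Big)^{2/3}\Big).$$ -/

import Mathlib

namespace PartialMonitoring

/-! ## Partial monitoring games -/

/-- A partial monitoring game with `k` actions, `d` outcomes and feedback alphabet `S`:
a loss matrix with entries in `[0,1]` and a feedback matrix. -/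
structure Game (k d : ℕ) (S : Type*) where
  loss : Fin k → Fin d → ℝ
  loss_mem : ∀ a x, loss a x ∈ Set.Icc (0 : ℝ) 1
  feedback : Fin k → Fin d → S

namespace Game

variable {k d : ℕ} {S : Type*}

/-- The cell of action `a`: the outcome distributions for which `a` is optimal. -/
def cell (g : Game k d S) (a : Fin k) : Set (Fin d → ℝ) :=
  {u | u ∈ stdSimplex ℝ (Fin d) ∧ ∀ b, ∑ x, (g.loss a x - g.loss b x) * u x ≤ 0}

/-- No two distinct actions have the same row in the loss matrix. -/
def NoDuplicates (g : Game k d S) : Prop :=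
  ∀ a b, a ≠ b → g.loss a ≠ g.loss b

/-- The cell of `a` is nonempty and has dimension `d - 1`. -/
def ParetoOptimal (g : Game k d S) (a : Fin k) : Prop :=
  (g.cell a).Nonempty ∧ Module.finrank ℝ (vectorSpan ℝ (g.cell a)) + 1 = d

/-- The cells of `a` and `b` meet in a nonempty set of dimension `d - 2`. -/
def Neighbors (g : Game k d S) (a b : Fin k) : Prop :=
  (g.cell a ∩ g.cell b).Nonempty ∧
    Module.finrank ℝ (vectorSpan ℝ (g.cell a ∩ g.cell b)) + 2 = d

/-- `w` recovers the loss difference between `a` and `b` from the feedback. -/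
def Recovers (g : Game k d S) (w : Fin k → S → ℝ) (a b : Fin k) : Prop :=
  ∀ x, ∑ c, w c (g.feedback c x) = g.loss a x - g.loss b x

/-- Every pair of neighboring actions is globally observable. -/
def GloballyObservable (g : Game k d S) : Prop :=
  ∀ a b, g.Neighbors a b → ∃ w : Fin k → S → ℝ, g.Recovers w a b

/-- The data from which the loss-difference estimator is built: an in-tree on the actions whose
edges `(a, parent a)`, `a ≠ root`, join neighbors, and for each such edge a function `w a`
recovering the loss difference `L_a - L_{parent a}`. -/
structure EstimationTree (g : Game k d S) where
  root : Fin k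
  parent : Fin k → Fin k
  reaches_root : ∀ a, ∃ n, parent^[n] a = root
  neighbors : ∀ a, a ≠ root → g.Neighbors a (parent a)
  w : Fin k → Fin k → S → ℝ
  recovers : ∀ a, a ≠ root → g.Recovers (w a) a (parent a)

namespace EstimationTree

variable {g : Game k d S}

/-- The number of edges on the path from `b` to the root. -/
def depth (t : g.EstimationTree) (b : Fin k) : ℕ :=
  Nat.find (t.reaches_root b)

/-- `G(a, σ)_b`: the sum of `w_e(a, σ)` over the edges `e` on the path from `b` to the root. -/
def G (t : g.EstimationTree) (a : Fin k) (σ : S) (b : Fin k) : ℝ :=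
  ∑ i ∈ Finset.range (t.depth b), t.w (t.parent^[i] b) a σ

/-- The game-dependent constant `c_𝒢 = max {1, k ‖G‖_∞}`; the norm is the sup norm, that is,
the maximum of `|G(a, σ)_b|` over all `a`, `σ` and `b`. -/
noncomputable def cG [Fintype S] (t : g.EstimationTree) : ℝ :=
  max 1 ((k : ℝ) * ‖t.G‖)

end EstimationTree

end Game

/-! ## Interaction, regret and the self-bounding regime -/

/-- A learner assigns to the list of past (action, feedback) pairs, most recent first, the
probabilities with which the next action is drawn. -/
abbrev Learner (k : ℕ) (S : Type*) := List (Fin k × S) → Fin k → ℝ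

/-- An environment assigns to the list of past (action, outcome) pairs, most recent first, the
probabilities with which the next outcome is drawn. -/
abbrev Environment (k d : ℕ) := List (Fin k × Fin d) → Fin d → ℝ

/-- All values of the learner or environment `f` are probability vectors. -/
def IsKernel {ι : Type*} {n : ℕ} (f : ι → Fin n → ℝ) : Prop :=
  ∀ i, f i ∈ stdSimplex ℝ (Fin n)

section Interaction

variable {k d : ℕ} {S : Type*}

/-- The probability of a history (most recent round first). Given the past, the outcome and the
action of a round are drawn independently. -/
def historyProb (g : Game k d S) (π : Learner k S) (env : Environment k d) :
    List (Fin k × Fin d) → ℝ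
  | [] => 1
  | (a, x) :: h =>
      historyProb g π env h *
        (env h x * π (h.map fun p => (p.1, g.feedback p.1 p.2)) a)

/-- Expectation of a function of the history of the first `T` rounds. -/
def expect (g : Game k d S) (π : Learner k S) (env : Environment k d) (T : ℕ)
    (f : List (Fin k × Fin d) → ℝ) : ℝ :=
  ∑ ω : Fin T → Fin k × Fin d, historyProb g π env (List.ofFn ω) * f (List.ofFn ω)

/-- The (pseudo-)regret: expected cumulative loss of the learner minus that of the fixed action
with the smallest expected cumulative loss. -/
noncomputable def regret (g : Game k d S) (π : Learner k S) (env : Environment k d)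
    (T : ℕ) : ℝ :=
  expect g π env T (fun h => (h.map fun p => g.loss p.1 p.2).sum) -
    ⨅ a : Fin k, expect g π env T (fun h => (h.map fun p => g.loss a p.2).sum)

/-- The adversarial regime with a `(Δ, C, T)` self-bounding constraint. -/
def SelfBounding (g : Game k d S) (env : Environment k d) (Δ : Fin k → ℝ) (C : ℝ)
    (T : ℕ) : Prop :=
  ∀ π : Learner k S, IsKernel π →
    expect g π env T (fun h => (h.map fun p => Δ p.1).sum - C) ≤ regret g π env T

/-- `Δ_min`, the minimum of `Δ_a` over the actions `a ≠ a*`. -/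
noncomputable def gapMin (Δ : Fin k → ℝ) (astar : Fin k) : ℝ :=
  ⨅ a : {a : Fin k // a ≠ astar}, Δ a

end Interaction

/-! ## The algorithm: follow the regularized leader with Tsallis entropies and
stability-penalty-bias matching learning rate -/

section Algorithm

variable {k : ℕ} {S : Type*}

/-- The Tsallis entropy `H_α`. -/
noncomputable def tsallis (α : ℝ) (p : Fin k → ℝ) : ℝ :=
  (1 / α) * ∑ i, (p i ^ α - p i)

/-- The objective minimized by the learner, `Lhat` being the cumulative estimated loss. -/
noncomputable def ftrlObjective (α β βbar : ℝ) (Lhat p : Fin k → ℝ) : ℝ :=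
  ∑ i, Lhat i * p i + β * (-tsallis α p) + βbar * (-tsallis (1 - α) p)

/-- A minimizer of the objective over the simplex. -/
noncomputable def ftrl (α β βbar : ℝ) (Lhat : Fin k → ℝ) : Fin k → ℝ :=
  Classical.epsilon fun q => q ∈ stdSimplex ℝ (Fin k) ∧
    ∀ p ∈ stdSimplex ℝ (Fin k), ftrlObjective α β βbar Lhat q ≤ ftrlObjective α β βbar Lhat p

/-- The minimizer exists. -/
theorem ftrl_spec {α : ℝ} (h0 : 0 < α) (h1 : α < 1) (hk : 0 < k) (β βbar : ℝ)
    (Lhat : Fin k → ℝ) :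
    ftrl α β βbar Lhat ∈ stdSimplex ℝ (Fin k) ∧
      ∀ p ∈ stdSimplex ℝ (Fin k),
        ftrlObjective α β βbar Lhat (ftrl α β βbar Lhat) ≤ ftrlObjective α β βbar Lhat p := by
  have hc : Continuous (ftrlObjective (k := k) α β βbar Lhat) := by
    have hp : ∀ (i : Fin k) (s : ℝ), 0 < s → Continuous fun p : Fin k → ℝ => p i ^ s :=
      fun i s hs => (continuous_apply i).rpow_const fun _ => Or.inr hs.le
    have hT : ∀ s : ℝ, 0 < s → Continuous (tsallis (k := k) s) := fun s hs =>
      continuous_const.mul (continuous_finsetSum _ fun i _ => (hp i s hs).sub (continuous_apply i))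
    have hl : Continuous fun p : Fin k → ℝ => ∑ i, Lhat i * p i :=
      continuous_finsetSum _ fun i _ => continuous_const.mul (continuous_apply i)
    exact (hl.add (continuous_const.mul (hT α h0).neg)).add
      (continuous_const.mul (hT (1 - α) (by linarith)).neg)
  obtain ⟨q, hq, hmin⟩ := (isCompact_stdSimplex ℝ (Fin k)).exists_isMinOn
    ⟨_, single_mem_stdSimplex ℝ (⟨0, hk⟩ : Fin k)⟩ hc.continuousOn
  exact Classical.epsilon_spec (p := fun q => q ∈ stdSimplex ℝ (Fin k) ∧
    ∀ p ∈ stdSimplex ℝ (Fin k), ftrlObjective α β βbar Lhat q ≤ ftrlObjective α β βbar Lhat p)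
    ⟨q, hq, fun p hp => hmin hp⟩

/-- A rule selecting an index of a maximal coordinate (ties are broken in any way). -/
def IsArgmaxRule (I : (Fin k → ℝ) → Fin k) : Prop :=
  ∀ (q : Fin k → ℝ) (i : Fin k), q i ≤ q (I q)

/-- `q_* = min {q_I, 1 - q_I}` for the maximal coordinate `q_I`. -/
noncomputable def qStar (I : (Fin k → ℝ) → Fin k) (q : Fin k → ℝ) : ℝ :=
  min (q (I q)) (1 - q (I q))

/-- The stability component `z_t`. -/
noncomputable def zVal (c α : ℝ) (I : (Fin k → ℝ) → Fin k) (q : Fin k → ℝ) : ℝ :=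
  4 * c ^ 2 / (1 - α) *
    (∑ i ∈ Finset.univ.filter (fun i => i ≠ I q), q i ^ (2 - α) + qStar I q ^ (2 - α))

/-- The bias component `u_t`. -/
noncomputable def uVal (c α : ℝ) (I : (Fin k → ℝ) → Fin k) (q : Fin k → ℝ) : ℝ :=
  8 * c / (1 - α) * qStar I q ^ (1 - α)

/-- The exploration rate `γ_t`. -/
noncomputable def gammaVal (c α : ℝ) (I : (Fin k → ℝ) → Fin k) (q : Fin k → ℝ) (β : ℝ) : ℝ :=
  Real.sqrt (zVal c α I q / β) + uVal c α I q / β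

/-- The action probabilities `p_t = (1 - γ_t) q_t + γ_t 1/k`. -/
noncomputable def actionProb (c α : ℝ) (I : (Fin k → ℝ) → Fin k) (q : Fin k → ℝ) (β : ℝ) :
    Fin k → ℝ :=
  fun i => (1 - gammaVal c α I q β) * q i + gammaVal c α I q β * (1 / (k : ℝ))

/-- The regularization parameter `β̄`. -/
noncomputable def betaBar (k : ℕ) (c α β₁ : ℝ) : ℝ :=
  32 * c * Real.sqrt k / ((1 - α) ^ 2 * Real.sqrt β₁)

/-- The state of the algorithm before a round: cumulative estimated loss and `β_t`. -/
structure AlgState (k : ℕ) where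
  Lhat : Fin k → ℝ
  β : ℝ

/-- The vector `q_t` computed from the state. -/
noncomputable def AlgState.q (c α β₁ : ℝ) (s : AlgState k) : Fin k → ℝ :=
  ftrl α s.β (betaBar k c α β₁) s.Lhat

/-- The action probabilities `p_t` computed from the state. -/
noncomputable def AlgState.p (c α β₁ : ℝ) (I : (Fin k → ℝ) → Fin k) (s : AlgState k) :
    Fin k → ℝ :=
  actionProb c α I (s.q c α β₁) s.β

/-- The state after the given list of past (action, feedback) pairs, most recent first:
importance-weighted estimation `ŷ_t = G(A_t, σ_t) / p_{t,A_t}` and the update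
`β_{t+1} = β_t + (2 √(z_t / β_t) + u_t / β_t) / H_α(q_t)`. -/
noncomputable def algState (G : Fin k → S → Fin k → ℝ) (c α β₁ : ℝ)
    (I : (Fin k → ℝ) → Fin k) : List (Fin k × S) → AlgState k
  | [] => ⟨fun _ => 0, β₁⟩
  | (a, σ) :: h =>
      let s := algState G c α β₁ I h
      let q := s.q c α β₁
      { Lhat := fun b => s.Lhat b + G a σ b / s.p c α β₁ I a
        β := s.β + 1 / tsallis α q *
          (2 * Real.sqrt (zVal c α I q / s.β) + uVal c α I q / s.β) }

/-- The algorithm with the parameters for partial monitoring, as a learner. -/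
noncomputable def algorithm {d : ℕ} [Fintype S] {g : Game k d S} (t : g.EstimationTree)
    (α β₁ : ℝ) (I : (Fin k → ℝ) → Fin k) : Learner k S :=
  fun h => (algState t.G t.cG α β₁ I h).p t.cG α β₁ I

end Algorithm

/-! ## The constants in the bounds -/

/-- The value `z_max`: an upper bound of all `z_t`. -/
noncomputable def zMax (c α : ℝ) : ℝ := 4 * c ^ 2 / (1 - α)

/-- The value `u_max`: an upper bound of all `u_t`. -/
noncomputable def uMax (c α : ℝ) : ℝ := 8 * c / (1 - α)

/-- The entropy `H_α(1/k)` of the uniform distribution on `k` actions. -/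
noncomputable def hUnif (k : ℕ) (α : ℝ) : ℝ := tsallis α (fun _ : Fin k => 1 / (k : ℝ))

/-- `κ = √(z_max / β₁) + u_max / β₁ + β₁ h₁ + β̄ h̄`, where `h₁ = H_α(1/k)` (the first iterate is
uniform) and `h̄ = H_{1-α}(1/k)`. -/
noncomputable def kappa (k : ℕ) (c α β₁ : ℝ) : ℝ :=
  Real.sqrt (zMax c α / β₁) + uMax c α / β₁ + β₁ * hUnif k α +
    betaBar k c α β₁ * hUnif k (1 - α)

/-- `τ = 1 / Δ_min ^ 3 + C / Δ_min`. -/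
noncomputable def tau (Δmin C : ℝ) : ℝ := 1 / Δmin ^ 3 + C / Δmin

/-- `κ' = κ + ((z_max h₁)^{1/3} + √(u_max h₁)) τ^{2/3}`. -/
noncomputable def kappa' (k : ℕ) (c α β₁ Δmin C : ℝ) : ℝ :=
  kappa k c α β₁ +
    ((zMax c α * hUnif k α) ^ (1 / 3 : ℝ) + Real.sqrt (uMax c α * hUnif k α)) *
      tau Δmin C ^ (2 / 3 : ℝ)

/-- The exponent `α = 1 - 1 / ln k`. -/
noncomputable def alphaOf (k : ℕ) : ℝ := 1 - 1 / Real.log k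

end PartialMonitoring

open PartialMonitoring

namespace PartialMonitoring

/-! ### Real powers and Bregman divergences -/

/-! The regret is charged to the quantity `√(z_t/β_t) + u_t/β_t` of each round (`AlgState.cost`,
equal to the exploration rate), and these costs are then summed in two ways.

One round. Fix a comparator `b` and take as potential the minimal value of the regularized objective
minus the estimated loss of `b`. It is never positive, and initially it is at least `-(β₁ h₁ + β̄
h̄)`. At the minimizer the first-order terms cancel, so the excess of the objective is exactly a
Bregman divergence (`IsFtrlMin.objective_sub`). Hence the loss of `q_t` relative to `b` is at most
the growth of the potential, plus a stability term, plus the entropy penalty `(β_{t+1} - β_t)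
H(q_{t+1})`. In expectation the stability term is of order `z_t / (β_t γ_t)` and exploration costs
`γ_t`; since `γ_t ≥ √(z_t/β_t)`, both are within a constant of `γ_t`. The part `u_t/β_t` of `γ_t`
keeps the loss estimates so small, and `β̄` makes the growth of `β` so harmless, that `q_{t+1} ≤ 4
q_t` in every coordinate (`AlgState.next_q_le`). Then `H(q_{t+1}) ≤ 4 H(q_t)`, and the update rule
of `β` turns the penalty into a multiple of the cost. This gives `AlgState.round_le`; a
supermartingale argument sums it to `regret_le`.

Adversarial regime. Along each single history, `β^{3/2}` grows by at least `3 √z / H` and `β²` by at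
least `2 u / H` per round, where `H` bounds the entropies. The costs are therefore dominated by
increments of the powers `2/3` and `1/2` of accumulated weights (`MatchingRate.cum_cost_le`).

Self-bounding regime. Young's inequality splits a cost into `θ √(z η)` or `θ² u η`, with `η` the
entropy, and `θ⁻²` times the increment of a logarithm. Both `√(z η)` and `u η` are linear in `1 -
q_{t,a*}`, up to factors in `c` and `ln k` (`sqrt_mul_tsallis_le`, `uVal_mul_tsallis_le`). The
self-bounding constraint bounds the expected sum of these gaps by `(Reg + C)/Δ_min` up to a constant
(`expect_totalGap_le`), and a small `θ` lets the regret be absorbed (`exists_balance`,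
`le_of_selfBounding`). To obtain `ln (T/τ)` instead of `ln T`, the entropies are truncated from
below at a level depending on `τ/T`, and the logarithm is used only once the accumulated weights
exceed a threshold proportional to `τ` (`MatchingRate.cum_cost_le_log`). -/

theorem half_rpow_le {x : ℝ} (h0 : 0 ≤ x) (h1 : x ≤ 1) : (1 / 2 : ℝ) ^ x ≤ 1 - x / 2 := by
  have := rpow_one_add_le_one_add_mul_self (s := -(1 / 2)) (by norm_num) h0 h1
  norm_num at this ⊢
  linarith

theorem quarter_rpow_le {x : ℝ} (h0 : 0 ≤ x) (h1 : x ≤ 1) :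
    (1 / 4 : ℝ) ^ x ≤ 1 - 3 / 4 * x := by
  have := rpow_one_add_le_one_add_mul_self (s := -(3 / 4)) (by norm_num) h0 h1
  norm_num at this ⊢
  linarith

/-- Bregman divergence of `x ↦ -x ^ s / s`. -/
noncomputable def breg (s r q : ℝ) : ℝ := (q ^ s - r ^ s) / s + q ^ (s - 1) * (r - q)

/-- By homogeneity only the ratio `r / q` matters, so lower bounds reduce to one-variable
inequalities. -/
theorem breg_eq {s r q : ℝ} (hr : 0 ≤ r) (hq : 0 < q) :
    breg s r q = q ^ s * ((1 - (r / q) ^ s) / s + (r / q - 1)) := by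
  have h1 : q ^ (s - 1) = q ^ s / q := Real.rpow_sub_one hq.ne' s
  have h2 : (r / q) ^ s = r ^ s / q ^ s := Real.div_rpow hr hq.le s
  have h3 : q ^ s ≠ 0 := (Real.rpow_pos_of_pos hq s).ne'
  have h4 : q ≠ 0 := hq.ne'
  rw [breg, h1, h2]
  have e1 : q ^ s * (1 - r ^ s / q ^ s) = q ^ s - r ^ s := by field_simp
  rw [mul_add, ← mul_div_assoc, e1]
  congr 1
  field_simp

theorem breg_nonneg {s r q : ℝ} (h0 : 0 < s) (h1 : s ≤ 1) (hr : 0 ≤ r) (hq : 0 < q) :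
    0 ≤ breg s r q := by
  rw [breg_eq hr hq]
  refine mul_nonneg (Real.rpow_nonneg hq.le s) ?_
  have hx : 0 ≤ r / q := by positivity
  have := rpow_one_add_le_one_add_mul_self (s := r / q - 1) (by linarith) h0.le h1
  rw [add_sub_cancel] at this
  have h2 : -(r / q - 1) ≤ (1 - (r / q) ^ s) / s := by
    rw [le_div_iff₀ h0]; linarith
  linarith

/-- With `t = √(r/q)`, Bernoulli's inequality for `t ^ s`, squared, leaves the exact remainder `(1 -
s)(t - 1)²`. The hypothesis gives `t ≤ 2`, so `(t² - 1)² ≤ 9 (t - 1)²`; this is the 9. The factor `1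
- s` is the curvature that is lost as `s` tends to 1. -/
theorem breg_ge_sq {s r q : ℝ} (h0 : 0 < s) (h1 : s ≤ 1) (hr : 0 ≤ r) (hq : 0 < q)
    (hrq : r ≤ 4 * q) :
    (1 - s) / 9 * q ^ (s - 2) * (r - q) ^ 2 ≤ breg s r q := by
  rw [breg_eq hr hq]
  have hx : 0 ≤ r / q := by positivity
  set x := r / q with hxdef
  have hx4 : x ≤ 4 := by rw [hxdef, div_le_iff₀ hq]; exact hrq
  have h2 : q ^ (s - 2) = q ^ s / q ^ 2 := by
    rw [Real.rpow_sub hq]; norm_num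
  have hr' : r - q = q * (x - 1) := by rw [hxdef]; field_simp
  have hkey : (1 - s) / 9 * (x - 1) ^ 2 ≤ (1 - x ^ s) / s + (x - 1) := by
    set t := Real.sqrt x with ht
    have ht0 : 0 ≤ t := Real.sqrt_nonneg x
    have htx : t ^ 2 = x := Real.sq_sqrt hx
    have ht2 : t ≤ 2 := by nlinarith
    have hb := rpow_one_add_le_one_add_mul_self (s := t - 1) (by linarith) h0.le h1
    rw [add_sub_cancel] at hb
    have hxs : x ^ s = (t ^ s) ^ 2 := by
      rw [← htx, ← Real.rpow_natCast, ← Real.rpow_natCast, ← Real.rpow_mul ht0,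
        ← Real.rpow_mul ht0, mul_comm]
    have hts : 0 ≤ t ^ s := Real.rpow_nonneg ht0 s
    have hsq : x ^ s ≤ (1 + s * (t - 1)) ^ 2 := by
      rw [hxs]; exact pow_le_pow_left₀ hts hb 2
    have h3 : (1 - s) * (t - 1) ^ 2 - (x - 1) ≤ (1 - x ^ s) / s := by
      rw [le_div_iff₀ h0, ← htx]; rw [← htx] at hsq; nlinarith
    have h4 : (x - 1) ^ 2 ≤ 9 * (t - 1) ^ 2 := by
      rw [← htx]
      have : (t ^ 2 - 1) ^ 2 = (t + 1) ^ 2 * (t - 1) ^ 2 := by ring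
      rw [this]
      exact mul_le_mul_of_nonneg_right (by nlinarith) (sq_nonneg _)
    have h5 : (1 - s) / 9 * (x - 1) ^ 2 ≤ (1 - s) * (t - 1) ^ 2 := by
      have := mul_le_mul_of_nonneg_left h4 (by linarith : 0 ≤ (1 - s) / 9)
      linarith
    linarith
  rw [h2, hr']
  have : (1 - s) / 9 * (q ^ s / q ^ 2) * (q * (x - 1)) ^ 2
      = q ^ s * ((1 - s) / 9 * (x - 1) ^ 2) := by
    field_simp
  rw [this]
  exact mul_le_mul_of_nonneg_left hkey (Real.rpow_nonneg hq.le s)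

/-! ### The Tsallis entropy -/

section Tsallis

variable {k : ℕ}

theorem rpow_sub_self_nonneg {s x : ℝ} (h1 : s ≤ 1) (hx0 : 0 ≤ x) (hx1 : x ≤ 1) :
    x ≤ x ^ s := by
  rcases hx0.eq_or_lt with h | h
  · rw [← h]; positivity
  · simpa using Real.rpow_le_rpow_of_exponent_ge h hx1 h1

theorem mem_simplex_le_one {q : Fin k → ℝ} (hq : q ∈ stdSimplex ℝ (Fin k)) (i : Fin k) :
    q i ≤ 1 := by
  rw [← hq.2]
  exact Finset.single_le_sum (fun j _ => hq.1 j) (Finset.mem_univ i)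

theorem tsallis_nonneg {s : ℝ} (h0 : 0 < s) (h1 : s ≤ 1) {q : Fin k → ℝ}
    (hq : q ∈ stdSimplex ℝ (Fin k)) : 0 ≤ tsallis s q :=
  mul_nonneg (by positivity) (Finset.sum_nonneg fun i _ =>
    sub_nonneg.2 (rpow_sub_self_nonneg h1 (hq.1 i) (mem_simplex_le_one hq i)))

/-- Jensen's inequality for the concave power with uniform weights. -/
theorem sum_rpow_le {ι : Type*} (A : Finset ι) {s : ℝ} (h0 : 0 < s) (h1 : s ≤ 1)
    {x : ι → ℝ} (hx : ∀ i ∈ A, 0 ≤ x i) :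
    ∑ i ∈ A, x i ^ s ≤ (A.card : ℝ) ^ (1 - s) * (∑ i ∈ A, x i) ^ s := by
  rcases A.eq_empty_or_nonempty with rfl | hA
  · simp [h0.ne']
  have hn : (0 : ℝ) < A.card := by exact_mod_cast hA.card_pos
  have hJ := (Real.concaveOn_rpow h0.le h1).le_map_sum (t := A)
    (w := fun _ => 1 / (A.card : ℝ)) (p := x) (fun _ _ => by positivity)
    (by rw [Finset.sum_const, nsmul_eq_mul]; field_simp) (fun i hi => hx i hi)
  simp only [smul_eq_mul, ← Finset.mul_sum] at hJ
  have hS : 0 ≤ ∑ i ∈ A, x i := Finset.sum_nonneg hx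
  rw [Real.mul_rpow (by positivity) hS, Real.div_rpow zero_le_one hn.le, Real.one_rpow] at hJ
  rw [Real.rpow_sub hn, Real.rpow_one]
  have hns := Real.rpow_pos_of_pos hn s
  have := mul_le_mul_of_nonneg_left hJ hn.le
  calc ∑ i ∈ A, x i ^ s = A.card * (1 / A.card * ∑ i ∈ A, x i ^ s) := by field_simp
    _ ≤ _ := this
    _ = _ := by ring

theorem tsallis_eq {s : ℝ} {q : Fin k → ℝ} (hq : q ∈ stdSimplex ℝ (Fin k)) :
    tsallis s q = (1 / s) * (∑ i, q i ^ s - 1) := by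
  rw [tsallis, Finset.sum_sub_distrib, hq.2]

theorem hUnif_eq (hk : 0 < k) (s : ℝ) : hUnif k s = (1 / s) * ((k : ℝ) ^ (1 - s) - 1) := by
  have hk' : (0 : ℝ) < k := by exact_mod_cast hk
  rw [hUnif, tsallis]
  congr 1
  rw [Finset.sum_const, Finset.card_univ, Fintype.card_fin, nsmul_eq_mul,
    Real.div_rpow zero_le_one hk'.le, Real.one_rpow, Real.rpow_sub hk', Real.rpow_one]
  field_simp

theorem tsallis_le_hUnif (hk : 0 < k) {s : ℝ} (h0 : 0 < s) (h1 : s ≤ 1) {q : Fin k → ℝ}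
    (hq : q ∈ stdSimplex ℝ (Fin k)) : tsallis s q ≤ hUnif k s := by
  rw [tsallis_eq hq, hUnif_eq hk]
  have := sum_rpow_le Finset.univ h0 h1 (x := q) (fun i _ => hq.1 i)
  rw [hq.2, Real.one_rpow, mul_one, Finset.card_univ, Fintype.card_fin] at this
  exact mul_le_mul_of_nonneg_left (by linarith) (by positivity)

theorem tsallis_single {s : ℝ} (h0 : 0 < s) (a : Fin k) :
    tsallis s (Pi.single a (1 : ℝ)) = 0 := by
  rw [tsallis, Finset.sum_eq_zero, mul_zero]
  intro i _
  rcases eq_or_ne i a with rfl | h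
  · simp
  · simp [Pi.single_eq_of_ne h, Real.zero_rpow h0.ne']

/-- The function `x ^ s - x` is concave and vanishes at 0 and 1. If `q ≤ r`, compare with the chord
from 0 to `r`; if `r ≤ q`, with the chord from `r` to 1. This is why both `r` and `1 - r` have to be
controlled. -/
theorem rpow_sub_self_le {s C q r : ℝ} (h0 : 0 < s) (h1 : s ≤ 1) (hC : 0 ≤ C)
    (hq0 : 0 ≤ q) (hq1 : q ≤ 1) (hr0 : 0 ≤ r) (hr1 : r ≤ 1) (hrq : r ≤ C * q)
    (hrq' : 1 - r ≤ C * (1 - q)) : r ^ s - r ≤ C * (q ^ s - q) := by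
  have hc := Real.concaveOn_rpow h0.le h1
  have hfr : r ≤ r ^ s := rpow_sub_self_nonneg h1 hr0 hr1
  have hfq : q ≤ q ^ s := rpow_sub_self_nonneg h1 hq0 hq1
  rcases le_total q r with h | h
  · rcases hr0.eq_or_lt with h' | h'
    · rw [← h', Real.zero_rpow h0.ne']; nlinarith
    have := hc.2 (Set.mem_Ici.2 hr0) (Set.mem_Ici.2 le_rfl)
      (show 0 ≤ q / r by positivity) (show 0 ≤ 1 - q / r by rw [sub_nonneg, div_le_one h']; exact h) (by ring)
    simp only [smul_eq_mul, mul_zero, add_zero, Real.zero_rpow h0.ne',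
      div_mul_cancel₀ q h'.ne'] at this
    have h3 : q / r * (r ^ s - r) ≤ q ^ s - q := by
      rw [mul_sub, div_mul_cancel₀ q h'.ne']; linarith
    have h4 : 1 ≤ C * (q / r) := by
      rw [← mul_div_assoc, le_div_iff₀ h']; linarith
    nlinarith [mul_le_mul_of_nonneg_left h3 hC, mul_le_mul_of_nonneg_right h4 (sub_nonneg.2 hfr)]
  · rcases hr1.eq_or_lt with h' | h'
    · rw [h', Real.one_rpow]; nlinarith
    have hr' : 0 < 1 - r := by linarith
    have hw : (1 - q) / (1 - r) * r + (1 - (1 - q) / (1 - r)) = q := by field_simp; ring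
    have := hc.2 (Set.mem_Ici.2 hr0) (Set.mem_Ici.2 zero_le_one)
      (show 0 ≤ (1 - q) / (1 - r) from div_nonneg (by linarith) hr'.le)
      (show 0 ≤ 1 - (1 - q) / (1 - r) by rw [sub_nonneg, div_le_one hr']; linarith) (by ring)
    simp only [smul_eq_mul, mul_one, Real.one_rpow, hw] at this
    have h3 : (1 - q) / (1 - r) * (r ^ s - r) ≤ q ^ s - q := by
      rw [mul_sub]; linarith
    have h4 : 1 ≤ C * ((1 - q) / (1 - r)) := by
      rw [← mul_div_assoc, le_div_iff₀ hr']; linarith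
    nlinarith [mul_le_mul_of_nonneg_left h3 hC, mul_le_mul_of_nonneg_right h4 (sub_nonneg.2 hfr)]

/-- A coordinatewise bound also controls the complements, because `1 - r i` is the sum of the other
coordinates; the scalar comparison then applies to each summand. -/
theorem tsallis_le_mul {s C : ℝ} (h0 : 0 < s) (h1 : s ≤ 1) (hC : 0 ≤ C) {q r : Fin k → ℝ}
    (hq : q ∈ stdSimplex ℝ (Fin k)) (hr : r ∈ stdSimplex ℝ (Fin k))
    (hrq : ∀ i, r i ≤ C * q i) :
    tsallis s r ≤ C * tsallis s q := by
  rw [tsallis, tsallis, mul_left_comm C]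
  refine mul_le_mul_of_nonneg_left ?_ (one_div_nonneg.2 h0.le)
  rw [Finset.mul_sum]
  refine Finset.sum_le_sum fun i _ => ?_
  have e : ∀ p : Fin k → ℝ, p ∈ stdSimplex ℝ (Fin k) →
      1 - p i = ∑ j ∈ Finset.univ.erase i, p j := fun p hp => by
    rw [← hp.2, ← Finset.add_sum_erase _ _ (Finset.mem_univ i)]; ring
  refine rpow_sub_self_le h0 h1 hC (hq.1 i) (mem_simplex_le_one hq i) (hr.1 i)
    (mem_simplex_le_one hr i) (hrq i) ?_
  rw [e r hr, e q hq, Finset.mul_sum]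
  exact Finset.sum_le_sum fun j _ => hrq j



variable {I : (Fin k → ℝ) → Fin k} {q : Fin k → ℝ}

theorem le_qStar (hI : IsArgmaxRule I) (hq : q ∈ stdSimplex ℝ (Fin k)) {i : Fin k}
    (hi : i ≠ I q) : q i ≤ qStar I q := by
  refine le_min (hI q i) ?_
  have : q i + q (I q) ≤ ∑ j, q j := by
    rw [← Finset.sum_pair hi]
    exact Finset.sum_le_sum_of_subset_of_nonneg (Finset.subset_univ _) fun j _ _ => hq.1 j
  rw [hq.2] at this
  linarith

theorem sum_ne_eq (hq : q ∈ stdSimplex ℝ (Fin k)) (i : Fin k) :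
    ∑ j ∈ Finset.univ.filter (fun j => j ≠ i), q j = 1 - q i := by
  rw [← hq.2, ← Finset.add_sum_erase _ _ (Finset.mem_univ i), Finset.filter_ne']; ring

theorem qStar_le_half : qStar I q ≤ 1 / 2 := by
  unfold qStar
  rcases le_total (q (I q)) (1 / 2) with h | h
  · exact (min_le_left _ _).trans h
  · exact (min_le_right _ _).trans (by linarith)

theorem qStar_nonneg (hq : q ∈ stdSimplex ℝ (Fin k)) : 0 ≤ qStar I q :=
  le_min (hq.1 _) (sub_nonneg.2 (mem_simplex_le_one hq _))

/-- Write `x = x ^ s * x ^ (1 - s)` and bound the second factor by `(1/2) ^ (1 - s)`. -/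
theorem rpow_ge_of_le_half {s x : ℝ} (h0 : 0 ≤ s) (h1 : s ≤ 1) (hx0 : 0 ≤ x)
    (hx : x ≤ 1 / 2) : (1 - s) / 2 * x ^ s ≤ x ^ s - x := by
  rcases hx0.eq_or_lt with h | h
  · rw [← h]
    have : (0 : ℝ) ≤ 0 ^ s := Real.rpow_nonneg le_rfl s
    nlinarith
  have e : x = x ^ s * x ^ (1 - s) := by
    rw [← Real.rpow_add h]; simp
  have h2 : x ^ (1 - s) ≤ 1 - (1 - s) / 2 :=
    (Real.rpow_le_rpow hx0 hx (by linarith)).trans (half_rpow_le (by linarith) (by linarith))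
  have h3 := Real.rpow_nonneg hx0 s
  have : x ≤ x ^ s * (1 - (1 - s) / 2) := by
    calc x = x ^ s * x ^ (1 - s) := e
      _ ≤ _ := mul_le_mul_of_nonneg_left h2 h3
  linarith

/-- If the largest coordinate is at most `1/2`, its summand alone suffices. Otherwise the remaining
coordinates are at most `1/2` and sum to `q_*`, and subadditivity of the power handles them
together. This makes the increment of `β` bounded by a power of `q_*`. -/
theorem tsallis_ge (hI : IsArgmaxRule I) {s : ℝ} (h0 : 0 < s) (h1 : s ≤ 1)
    (hq : q ∈ stdSimplex ℝ (Fin k)) :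
    (1 - s) / 2 * qStar I q ^ s ≤ tsallis s q := by
  have hf : ∀ i, 0 ≤ q i ^ s - q i := fun i =>
    sub_nonneg.2 (rpow_sub_self_nonneg h1 (hq.1 i) (mem_simplex_le_one hq i))
  have key : (1 - s) / 2 * qStar I q ^ s ≤ ∑ i, (q i ^ s - q i) := by
    rcases le_total (q (I q)) (1 / 2) with h | h
    · have e : qStar I q = q (I q) := min_eq_left (by linarith)
      rw [e]
      exact (rpow_ge_of_le_half h0.le h1 (hq.1 _) h).trans
        (Finset.single_le_sum (f := fun i => q i ^ s - q i) (fun i _ => hf i)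
          (Finset.mem_univ (I q)))
    · have e : qStar I q = 1 - q (I q) := min_eq_right (by linarith)
      have h2 : (∑ j ∈ Finset.univ.filter (fun j => j ≠ I q), q j) ^ s ≤
          ∑ j ∈ Finset.univ.filter (fun j => j ≠ I q), q j ^ s := by
        refine Finset.le_sum_of_subadditive_on_pred (fun x : ℝ => x ^ s) (fun x => 0 ≤ x)
          (by simp [h0.ne']) (fun x y hx hy => Real.rpow_add_le_add_rpow hx hy h0.le h1)
          (fun x y hx hy => add_nonneg hx hy) q (fun i _ => hq.1 i)
      rw [sum_ne_eq hq] at h2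
      rw [e]
      calc (1 - s) / 2 * (1 - q (I q)) ^ s
          ≤ (1 - s) / 2 * ∑ j ∈ Finset.univ.filter (fun j => j ≠ I q), q j ^ s :=
            mul_le_mul_of_nonneg_left h2 (by linarith)
        _ ≤ ∑ j ∈ Finset.univ.filter (fun j => j ≠ I q), (q j ^ s - q j) := by
            rw [Finset.mul_sum]
            refine Finset.sum_le_sum fun j hj => rpow_ge_of_le_half h0.le h1 (hq.1 _) ?_
            exact (le_qStar hI hq (Finset.mem_filter.1 hj).2).trans qStar_le_half
        _ ≤ _ := Finset.sum_le_sum_of_subset_of_nonneg (Finset.subset_univ _) fun j _ _ => hf j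
  have h2 : 1 ≤ 1 / s := by rw [le_div_iff₀ h0]; linarith
  rw [tsallis]
  have h3 := Finset.sum_nonneg fun i (_ : i ∈ Finset.univ) => hf i
  nlinarith

/-- Since `q i ^ s ≤ 1` cancels the `-1`, only the other coordinates, of total mass `1 - q i`,
contribute. With `s = alphaOf k` the factor `k ^ (1 - s)` is `e`. -/
theorem tsallis_le_gap {s : ℝ} (h0 : 0 < s) (h1 : s ≤ 1)
    (hq : q ∈ stdSimplex ℝ (Fin k)) (i : Fin k) :
    tsallis s q ≤ (1 / s) * ((k : ℝ) ^ (1 - s) * (1 - q i) ^ s) := by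
  rw [tsallis_eq hq]
  refine mul_le_mul_of_nonneg_left ?_ (by positivity)
  rw [← Finset.add_sum_erase _ _ (Finset.mem_univ i), ← Finset.filter_ne']
  have h2 := sum_rpow_le (Finset.univ.filter (fun j => j ≠ i)) h0 h1 (x := q) fun i _ => hq.1 i
  rw [sum_ne_eq hq] at h2
  have h3 : q i ^ s ≤ 1 := Real.rpow_le_one (hq.1 i) (mem_simplex_le_one hq i) h0.le
  have h4 : ((Finset.univ.filter (fun j => j ≠ i)).card : ℝ) ≤ k := by
    have := Finset.card_le_univ (Finset.univ.filter (fun j => j ≠ i))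
    rw [Fintype.card_fin] at this
    exact_mod_cast this
  have h5 := mul_le_mul_of_nonneg_right (Real.rpow_le_rpow (by positivity) h4
    (by linarith : 0 ≤ 1 - s))
    (Real.rpow_nonneg (sub_nonneg.2 (mem_simplex_le_one hq i)) s)
  linarith

end Tsallis

/-! ### Optimality conditions for follow the regularized leader -/

section FTRL

variable {k : ℕ} {α β β' βb : ℝ}

/-- The summand of the objective that belongs to one coordinate. -/
noncomputable def coordObj (α β βb L x : ℝ) : ℝ :=
  L * x - β / α * (x ^ α - x) - βb / (1 - α) * (x ^ (1 - α) - x)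

/-- The derivative of `coordObj`. -/
noncomputable def coordDeriv (α β βb L x : ℝ) : ℝ :=
  L - β * (x ^ (α - 1) - 1 / α) - βb * (x ^ (1 - α - 1) - 1 / (1 - α))

theorem ftrlObjective_eq (α β βb : ℝ) (L p : Fin k → ℝ) :
    ftrlObjective α β βb L p = ∑ i, coordObj α β βb (L i) (p i) := by
  simp only [ftrlObjective, tsallis, coordObj, Finset.sum_sub_distrib, ← Finset.mul_sum]
  ring

theorem hasDerivAt_coordObj (h0 : 0 < α) (h1 : α < 1) (L : ℝ) {x : ℝ} (hx : 0 < x) :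
    HasDerivAt (coordObj α β βb L) (coordDeriv α β βb L x) x := by
  have hd : ∀ s : ℝ, HasDerivAt (fun x : ℝ => x ^ s - x) (s * x ^ (s - 1) - 1) x := fun s =>
    (Real.hasDerivAt_rpow_const (Or.inl hx.ne')).sub (hasDerivAt_id x)
  have h1' : 1 - α ≠ 0 := by linarith
  refine ((((hasDerivAt_id x).const_mul L).sub ((hd α).const_mul (β / α))).sub
    ((hd (1 - α)).const_mul (βb / (1 - α)))).congr_deriv ?_
  rw [coordDeriv]
  field_simp

theorem coordObj_sub (h0 : 0 < α) (h1 : α < 1) (L r q : ℝ) :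
    coordObj α β βb L r - coordObj α β βb L q =
      coordDeriv α β βb L q * (r - q) + β * breg α r q + βb * breg (1 - α) r q := by
  have h1' : 1 - α ≠ 0 := by linarith
  simp only [coordObj, coordDeriv, breg]
  field_simp
  ring

theorem coordObj_convex (h0 : 0 < α) (h1 : α < 1) (hβ : 0 ≤ β) (hb : 0 ≤ βb) (L : ℝ)
    {ε x y : ℝ} (hε : 0 ≤ ε) (hε1 : ε ≤ 1) (hx : 0 ≤ x) (hy : 0 ≤ y) :
    coordObj α β βb L ((1 - ε) * x + ε * y) ≤
      (1 - ε) * coordObj α β βb L x + ε * coordObj α β βb L y := by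
  have hc : ∀ s : ℝ, 0 ≤ s → s ≤ 1 →
      (1 - ε) * x ^ s + ε * y ^ s ≤ ((1 - ε) * x + ε * y) ^ s := fun s hs hs1 =>
    (Real.concaveOn_rpow hs hs1).2 (Set.mem_Ici.2 hx) (Set.mem_Ici.2 hy) (sub_nonneg.2 hε1) hε
      (by ring)
  have e1 := mul_le_mul_of_nonneg_left (hc α h0.le h1.le) (div_nonneg hβ h0.le)
  have e2 := mul_le_mul_of_nonneg_left (hc (1 - α) (by linarith) (by linarith))
    (div_nonneg hb (by linarith : 0 ≤ 1 - α))
  simp only [coordObj]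
  nlinarith

/-- `q` minimizes the regularized objective over the simplex. -/
def IsFtrlMin (α β βb : ℝ) (L q : Fin k → ℝ) : Prop :=
  q ∈ stdSimplex ℝ (Fin k) ∧
    ∀ p ∈ stdSimplex ℝ (Fin k), ftrlObjective α β βb L q ≤ ftrlObjective α β βb L p

/-- The entropy has infinite slope at the boundary: moving mass `ε/k` into an empty coordinate gains
order `ε ^ α`, while convexity limits the loss elsewhere to order `ε`. Positivity makes the
objective differentiable at the minimizer. -/
theorem IsFtrlMin.pos (h0 : 0 < α) (h1 : α < 1) (hβ : 0 < β) (hb : 0 ≤ βb)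
    {L q : Fin k → ℝ} (h : IsFtrlMin α β βb L q) (j : Fin k) : 0 < q j := by
  by_contra hj
  have hj0 : q j = 0 := le_antisymm (not_lt.1 hj) (h.1.1 j)
  have hk : (0 : ℝ) < k := by exact_mod_cast (Fin.pos j)
  have h1' : 0 < 1 - α := by linarith
  -- The competitor is the mixture `(1 - ε) q + ε · 1/k`; the point is that `B` does not depend on
  -- `ε`.
  obtain ⟨B, hB⟩ : ∃ B : ℝ, ∀ ε : ℝ, 0 < ε → ε ≤ 1 → β / α * (ε / k) ^ α ≤ ε * B := by
    refine ⟨∑ i ∈ Finset.univ.erase j, (coordObj α β βb (L i) (1 / k)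
      - coordObj α β βb (L i) (q i)) + (|L j| + β / α + βb / (1 - α)) / k, fun ε he he1 => ?_⟩
    have hp : (fun i => (1 - ε) * q i + ε * (1 / k)) ∈ stdSimplex ℝ (Fin k) := by
      refine ⟨fun i => ?_, ?_⟩
      · have := h.1.1 i
        have : 0 ≤ 1 - ε := by linarith
        positivity
      · rw [Finset.sum_add_distrib, ← Finset.mul_sum, h.1.2, Finset.sum_const,
          Finset.card_univ, Fintype.card_fin, nsmul_eq_mul]
        field_simp
        ring
    have hm := h.2 _ hp
    rw [ftrlObjective_eq, ftrlObjective_eq, ← Finset.add_sum_erase _ _ (Finset.mem_univ j),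
      ← Finset.add_sum_erase _ _ (Finset.mem_univ j)] at hm
    have hs : ∑ i ∈ Finset.univ.erase j, coordObj α β βb (L i) ((1 - ε) * q i + ε * (1 / k)) ≤
        ∑ i ∈ Finset.univ.erase j, (coordObj α β βb (L i) (q i) +
          ε * (coordObj α β βb (L i) (1 / k) - coordObj α β βb (L i) (q i))) := by
      refine Finset.sum_le_sum fun i _ => ?_
      have := coordObj_convex h0 h1 hβ.le hb (L i) he.le he1 (h.1.1 i)
        (by positivity : (0 : ℝ) ≤ 1 / k)
      linarith
    rw [Finset.sum_add_distrib, ← Finset.mul_sum] at hs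
    have hz : coordObj α β βb (L j) (q j) = 0 := by
      rw [hj0, coordObj, Real.zero_rpow h0.ne', Real.zero_rpow h1'.ne']; ring
    have hq : coordObj α β βb (L j) ((1 - ε) * q j + ε * (1 / k)) ≤
        (|L j| + β / α + βb / (1 - α)) * (ε / k) - β / α * (ε / k) ^ α := by
      have e : (1 - ε) * q j + ε * (1 / k) = ε / k := by rw [hj0]; ring
      rw [e, coordObj]
      have a1 : 0 ≤ βb / (1 - α) * (ε / k) ^ (1 - α) := by positivity
      have a2 : L j * (ε / k) ≤ |L j| * (ε / k) :=
        mul_le_mul_of_nonneg_right (le_abs_self _) (by positivity)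
      linarith
    rw [hz] at hm
    have e3 : ε * ((|L j| + β / α + βb / (1 - α)) / k) =
      (|L j| + β / α + βb / (1 - α)) * (ε / k) := by ring
    rw [mul_add, e3]
    linarith
  -- Since `1 - α > 0`, a small `x = ε/k` makes this factor less than 1, which contradicts the bound
  -- by `ε B`.
  have ht : Filter.Tendsto (fun x : ℝ => (B * k * α / β) * x ^ (1 - α)) (nhdsWithin 0 (Set.Ioi 0))
      (nhds ((B * k * α / β) * 0 ^ (1 - α))) :=
    ((Real.continuousAt_rpow_const 0 (1 - α) (Or.inr h1'.le)).tendsto.const_mul _).mono_left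
      nhdsWithin_le_nhds
  rw [Real.zero_rpow h1'.ne', mul_zero] at ht
  have hev := ((ht.eventually (gt_mem_nhds zero_lt_one)).and
    (Ioc_mem_nhdsGT (show (0 : ℝ) < 1 / k by positivity))).exists
  obtain ⟨x, hx1, hx0, hxk⟩ := hev
  have := hB (x * k) (by positivity) (by rw [le_div_iff₀ hk] at hxk; exact hxk)
  rw [mul_div_cancel_right₀ x hk.ne'] at this
  have hxa := Real.rpow_pos_of_pos hx0 α
  have e : x = x ^ α * x ^ (1 - α) := by rw [← Real.rpow_add hx0]; simp
  have h2 : x ^ α ≤ x ^ α * ((B * k * α / β) * x ^ (1 - α)) := by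
    calc x ^ α = (α / β) * (β / α * x ^ α) := by field_simp
      _ ≤ (α / β) * (x * k * B) := mul_le_mul_of_nonneg_left this (by positivity)
      _ = (α / β) * ((x ^ α * x ^ (1 - α)) * k * B) := by rw [← e]
      _ = _ := by ring
  nlinarith

/-- Stationarity under transfers of mass between two coordinates; the common value of the
derivatives is the Lagrange multiplier of the simplex constraint. -/
theorem IsFtrlMin.deriv_eq (h0 : 0 < α) (h1 : α < 1) (hβ : 0 < β) (hb : 0 ≤ βb)
    {L q : Fin k → ℝ} (h : IsFtrlMin α β βb L q) (i j : Fin k) :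
    coordDeriv α β βb (L i) (q i) = coordDeriv α β βb (L j) (q j) := by
  rcases eq_or_ne i j with rfl | hij
  · rfl
  have hi := h.pos h0 h1 hβ hb i
  have hj := h.pos h0 h1 hβ hb j
  set φ : ℝ → ℝ := fun t => coordObj α β βb (L i) (q i + t) + coordObj α β βb (L j) (q j - t)
  have hd : HasDerivAt φ (coordDeriv α β βb (L i) (q i) - coordDeriv α β βb (L j) (q j)) 0 := by
    have a1 : HasDerivAt (fun t : ℝ => q i + t) 1 0 := (hasDerivAt_id 0).const_add _
    have a2 : HasDerivAt (fun t : ℝ => q j - t) (-1) 0 := (hasDerivAt_id 0).const_sub _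
    have b1 := hasDerivAt_coordObj (β := β) (βb := βb) h0 h1 (L i) hi
    have b2 := hasDerivAt_coordObj (β := β) (βb := βb) h0 h1 (L j) hj
    rw [← add_zero (q i)] at b1
    rw [← sub_zero (q j)] at b2
    have := (b1.comp (0 : ℝ) a1).add (b2.comp (0 : ℝ) a2)
    rw [add_zero, sub_zero] at this
    exact this.congr_deriv (by ring)
  have hm : IsLocalMin φ 0 := by
    have hnb : Set.Ioo (-q i) (q j) ∈ nhds (0 : ℝ) := Ioo_mem_nhds (by linarith) hj
    filter_upwards [hnb] with t ht
    set p : Fin k → ℝ := Function.update (Function.update q i (q i + t)) j (q j - t) with hp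
    have hpi : p i = q i + t := by simp [hp, hij]
    have hpj : p j = q j - t := by simp [hp]
    have hpo : ∀ l ∈ (Finset.univ.erase i).erase j, p l = q l := fun l hl => by
      have h1 := Finset.ne_of_mem_erase hl
      have h2 := Finset.ne_of_mem_erase (Finset.mem_of_mem_erase hl)
      simp [hp, h1, h2]
    have hsplit : ∀ f : Fin k → ℝ, ∑ l, f l =
        f i + (f j + ∑ l ∈ (Finset.univ.erase i).erase j, f l) :=
      fun f => by
        rw [Finset.add_sum_erase _ _ (Finset.mem_erase.2 ⟨hij.symm, Finset.mem_univ j⟩),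
          Finset.add_sum_erase _ _ (Finset.mem_univ i)]
    have hps : p ∈ stdSimplex ℝ (Fin k) := by
      refine ⟨fun l => ?_, ?_⟩
      · by_cases hl : l = i
        · rw [hl, hpi]; linarith [ht.1]
        by_cases hl' : l = j
        · rw [hl', hpj]; linarith [ht.2]
        rw [hpo l (by simp [hl, hl'])]
        exact h.1.1 l
      · rw [hsplit, hpi, hpj, Finset.sum_congr rfl hpo, ← h.1.2, hsplit q]; ring
    have := h.2 p hps
    rw [ftrlObjective_eq, ftrlObjective_eq, hsplit, hsplit (fun l => coordObj α β βb (L l) (p l)),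
      hpi, hpj, Finset.sum_congr rfl (fun l hl => congrArg (coordObj α β βb (L l)) (hpo l hl))]
      at this
    simp only [φ, add_zero, sub_zero]
    linarith
  have := hm.hasDerivAt_eq_zero hd
  linarith

/-- The linear part carries the same multiplier in every coordinate and vanishes because both points
have total mass 1. Only the Bregman divergences remain, with equality. -/
theorem IsFtrlMin.objective_sub (h0 : 0 < α) (h1 : α < 1) (hβ : 0 < β) (hb : 0 ≤ βb)
    {L q r : Fin k → ℝ} (h : IsFtrlMin α β βb L q) (hr : r ∈ stdSimplex ℝ (Fin k)) :
    ftrlObjective α β βb L r - ftrlObjective α β βb L q =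
      ∑ i, (β * breg α (r i) (q i) + βb * breg (1 - α) (r i) (q i)) := by
  rw [ftrlObjective_eq, ftrlObjective_eq, ← Finset.sum_sub_distrib]
  rcases isEmpty_or_nonempty (Fin k) with _ | ⟨⟨j⟩⟩
  · simp
  have e : ∀ i, coordObj α β βb (L i) (r i) - coordObj α β βb (L i) (q i) =
      coordDeriv α β βb (L j) (q j) * (r i - q i) +
        (β * breg α (r i) (q i) + βb * breg (1 - α) (r i) (q i)) := fun i => by
    rw [coordObj_sub h0 h1, h.deriv_eq h0 h1 hβ hb i j, add_assoc]
  rw [Finset.sum_congr rfl fun i _ => e i, Finset.sum_add_distrib, ← Finset.mul_sum,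
    Finset.sum_sub_distrib, hr.2, h.1.2]
  ring

/-- The minimizers before and after a round are multiplicatively close in each coordinate
`i` for which the loss estimate is small and `β` grows little. -/
theorem IsFtrlMin.le_four_mul (h0 : 0 < α) (h1 : α < 1) (hβ : 0 < β) (hββ' : β ≤ β')
    (hb : 0 ≤ βb) {L y q r : Fin k → ℝ} (hq : IsFtrlMin α β βb L q)
    (hr : IsFtrlMin α β' βb (fun i => L i + y i) r) {i : Fin k}
    (hy : ∀ j, |y j| ≤ (1 - α) / 8 * β * q i ^ (α - 1))
    (hδ : β' - β ≤ β * (1 - α) / 2 + βb * (3 / 4 * α) * q i ^ (1 - 2 * α)) :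
    r i ≤ 4 * q i := by
  by_contra! hlt
  have hqi := hq.pos h0 h1 hβ hb i
  have hri := hr.pos h0 h1 (hβ.trans_le hββ') hb i
  -- Mass is conserved, so a coordinate that grows forces another one not to grow. Comparing the
  -- optimality conditions at `i` and `j` eliminates the multipliers.
  obtain ⟨j, -, hj⟩ : ∃ j ∈ Finset.univ, r j ≤ q j := by
    by_contra! hcon
    have := Finset.sum_lt_sum_of_nonempty ⟨i, Finset.mem_univ i⟩ hcon
    rw [hq.1.2, hr.1.2] at this
    exact lt_irrefl _ this
  have hqj := hq.pos h0 h1 hβ hb j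
  have hrj := hr.pos h0 h1 (hβ.trans_le hββ') hb j
  have eq := hq.deriv_eq h0 h1 hβ hb i j
  have er := hr.deriv_eq h0 h1 (hβ.trans_le hββ') hb i j
  simp only [coordDeriv] at eq er
  have m1 : q j ^ (α - 1) ≤ r j ^ (α - 1) :=
    Real.rpow_le_rpow_of_nonpos hrj hj (by linarith)
  have m2 : q j ^ (1 - α - 1) ≤ r j ^ (1 - α - 1) :=
    Real.rpow_le_rpow_of_nonpos hrj hj (by linarith)
  have m3 : βb * q j ^ (1 - α - 1) ≤ βb * r j ^ (1 - α - 1) := mul_le_mul_of_nonneg_left m2 hb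
  have m4 : β * q j ^ (α - 1) ≤ β' * r j ^ (α - 1) :=
    mul_le_mul hββ' m1 (Real.rpow_nonneg hqj.le _) (hβ.trans_le hββ').le
  have y1 := (abs_le.1 (hy i)).1
  have y2 := (abs_le.1 (hy j)).2
  have hlow : β * q i ^ (α - 1) + βb * q i ^ (1 - α - 1) -
      (1 - α) / 4 * β * q i ^ (α - 1) ≤ β' * r i ^ (α - 1) + βb * r i ^ (1 - α - 1) := by
    linarith
  have n1 : r i ^ (α - 1) < (4 * q i) ^ (α - 1) :=
    Real.rpow_lt_rpow_of_neg (by positivity) hlt (by linarith)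
  have n2 : r i ^ (1 - α - 1) ≤ (4 * q i) ^ (1 - α - 1) :=
    Real.rpow_le_rpow_of_nonpos (by positivity) hlt.le (by linarith)
  -- A growth of `r i` beyond `4 q i` lowers the two powers by factors `1 - (3/4)(1 - α)` and `1 -
  -- (3/4) α`. The loss estimates recover only `(1 - α)/4` of the first deficit; the growth
  -- condition on `β` allows the remaining `(1 - α)/2` and the whole second deficit.
  have four : ∀ s : ℝ, 0 ≤ s → s ≤ 1 → (4 : ℝ) ^ (-s) ≤ 1 - 3 / 4 * s := fun s hs hs1 => by
    have := quarter_rpow_le hs hs1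
    rwa [one_div, Real.inv_rpow (by norm_num), ← Real.rpow_neg (by norm_num)] at this
  have f1 := four (1 - α) (by linarith) (by linarith)
  have f2 := four α h0.le h1.le
  rw [neg_sub] at f1
  rw [Real.mul_rpow (by norm_num) hqi.le] at n1 n2
  rw [show 1 - α - 1 = -α by ring] at n2 hlow
  have hQ := Real.rpow_pos_of_pos hqi (α - 1)
  have hQ' := Real.rpow_pos_of_pos hqi (-α)
  have hQQ : q i ^ (1 - 2 * α) * q i ^ (α - 1) = q i ^ (-α) := by
    rw [← Real.rpow_add hqi]; ring_nf
  have s1 : β' * r i ^ (α - 1) < (β + (β' - β)) * (q i ^ (α - 1)) * (4 : ℝ) ^ (α - 1) := by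
    have := mul_lt_mul_of_pos_left n1 (hβ.trans_le hββ')
    linarith
  have s2 : (β + (β' - β)) * (q i ^ (α - 1)) * (4 : ℝ) ^ (α - 1) ≤
      β * q i ^ (α - 1) * (1 - 3 / 4 * (1 - α)) + (β' - β) * q i ^ (α - 1) := by
    have g1 := mul_le_mul_of_nonneg_left f1 (mul_pos hβ hQ).le
    have g2 : (4 : ℝ) ^ (α - 1) ≤ 1 := by linarith
    have g3 := mul_le_mul_of_nonneg_left g2 (mul_nonneg (sub_nonneg.2 hββ') hQ.le)
    linarith
  have s3 : βb * r i ^ (-α) ≤ βb * q i ^ (-α) * (1 - 3 / 4 * α) := by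
    have g1 := mul_le_mul_of_nonneg_left n2 hb
    have g2 := mul_le_mul_of_nonneg_left f2 (mul_nonneg hb hQ'.le)
    linarith
  have s4 := mul_le_mul_of_nonneg_right hδ hQ.le
  have s5 : (β * (1 - α) / 2 + βb * (3 / 4 * α) * q i ^ (1 - 2 * α)) * q i ^ (α - 1) =
      β * (1 - α) / 2 * q i ^ (α - 1) + βb * (3 / 4 * α) * q i ^ (-α) := by
    rw [← hQQ]; ring
  rw [s5] at s4
  linarith

/-- The stability term of one round; adding a constant to `y` makes the coordinate `m`
disappear from the bound. -/
theorem stability_le (h0 : 0 < α) (h1 : α < 1) (hβ : 0 < β) {y q r : Fin k → ℝ} {M : ℝ}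
    (hq : ∀ i, 0 < q i) (hr : ∀ i, 0 ≤ r i) (hsum : ∑ i, q i = ∑ i, r i)
    (hy : ∀ i, |y i| ≤ M) (m : Fin k) (hrq : ∀ i, i ≠ m → r i ≤ 4 * q i) :
    ∑ i, y i * (q i - r i) - ∑ i, β * breg α (r i) (q i) ≤
      9 * M ^ 2 / (β * (1 - α)) *
        ∑ i ∈ Finset.univ.filter (fun i => i ≠ m), q i ^ (2 - α) := by
  have e : ∑ i, y i * (q i - r i) = ∑ i, (y i - y m) * (q i - r i) := by
    simp only [sub_mul, Finset.sum_sub_distrib, ← Finset.mul_sum]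
    simp [mul_sub, Finset.sum_sub_distrib, hsum]
  rw [e, ← Finset.sum_sub_distrib, Finset.mul_sum, ← Finset.add_sum_erase _ _ (Finset.mem_univ m),
    ← Finset.filter_ne']
  have hm : (y m - y m) * (q m - r m) - β * breg α (r m) (q m) ≤ 0 := by
    have := mul_nonneg hβ.le (breg_nonneg h0 h1.le (hr m) (hq m))
    simp only [sub_self, zero_mul]
    linarith
  have hs : ∑ i ∈ Finset.univ.filter (fun i => i ≠ m),
      ((y i - y m) * (q i - r i) - β * breg α (r i) (q i)) ≤
      ∑ i ∈ Finset.univ.filter (fun i => i ≠ m), 9 * M ^ 2 / (β * (1 - α)) * q i ^ (2 - α) := by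
    refine Finset.sum_le_sum fun i hi => ?_
    have hbr := mul_le_mul_of_nonneg_left
      (breg_ge_sq h0 h1.le (hr i) (hq i) (hrq i (Finset.mem_filter.1 hi).2)) hβ.le
    have hQ : q i ^ (α - 2) = (q i ^ (2 - α))⁻¹ := by
      rw [← Real.rpow_neg (hq i).le, neg_sub]
    have hP := Real.rpow_pos_of_pos (hq i) (2 - α)
    rw [hQ] at hbr
    set P := q i ^ (2 - α)
    have h1' : 0 < 1 - α := by linarith
    have hl : (y i - y m) ^ 2 ≤ 4 * M ^ 2 := by
      have a1 := abs_le.1 (hy i)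
      have a2 := abs_le.1 (hy m)
      nlinarith
    have hA : 0 < β * ((1 - α) / 9 * P⁻¹) := by positivity
    set A := β * ((1 - α) / 9 * P⁻¹) with hAdef
    have hAM : 9 * M ^ 2 / (β * (1 - α)) * P = 4 * M ^ 2 / (4 * A) := by
      rw [hAdef]; field_simp
    rw [hAM]
    -- Completing the square: `a b - A b² ≤ a² / (4 A)`.
    have : (y i - y m) * (q i - r i) - A * (r i - q i) ^ 2 ≤ (y i - y m) ^ 2 / (4 * A) := by
      rw [le_div_iff₀ (by positivity)]
      nlinarith [sq_nonneg ((y i - y m) - 2 * A * (q i - r i))]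
    have h4 : (y i - y m) ^ 2 / (4 * A) ≤ 4 * M ^ 2 / (4 * A) :=
      div_le_div_of_nonneg_right hl (by positivity)
    have h5 : β * ((1 - α) / 9 * P⁻¹ * (r i - q i) ^ 2) = A * (r i - q i) ^ 2 := by
      rw [hAdef]; ring
    linarith
  linarith

end FTRL

/-! ### The exponent `1 - 1 / ln k` -/

section Exponent

variable {k : ℕ}

/-- From `log (e/3) ≤ e/3 - 1`. A margin above 1 is essential: at `k = 3` the exponent `1 - 1/ln k`
is barely positive, and `1/α` enters the constants. -/
theorem log_ge_of_three_le (hk : 3 ≤ k) : (109 / 100 : ℝ) ≤ Real.log k := by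
  have hk' : (3 : ℝ) ≤ k := by exact_mod_cast hk
  have h1 : Real.log 3 ≤ Real.log k := Real.log_le_log (by norm_num) hk'
  have h2 := Real.log_le_sub_one_of_pos (show 0 < Real.exp 1 / 3 by positivity)
  rw [Real.log_div (Real.exp_ne_zero 1) (by norm_num), Real.log_exp] at h2
  have := Real.exp_one_lt_d9
  linarith

theorem one_sub_alphaOf (k : ℕ) : 1 - alphaOf k = 1 / Real.log k := by
  rw [alphaOf]; ring

theorem alphaOf_lt_one (hk : 3 ≤ k) : alphaOf k < 1 := by
  have := log_ge_of_three_le hk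
  have h : 0 < 1 / Real.log k := by positivity
  rw [← one_sub_alphaOf] at h
  linarith

theorem alphaOf_ge (hk : 3 ≤ k) : 1 / 13 ≤ alphaOf k := by
  have := log_ge_of_three_le hk
  have h : 1 / Real.log k ≤ 12 / 13 := by
    rw [div_le_iff₀ (by linarith)]; linarith
  rw [alphaOf]; linarith

theorem alphaOf_pos (hk : 3 ≤ k) : 0 < alphaOf k := by
  have := alphaOf_ge hk
  linarith

theorem one_div_alphaOf_le (hk : 3 ≤ k) : 1 / alphaOf k ≤ 13 := by
  have := alphaOf_ge hk
  rw [div_le_iff₀ (alphaOf_pos hk)]; linarith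

/-- The reason for this exponent: the entropy `H_α` stays bounded uniformly in `k`, at the price of
a factor `1/(1 - α) = ln k` in the stability and bias components. -/
theorem rpow_one_sub_alphaOf (hk : 3 ≤ k) : (k : ℝ) ^ (1 - alphaOf k) = Real.exp 1 := by
  have := log_ge_of_three_le hk
  have hk' : (0 : ℝ) < k := by
    have : 0 < k := by omega
    exact_mod_cast this
  rw [one_sub_alphaOf, Real.rpow_def_of_pos hk', mul_one_div_cancel (by linarith)]

theorem one_le_hUnif (hk : 3 ≤ k) : 1 ≤ hUnif k (alphaOf k) := by
  rw [hUnif_eq (by omega), rpow_one_sub_alphaOf hk]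
  have h1 : 1 ≤ 1 / alphaOf k := by
    rw [le_div_iff₀ (alphaOf_pos hk)]; linarith [alphaOf_lt_one hk]
  have h2 := Real.exp_one_gt_d9
  nlinarith

theorem hUnif_le (hk : 3 ≤ k) : hUnif k (alphaOf k) ≤ 23 := by
  rw [hUnif_eq (by omega), rpow_one_sub_alphaOf hk]
  have h1 := one_div_alphaOf_le hk
  have h2 := Real.exp_one_lt_d9
  have h3 := Real.exp_one_gt_d9
  nlinarith

theorem hUnif_one_sub_nonneg (hk : 3 ≤ k) : 0 ≤ hUnif k (1 - alphaOf k) := by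
  have h1 := alphaOf_lt_one hk
  have h2 := alphaOf_pos hk
  have hk' : (1 : ℝ) ≤ k := by
    have : 1 ≤ k := by omega
    exact_mod_cast this
  rw [hUnif_eq (by omega), sub_sub_cancel]
  have := Real.one_le_rpow hk' h2.le
  exact mul_nonneg (one_div_nonneg.2 (by linarith)) (by linarith)

theorem hUnif_one_sub_le (hk : 3 ≤ k) : hUnif k (1 - alphaOf k) ≤ Real.log k * k := by
  have h1 := alphaOf_lt_one hk
  have hl := log_ge_of_three_le hk
  have hk' : (1 : ℝ) ≤ k := by
    have : 1 ≤ k := by omega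
    exact_mod_cast this
  rw [hUnif_eq (by omega), sub_sub_cancel, one_sub_alphaOf, one_div_one_div]
  have := Real.rpow_le_rpow_of_exponent_le hk' h1.le
  rw [Real.rpow_one] at this
  exact mul_le_mul_of_nonneg_left (by linarith) (by linarith)

end Exponent

/-! ### Stability and bias components -/

section Components

variable {k : ℕ} {c α β β₁ : ℝ} {I : (Fin k → ℝ) → Fin k} {q : Fin k → ℝ}

theorem zVal_nonneg (h1 : α < 1) (hq : q ∈ stdSimplex ℝ (Fin k)) : 0 ≤ zVal c α I q := by
  have : 0 < 1 - α := by linarith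
  have h2 := Real.rpow_nonneg (qStar_nonneg (I := I) hq) (2 - α)
  have h3 : 0 ≤ ∑ i ∈ Finset.univ.filter (fun i => i ≠ I q), q i ^ (2 - α) :=
    Finset.sum_nonneg fun i _ => Real.rpow_nonneg (hq.1 i) _
  rw [zVal]
  positivity

theorem uVal_nonneg (hc : 0 ≤ c) (h1 : α < 1) (hq : q ∈ stdSimplex ℝ (Fin k)) :
    0 ≤ uVal c α I q := by
  have : 0 < 1 - α := by linarith
  have h2 := Real.rpow_nonneg (qStar_nonneg (I := I) hq) (1 - α)
  rw [uVal]
  positivity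

theorem rpow_two_sub_le {x y : ℝ} (h1 : α < 1) (hx : 0 ≤ x) (hxy : x ≤ y) :
    x ^ (2 - α) ≤ x * y ^ (1 - α) := by
  have e : x ^ (2 - α) = x * x ^ (1 - α) := by
    rw [show 2 - α = 1 + (1 - α) by ring, Real.rpow_add_of_nonneg hx zero_le_one (by linarith),
      Real.rpow_one]
  rw [e]
  exact mul_le_mul_of_nonneg_left (Real.rpow_le_rpow hx hxy (by linarith)) hx

theorem rpow_two_sub_eq {x : ℝ} (h1 : α < 1) (hx : 0 ≤ x) :
    x ^ (2 - α) = x * x ^ (1 - α) := by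
  rw [show 2 - α = 1 + (1 - α) by ring, Real.rpow_add_of_nonneg hx zero_le_one (by linarith),
      Real.rpow_one]

theorem sum_rpow_two_sub_le {y : ℝ} (h1 : α < 1) (hq : q ∈ stdSimplex ℝ (Fin k))
    (hy : ∀ i, i ≠ I q → q i ≤ y) :
    ∑ i ∈ Finset.univ.filter (fun i => i ≠ I q), q i ^ (2 - α) ≤
      (1 - q (I q)) * y ^ (1 - α) := by
  rw [← sum_ne_eq hq, Finset.sum_mul]
  exact Finset.sum_le_sum fun i hi =>
    rpow_two_sub_le h1 (hq.1 i) (hy i (Finset.mem_filter.1 hi).2)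

/-- The sum is at most `1 - q_I` and the extra term at most `q_I`, so the bracket is at most 1. -/
theorem zVal_le_zMax (h1 : α < 1) (hq : q ∈ stdSimplex ℝ (Fin k)) :
    zVal c α I q ≤ zMax c α := by
  have h1' : 0 < 1 - α := by linarith
  have h2 := sum_rpow_two_sub_le (I := I) h1 hq fun i _ => mem_simplex_le_one hq i
  have h3 : qStar I q ^ (2 - α) ≤ q (I q) := by
    have hs := qStar_nonneg (I := I) hq
    have := rpow_two_sub_le (y := 1) h1 hs (qStar_le_half.trans (by norm_num))
    rw [Real.one_rpow, mul_one] at this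
    exact this.trans (min_le_left _ _)
  rw [Real.one_rpow, mul_one] at h2
  rw [zVal, zMax]
  exact mul_le_of_le_one_right (by positivity) (by linarith)

theorem uVal_le_uMax (hc : 0 ≤ c) (h1 : α < 1) (hq : q ∈ stdSimplex ℝ (Fin k)) :
    uVal c α I q ≤ uMax c α := by
  have h1' : 0 < 1 - α := by linarith
  rw [uVal, uMax]
  exact mul_le_of_le_one_right (by positivity)
    (Real.rpow_le_one (qStar_nonneg hq) (qStar_le_half.trans (by norm_num)) h1'.le)

/-- All coordinates but the largest are at most `q_*`, which leaves `1 - q_I + q_* ≤ k q_*`. If `q_I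
≤ 1/2` this is `1 ≤ k q_I`, true of a maximal coordinate; otherwise it is `2 ≤ k`. -/
theorem zVal_le_qStar (hI : IsArgmaxRule I) (hk : 2 ≤ k) (h1 : α < 1)
    (hq : q ∈ stdSimplex ℝ (Fin k)) :
    zVal c α I q ≤ 4 * c ^ 2 / (1 - α) * (k * qStar I q ^ (2 - α)) := by
  have h1' : 0 < 1 - α := by linarith
  have hk' : (2 : ℝ) ≤ k := by exact_mod_cast hk
  rw [zVal]
  refine mul_le_mul_of_nonneg_left ?_ (by positivity)
  have h2 := sum_rpow_two_sub_le (I := I) h1 hq fun i hi => le_qStar hI hq hi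
  have hs := qStar_nonneg (I := I) hq
  have hs1 := Real.rpow_nonneg hs (1 - α)
  rw [rpow_two_sub_eq h1 hs]
  have h3 : 1 - q (I q) + qStar I q ≤ k * qStar I q := by
    rcases le_total (q (I q)) (1 / 2) with h | h
    · have e : qStar I q = q (I q) := min_eq_left (by linarith)
      have : ∑ i, q i ≤ ∑ _i : Fin k, q (I q) := Finset.sum_le_sum fun i _ => hI q i
      rw [hq.2, Finset.sum_const, Finset.card_univ, Fintype.card_fin, nsmul_eq_mul] at this
      rw [e]; linarith
    · have e : qStar I q = 1 - q (I q) := min_eq_right (by linarith)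
      rw [← e]
      nlinarith
  nlinarith

theorem qStar_le_gap (hI : IsArgmaxRule I) (a : Fin k) : qStar I q ≤ 1 - q a :=
  (min_le_right _ _).trans (by linarith [hI q a])

/-- Since `q_* ≤ 1 - q_I ≤ 1 - q_a`, the bound holds for every action `a`; no knowledge of which
action is optimal is needed. -/
theorem zVal_le_gap (hI : IsArgmaxRule I) (h1 : α < 1)
    (hq : q ∈ stdSimplex ℝ (Fin k)) (a : Fin k) :
    zVal c α I q ≤ 8 * c ^ 2 / (1 - α) * (1 - q a) ^ (2 - α) := by
  have h1' : 0 < 1 - α := by linarith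
  have hs := qStar_nonneg (I := I) hq
  have ha : 0 ≤ 1 - q a := hs.trans (qStar_le_gap hI a)
  have h2 := sum_rpow_two_sub_le (I := I) (y := 1 - q a) h1 hq
    fun i hi => (le_qStar hI hq hi).trans (qStar_le_gap hI a)
  have h3 := Real.rpow_le_rpow hs (qStar_le_gap (q := q) hI a) (by linarith : 0 ≤ 2 - α)
  have h4 : (1 - q (I q)) * (1 - q a) ^ (1 - α) ≤ (1 - q a) ^ (2 - α) := by
    rw [rpow_two_sub_eq h1 ha]
    exact mul_le_mul_of_nonneg_right (by linarith [hI q a]) (Real.rpow_nonneg ha _)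
  rw [zVal]
  calc _ ≤ 4 * c ^ 2 / (1 - α) * (2 * (1 - q a) ^ (2 - α)) :=
        mul_le_mul_of_nonneg_left (by linarith) (by positivity)
    _ = _ := by ring

theorem uVal_le_gap (hI : IsArgmaxRule I) (hc : 0 ≤ c) (h1 : α < 1)
    (hq : q ∈ stdSimplex ℝ (Fin k)) (a : Fin k) :
    uVal c α I q ≤ 8 * c / (1 - α) * (1 - q a) ^ (1 - α) := by
  have h1' : 0 < 1 - α := by linarith
  rw [uVal]
  exact mul_le_mul_of_nonneg_left
    (Real.rpow_le_rpow (qStar_nonneg hq) (qStar_le_gap hI a) h1'.le) (by positivity)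

theorem zMax_div_le (hc : 1 ≤ c) (h1 : α < 1) (hβ : 64 * c ^ 2 / (1 - α) ≤ β) :
    zMax c α / β ≤ (1 / 4) ^ 2 := by
  have h1' : 0 < 1 - α := by linarith
  have hβ0 : 0 < β := lt_of_lt_of_le (by positivity) hβ
  rw [div_le_iff₀ hβ0, zMax]
  have : 4 * c ^ 2 / (1 - α) = (1 / 4) ^ 2 * (64 * c ^ 2 / (1 - α)) := by ring
  rw [this]
  exact mul_le_mul_of_nonneg_left hβ (by norm_num)

theorem uMax_div_le (hc : 1 ≤ c) (h1 : α < 1) (hβ : 64 * c ^ 2 / (1 - α) ≤ β) :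
    uMax c α / β ≤ 1 / 8 := by
  have h1' : 0 < 1 - α := by linarith
  have hβ0 : 0 < β := lt_of_lt_of_le (by positivity) hβ
  rw [div_le_iff₀ hβ0, uMax]
  have : 8 * c / (1 - α) ≤ 1 / 8 * (64 * c ^ 2 / (1 - α)) := by
    rw [← mul_div_assoc]
    exact div_le_div_of_nonneg_right (by nlinarith) h1'.le
  linarith

theorem gammaVal_le (hc : 1 ≤ c) (h1 : α < 1) (hβ : 64 * c ^ 2 / (1 - α) ≤ β)
    (hq : q ∈ stdSimplex ℝ (Fin k)) : gammaVal c α I q β ≤ 3 / 8 := by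
  have h1' : 0 < 1 - α := by linarith
  have hβ0 : 0 < β := lt_of_lt_of_le (by positivity) hβ
  have hz : Real.sqrt (zVal c α I q / β) ≤ 1 / 4 := by
    refine Real.sqrt_le_iff.2 ⟨by norm_num, le_trans ?_ (zMax_div_le hc h1 hβ)⟩
    exact div_le_div_of_nonneg_right (zVal_le_zMax h1 hq) hβ0.le
  have hu : uVal c α I q / β ≤ 1 / 8 :=
    (div_le_div_of_nonneg_right (uVal_le_uMax (by linarith) h1 hq) hβ0.le).trans
      (uMax_div_le hc h1 hβ)
  rw [gammaVal]
  linarith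

/-- The increment of `β` in a round is small compared to `β̄`. -/
theorem increment_le (hI : IsArgmaxRule I) (hk : 2 ≤ k) (hc : 1 ≤ c) (h0 : 0 < α) (h1 : α < 1)
    (hβ₁ : 64 * c ^ 2 / (1 - α) ≤ β₁) (hβ : β₁ ≤ β) (hq : q ∈ stdSimplex ℝ (Fin k))
    (hs : 0 < qStar I q) :
    1 / tsallis α q * (2 * Real.sqrt (zVal c α I q / β) + uVal c α I q / β) ≤
      5 / 16 * betaBar k c α β₁ * qStar I q ^ (1 - 2 * α) := by
  have hy : 0 < 1 - α := by linarith
  have hβ₁0 : 0 < β₁ := lt_of_lt_of_le (by positivity) hβ₁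
  have hβ0 : 0 < β := hβ₁0.trans_le hβ
  have hk' : (2 : ℝ) ≤ k := by exact_mod_cast hk
  have hsk : 1 ≤ Real.sqrt k := Real.one_le_sqrt.2 (by linarith)
  set Q := qStar I q with hQ
  have hQ1 : Q ≤ 1 := qStar_le_half.trans (by norm_num)
  have hQa := Real.rpow_pos_of_pos hs α
  have hQb := Real.rpow_pos_of_pos hs (1 - 2 * α)
  have hQc : Q ^ (1 - α) = Q ^ α * Q ^ (1 - 2 * α) := by
    rw [← Real.rpow_add hs]; ring_nf
  have hr := Real.sqrt_pos.2 hβ₁0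
  have hr2 := Real.sq_sqrt hβ₁0.le
  have hr8 : 8 ≤ Real.sqrt β₁ := by
    refine Real.le_sqrt_of_sq_le (le_trans ?_ hβ₁)
    rw [le_div_iff₀ hy]; nlinarith
  have hinv : 1 / tsallis α q ≤ 2 / ((1 - α) * Q ^ α) := by
    have := tsallis_ge hI h0 h1.le hq
    rw [← hQ] at this
    have e : 2 / ((1 - α) * Q ^ α) = 1 / ((1 - α) / 2 * Q ^ α) := by field_simp
    rw [e]
    exact one_div_le_one_div_of_le (by positivity) this
  have hz : Real.sqrt (zVal c α I q / β) ≤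
      2 * c * Real.sqrt k / ((1 - α) * Real.sqrt β₁) * Q ^ (1 - α) := by
    refine Real.sqrt_le_iff.2 ⟨by positivity, ?_⟩
    have hk2 := Real.sq_sqrt (show (0 : ℝ) ≤ k by linarith)
    -- The exponent is lowered from `2 - α` to `2(1 - α)`, so that after the square root the
    -- stability part has the same power of `q_*` as the bias part.
    have hQ2 : Q ^ (2 - α) ≤ (Q ^ (1 - α)) ^ 2 := by
      rw [← Real.rpow_natCast, ← Real.rpow_mul hs.le]
      refine Real.rpow_le_rpow_of_exponent_ge hs hQ1 ?_
      push_cast; linarith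
    have e : (2 * c * Real.sqrt k / ((1 - α) * Real.sqrt β₁) * Q ^ (1 - α)) ^ 2 =
        4 * c ^ 2 / (1 - α) * (k * (Q ^ (1 - α)) ^ 2) * (1 / ((1 - α) * β₁)) := by
      rw [mul_pow, div_pow, mul_pow, mul_pow, mul_pow, hk2, hr2]; field_simp; norm_num
    rw [e, div_eq_mul_one_div]
    refine mul_le_mul ((zVal_le_qStar hI hk h1 hq).trans ?_) ?_ (by positivity) (by positivity)
    · exact mul_le_mul_of_nonneg_left (mul_le_mul_of_nonneg_left hQ2 (by positivity))
        (by positivity)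
    · refine one_div_le_one_div_of_le (by positivity) (le_trans ?_ hβ)
      exact mul_le_of_le_one_left hβ₁0.le (by linarith)
  have hu : uVal c α I q / β ≤ c * Real.sqrt k / ((1 - α) * Real.sqrt β₁) * Q ^ (1 - α) := by
    have e : uVal c α I q / β = c / (1 - α) * (8 / β) * Q ^ (1 - α) := by
      rw [uVal]; ring
    have e' : c * Real.sqrt k / ((1 - α) * Real.sqrt β₁) * Q ^ (1 - α) =
      c / (1 - α) * (Real.sqrt k / Real.sqrt β₁) * Q ^ (1 - α) := by field_simp
    rw [e, e']
    refine mul_le_mul_of_nonneg_right (mul_le_mul_of_nonneg_left ?_ (by positivity))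
      (by positivity)
    rw [div_le_div_iff₀ hβ0 hr]
    nlinarith
  calc 1 / tsallis α q * (2 * Real.sqrt (zVal c α I q / β) + uVal c α I q / β)
      ≤ 2 / ((1 - α) * Q ^ α) *
        (5 * (c * Real.sqrt k / ((1 - α) * Real.sqrt β₁) * Q ^ (1 - α))) := by
        refine mul_le_mul hinv ?_ ?_ (by positivity)
        · have : 2 * c * Real.sqrt k / ((1 - α) * Real.sqrt β₁) * Q ^ (1 - α) =
            2 * (c * Real.sqrt k / ((1 - α) * Real.sqrt β₁) * Q ^ (1 - α)) := by ring
          linarith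
        · have := uVal_nonneg (I := I) (by linarith : 0 ≤ c) h1 hq
          positivity
    _ = _ := by
        rw [hQc, betaBar]
        field_simp
        norm_num

/-- The growth condition under which consecutive iterates are multiplicatively close. -/
theorem increment_cond (hI : IsArgmaxRule I) (hk : 3 ≤ k) (hc : 1 ≤ c)
    (hβ₁ : 64 * c ^ 2 / (1 - alphaOf k) ≤ β₁) (hβ : β₁ ≤ β) (hq : q ∈ stdSimplex ℝ (Fin k))
    {x : ℝ} (hx : 0 < x) (hxs : x ≤ qStar I q) :
    1 / tsallis (alphaOf k) q *
        (2 * Real.sqrt (zVal c (alphaOf k) I q / β) + uVal c (alphaOf k) I q / β) ≤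
      β * (1 - alphaOf k) / 2 +
        betaBar k c (alphaOf k) β₁ * (3 / 4 * alphaOf k) * x ^ (1 - 2 * alphaOf k) := by
  have h0 := alphaOf_pos hk
  have h1 := alphaOf_lt_one hk
  have hL := one_sub_alphaOf k
  have hlog := log_ge_of_three_le hk
  have hs : 0 < qStar I q := hx.trans_le hxs
  refine (increment_le hI (by omega) hc h0 h1 hβ₁ hβ hq hs).trans ?_
  set α := alphaOf k
  have hy : 0 < 1 - α := by linarith
  have hβ₁0 : 0 < β₁ := lt_of_lt_of_le (by positivity) hβ₁
  have hβ0 : 0 < β := hβ₁0.trans_le hβ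
  have hb : 0 ≤ betaBar k c α β₁ := by
    rw [betaBar]
    positivity
  have hyβ : 64 * c ^ 2 ≤ (1 - α) * β := by
    have := hβ₁.trans hβ
    rw [div_le_iff₀ hy] at this
    linarith
  -- For `α ≥ 1/2` the power is antitone and the `β̄` term dominates, as `5/16 ≤ 3/8`. For `α < 1/2`
  -- one has `k < e² < 9`, so `β̄ ≤ 48` and the increment is at most 15, while `β (1 - α) / 2 ≥ 32`.
  rcases le_or_gt (1 / 2) α with h | h
  · have h3 : qStar I q ^ (1 - 2 * α) ≤ x ^ (1 - 2 * α) :=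
      Real.rpow_le_rpow_of_nonpos hx hxs (by linarith)
    have h4 := Real.rpow_pos_of_pos hs (1 - 2 * α)
    have h5 : 5 / 16 * betaBar k c α β₁ * qStar I q ^ (1 - 2 * α) ≤
        betaBar k c α β₁ * (3 / 4 * α) * x ^ (1 - 2 * α) := by
      refine mul_le_mul ?_ h3 h4.le (by positivity)
      nlinarith
    have : 0 ≤ β * (1 - α) / 2 := by positivity
    linarith
  · have h3 : qStar I q ^ (1 - 2 * α) ≤ 1 :=
      Real.rpow_le_one hs.le (qStar_le_half.trans (by norm_num)) (by linarith)
    have hlog2 : Real.log k < 2 := by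
      have : 1 / 2 < 1 / Real.log k := by rw [← hL]; linarith
      exact (one_div_lt_one_div (by norm_num) (by linarith)).1 this
    have hk9 : (k : ℝ) ≤ 9 := by
      have hk0 : (0 : ℝ) < k := by
        have : 0 < k := by omega
        exact_mod_cast this
      have h6 := (Real.log_lt_iff_lt_exp hk0).1 hlog2
      have h7 : Real.exp 2 = Real.exp 1 * Real.exp 1 := by rw [← Real.exp_add]; norm_num
      have h8 := Real.exp_one_lt_d9
      have h9 := Real.exp_pos 1
      nlinarith
    have hsk : Real.sqrt k ≤ 3 := Real.sqrt_le_iff.2 ⟨by norm_num, by linarith⟩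
    have hr8 : 8 * c ≤ Real.sqrt β₁ := by
      refine Real.le_sqrt_of_sq_le (le_trans ?_ hβ₁)
      rw [le_div_iff₀ hy]; nlinarith
    have hbb : betaBar k c α β₁ ≤ 48 := by
      rw [betaBar, div_le_iff₀ (by positivity)]
      have h4 : 1 / 4 ≤ (1 - α) ^ 2 := by nlinarith
      have h5 : 1 / 4 * (8 * c) ≤ (1 - α) ^ 2 * Real.sqrt β₁ :=
        mul_le_mul h4 hr8 (by linarith) (by positivity)
      nlinarith
    have h5 : 5 / 16 * betaBar k c α β₁ * qStar I q ^ (1 - 2 * α) ≤ 15 := by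
      have := mul_le_of_le_one_right (by positivity : 0 ≤ 5 / 16 * betaBar k c α β₁) h3
      linarith
    have h6 : 0 ≤ betaBar k c α β₁ * (3 / 4 * α) * x ^ (1 - 2 * α) := by positivity
    nlinarith

end Components

/-! ### One round of the algorithm -/

section Round

variable {k : ℕ} {S : Type*} {G : Fin k → S → Fin k → ℝ} {c β₁ : ℝ}
  {I : (Fin k → ℝ) → Fin k} {s : AlgState k}

/-- The state after a round in which action `a` was played and `σ` was observed. -/
noncomputable def AlgState.next (G : Fin k → S → Fin k → ℝ) (c α β₁ : ℝ)
    (I : (Fin k → ℝ) → Fin k) (s : AlgState k) (a : Fin k) (σ : S) : AlgState k where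
  Lhat := fun b => s.Lhat b + G a σ b / s.p c α β₁ I a
  β := s.β + 1 / tsallis α (s.q c α β₁) *
    (2 * Real.sqrt (zVal c α I (s.q c α β₁) / s.β) + uVal c α I (s.q c α β₁) / s.β)

theorem algState_cons (α : ℝ) (a : Fin k) (σ : S) (h : List (Fin k × S)) :
    algState G c α β₁ I ((a, σ) :: h) = (algState G c α β₁ I h).next G c α β₁ I a σ := rfl

theorem AlgState.q_isMin (hk : 3 ≤ k) (s : AlgState k) :
    IsFtrlMin (alphaOf k) s.β (betaBar k c (alphaOf k) β₁) s.Lhat (s.q c (alphaOf k) β₁) :=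
  ftrl_spec (alphaOf_pos hk) (alphaOf_lt_one hk) (by omega) _ _ _

theorem betaOne_pos (hk : 3 ≤ k) (hc : 1 ≤ c) (hβ₁ : 64 * c ^ 2 / (1 - alphaOf k) ≤ β₁) :
    0 < β₁ := by
  have := alphaOf_lt_one hk
  have : 0 < 1 - alphaOf k := by linarith
  exact lt_of_lt_of_le (by positivity) hβ₁

theorem betaBar_nonneg (hc : 1 ≤ c) (α : ℝ) : 0 ≤ betaBar k c α β₁ := by
  rw [betaBar]
  positivity

theorem AlgState.q_pos (hk : 3 ≤ k) (hc : 1 ≤ c) (hβ : 0 < s.β) (i : Fin k) :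
    0 < s.q c (alphaOf k) β₁ i :=
  (s.q_isMin hk).pos (alphaOf_pos hk) (alphaOf_lt_one hk) hβ (betaBar_nonneg hc _) i

theorem AlgState.qStar_pos (hk : 3 ≤ k) (hc : 1 ≤ c) (hβ : 0 < s.β) :
    0 < qStar I (s.q c (alphaOf k) β₁) := by
  have hq := (s.q_isMin (c := c) (β₁ := β₁) hk).1
  set q := s.q c (alphaOf k) β₁
  refine lt_min (AlgState.q_pos hk hc hβ _) ?_
  rw [← sum_ne_eq hq]
  refine Finset.sum_pos (fun i _ => AlgState.q_pos hk hc hβ i) ?_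
  have : Nontrivial (Fin k) := Fin.nontrivial_iff_two_le.2 (by omega)
  obtain ⟨j, hj⟩ := exists_ne (I q)
  exact ⟨j, Finset.mem_filter.2 ⟨Finset.mem_univ j, hj⟩⟩

/-- Interior iterates have positive entropy, so the division in the update of `β` is never a
division by zero. -/
theorem AlgState.tsallis_pos (hI : IsArgmaxRule I) (hk : 3 ≤ k) (hc : 1 ≤ c) (hβ : 0 < s.β) :
    0 < tsallis (alphaOf k) (s.q c (alphaOf k) β₁) := by
  have h1 := alphaOf_lt_one hk
  have := tsallis_ge hI (alphaOf_pos hk) h1.le (s.q_isMin (c := c) (β₁ := β₁) hk).1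
  refine lt_of_lt_of_le ?_ this
  have h2 := Real.rpow_pos_of_pos (AlgState.qStar_pos (I := I) (β₁ := β₁) hk hc hβ) (alphaOf k)
  have h3 : 0 < 1 - alphaOf k := by linarith
  positivity

theorem AlgState.le_next_beta (hk : 3 ≤ k) (hc : 1 ≤ c) (hβ : 0 < s.β) (a : Fin k) (σ : S) :
    s.β ≤ (s.next G c (alphaOf k) β₁ I a σ).β := by
  have h1 := alphaOf_lt_one hk
  have hq := (s.q_isMin (c := c) (β₁ := β₁) hk).1
  have h2 := tsallis_nonneg (alphaOf_pos hk) h1.le hq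
  have h3 := uVal_nonneg (I := I) (by linarith : 0 ≤ c) h1 hq
  have : 0 ≤ 1 / tsallis (alphaOf k) (s.q c (alphaOf k) β₁) *
    (2 * Real.sqrt (zVal c (alphaOf k) I (s.q c (alphaOf k) β₁) / s.β) +
      uVal c (alphaOf k) I (s.q c (alphaOf k) β₁) / s.β) := by positivity
  simp only [AlgState.next]
  linarith

theorem beta_ge (hk : 3 ≤ k) (hc : 1 ≤ c) (hβ₁ : 64 * c ^ 2 / (1 - alphaOf k) ≤ β₁) :
    ∀ h : List (Fin k × S), β₁ ≤ (algState G c (alphaOf k) β₁ I h).β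
  | [] => le_rfl
  | (a, σ) :: h => by
    have ih := beta_ge hk hc hβ₁ h
    rw [algState_cons]
    exact ih.trans (AlgState.le_next_beta hk hc ((betaOne_pos hk hc hβ₁).trans_le ih) a σ)

/-- The bound `√(z_t / β_t) + u_t / β_t` for the cost of a round. -/
noncomputable def AlgState.cost (c α β₁ : ℝ) (I : (Fin k → ℝ) → Fin k) (s : AlgState k) : ℝ :=
  Real.sqrt (zVal c α I (s.q c α β₁) / s.β) + uVal c α I (s.q c α β₁) / s.β

theorem AlgState.gamma_eq (α : ℝ) :
    gammaVal c α I (s.q c α β₁) s.β = s.cost c α β₁ I := rfl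

theorem AlgState.zVal_pos (hk : 3 ≤ k) (hc : 1 ≤ c) (hβ : 0 < s.β) :
    0 < zVal c (alphaOf k) I (s.q c (alphaOf k) β₁) := by
  have h1 := alphaOf_lt_one hk
  have hq := (s.q_isMin (c := c) (β₁ := β₁) hk).1
  have h3 : 0 < 1 - alphaOf k := by linarith
  have h2 := Real.rpow_pos_of_pos (AlgState.qStar_pos (I := I) (β₁ := β₁) hk hc hβ)
    (2 - alphaOf k)
  have h4 : 0 ≤ ∑ i ∈ Finset.univ.filter (fun i => i ≠ I (s.q c (alphaOf k) β₁)),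
      s.q c (alphaOf k) β₁ i ^ (2 - alphaOf k) :=
    Finset.sum_nonneg fun i _ => Real.rpow_nonneg (hq.1 i) _
  rw [zVal]
  positivity

theorem AlgState.uVal_pos (hk : 3 ≤ k) (hc : 1 ≤ c) (hβ : 0 < s.β) :
    0 < uVal c (alphaOf k) I (s.q c (alphaOf k) β₁) := by
  have h1 := alphaOf_lt_one hk
  have h3 : 0 < 1 - alphaOf k := by linarith
  have h2 := Real.rpow_pos_of_pos (AlgState.qStar_pos (I := I) (β₁ := β₁) hk hc hβ)
    (1 - alphaOf k)
  rw [uVal]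
  positivity

theorem AlgState.cost_pos (hk : 3 ≤ k) (hc : 1 ≤ c) (hβ : 0 < s.β) :
    0 < s.cost c (alphaOf k) β₁ I := by
  have h1 := AlgState.zVal_pos (I := I) (β₁ := β₁) hk hc hβ
  have h2 := AlgState.uVal_pos (I := I) (β₁ := β₁) hk hc hβ
  rw [AlgState.cost]
  positivity

theorem AlgState.cost_le (hk : 3 ≤ k) (hc : 1 ≤ c)
    (hβ : 64 * c ^ 2 / (1 - alphaOf k) ≤ s.β) : s.cost c (alphaOf k) β₁ I ≤ 3 / 8 :=
  gammaVal_le hc (alphaOf_lt_one hk) hβ (s.q_isMin hk).1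

theorem AlgState.p_ge (hk : 3 ≤ k) (hc : 1 ≤ c) (hβ : 64 * c ^ 2 / (1 - alphaOf k) ≤ s.β)
    (a : Fin k) : s.cost c (alphaOf k) β₁ I / k ≤ s.p c (alphaOf k) β₁ I a := by
  have h1 := AlgState.cost_le (I := I) (β₁ := β₁) hk hc hβ
  have h2 := (s.q_isMin (c := c) (β₁ := β₁) hk).1.1 a
  rw [AlgState.p, actionProb, AlgState.gamma_eq]
  have : 0 ≤ (1 - s.cost c (alphaOf k) β₁ I) * s.q c (alphaOf k) β₁ a :=
    mul_nonneg (by linarith) h2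
  rw [mul_one_div]
  linarith

theorem AlgState.p_pos (hk : 3 ≤ k) (hc : 1 ≤ c) (hβ : 64 * c ^ 2 / (1 - alphaOf k) ≤ s.β)
    (a : Fin k) : 0 < s.p c (alphaOf k) β₁ I a := by
  have hk' : (0 : ℝ) < k := by
    have : 0 < k := by omega
    exact_mod_cast this
  exact (div_pos (AlgState.cost_pos hk hc (betaOne_pos hk hc hβ)) hk').trans_le
    (AlgState.p_ge hk hc hβ a)

theorem AlgState.p_mem (hk : 3 ≤ k) (hc : 1 ≤ c) (hβ : 64 * c ^ 2 / (1 - alphaOf k) ≤ s.β) :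
    s.p c (alphaOf k) β₁ I ∈ stdSimplex ℝ (Fin k) := by
  refine ⟨fun a => (AlgState.p_pos hk hc hβ a).le, ?_⟩
  have hk' : (k : ℝ) ≠ 0 := by
    have : k ≠ 0 := by omega
    exact_mod_cast this
  simp only [AlgState.p, actionProb]
  rw [Finset.sum_add_distrib, ← Finset.mul_sum, (s.q_isMin hk).1.2, Finset.sum_const,
    Finset.card_univ, Fintype.card_fin, nsmul_eq_mul]
  field_simp
  ring

/-- The action probabilities give `a*` at most a constant factor less suboptimality than `q`. -/
theorem AlgState.gap_le (hk : 3 ≤ k) (hc : 1 ≤ c)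
    (hβ : 64 * c ^ 2 / (1 - alphaOf k) ≤ s.β) (a : Fin k) :
    5 / 8 * (1 - s.q c (alphaOf k) β₁ a) ≤ 1 - s.p c (alphaOf k) β₁ I a := by
  have hk' : (1 : ℝ) ≤ k := by
    have : 1 ≤ k := by omega
    exact_mod_cast this
  have h1 := AlgState.cost_le (I := I) (β₁ := β₁) hk hc hβ
  have h2 := AlgState.cost_pos (I := I) (β₁ := β₁) hk hc (betaOne_pos hk hc hβ)
  have h3 := mem_simplex_le_one (s.q_isMin (c := c) (β₁ := β₁) hk).1 a
  have h4 : 1 / (k : ℝ) ≤ 1 := by rw [div_le_one (by linarith)]; exact hk'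
  rw [AlgState.p, actionProb, AlgState.gamma_eq]
  nlinarith

/-- The estimated loss vectors are bounded by `c / γ`. -/
theorem AlgState.estimate_le (hk : 3 ≤ k) (hc : 1 ≤ c)
    (hβ : 64 * c ^ 2 / (1 - alphaOf k) ≤ s.β) (hG : ∀ a σ b, |G a σ b| ≤ c / k)
    (a : Fin k) (σ : S) (b : Fin k) :
    |G a σ b / s.p c (alphaOf k) β₁ I a| ≤ (c / k) / s.p c (alphaOf k) β₁ I a := by
  have hp := AlgState.p_pos (I := I) (β₁ := β₁) hk hc hβ a
  rw [abs_div, abs_of_pos hp]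
  exact div_le_div_of_nonneg_right (hG a σ b) hp.le

/-- This is the purpose of `u_t`: the estimate is at most `c / γ`, and `γ ≥ u / β` is inversely
proportional to the range of losses that `IsFtrlMin.le_four_mul` tolerates. -/
theorem AlgState.estimate_le_rpow (hk : 3 ≤ k) (hc : 1 ≤ c)
    (hβ : 64 * c ^ 2 / (1 - alphaOf k) ≤ s.β) (hG : ∀ a σ b, |G a σ b| ≤ c / k)
    (a : Fin k) (σ : S) (b : Fin k) {x : ℝ} (hx : 0 < x)
    (hxs : x ≤ qStar I (s.q c (alphaOf k) β₁)) :
    |G a σ b / s.p c (alphaOf k) β₁ I a| ≤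
      (1 - alphaOf k) / 8 * s.β * x ^ (alphaOf k - 1) := by
  have hk' : (0 : ℝ) < k := by
    have : 0 < k := by omega
    exact_mod_cast this
  have h1 := alphaOf_lt_one hk
  have hy : 0 < 1 - alphaOf k := by linarith
  have hβ0 := betaOne_pos hk hc hβ
  refine (AlgState.estimate_le hk hc hβ hG a σ b).trans ?_
  rw [div_le_iff₀ (AlgState.p_pos hk hc hβ a)]
  have hp := AlgState.p_ge (I := I) (β₁ := β₁) hk hc hβ a
  have hu : 8 * c / (1 - alphaOf k) * x ^ (1 - alphaOf k) / s.β ≤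
      s.cost c (alphaOf k) β₁ I := by
    rw [AlgState.cost, uVal]
    have := Real.rpow_le_rpow hx.le hxs hy.le
    have h2 : 8 * c / (1 - alphaOf k) * x ^ (1 - alphaOf k) / s.β ≤
        8 * c / (1 - alphaOf k) * qStar I (s.q c (alphaOf k) β₁) ^ (1 - alphaOf k) / s.β :=
      div_le_div_of_nonneg_right (mul_le_mul_of_nonneg_left this (by positivity)) hβ0.le
    exact h2.trans (le_add_of_nonneg_left (Real.sqrt_nonneg _))
  have hX := Real.rpow_pos_of_pos hx (alphaOf k - 1)
  have e : x ^ (1 - alphaOf k) = (x ^ (alphaOf k - 1))⁻¹ := by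
    rw [← Real.rpow_neg hx.le, neg_sub]
  rw [e] at hu
  set X := x ^ (alphaOf k - 1)
  calc c / k = (1 - alphaOf k) / 8 * s.β * X *
        ((8 * c / (1 - alphaOf k) * X⁻¹ / s.β) / k) := by field_simp
    _ ≤ (1 - alphaOf k) / 8 * s.β * X * (s.cost c (alphaOf k) β₁ I / k) :=
        mul_le_mul_of_nonneg_left (div_le_div_of_nonneg_right hu hk'.le) (by positivity)
    _ ≤ _ := mul_le_mul_of_nonneg_left hp (by positivity)

/-- Consecutive iterates are multiplicatively close. -/
theorem AlgState.next_q_le (hI : IsArgmaxRule I) (hk : 3 ≤ k) (hc : 1 ≤ c)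
    (hβ₁ : 64 * c ^ 2 / (1 - alphaOf k) ≤ β₁) (hβ : β₁ ≤ s.β)
    (hG : ∀ a σ b, |G a σ b| ≤ c / k) (a : Fin k) (σ : S) (i : Fin k) :
    (s.next G c (alphaOf k) β₁ I a σ).q c (alphaOf k) β₁ i ≤
      4 * s.q c (alphaOf k) β₁ i := by
  have hβ0 : 0 < s.β := (betaOne_pos hk hc hβ₁).trans_le hβ
  have hq := s.q_isMin (c := c) (β₁ := β₁) hk
  have hr := (s.next G c (alphaOf k) β₁ I a σ).q_isMin (c := c) (β₁ := β₁) hk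
  have hqi := AlgState.q_pos (β₁ := β₁) hk hc hβ0 i
  rcases le_or_gt (s.q c (alphaOf k) β₁ i) (qStar I (s.q c (alphaOf k) β₁)) with h | h
  · refine hq.le_four_mul (alphaOf_pos hk) (alphaOf_lt_one hk) hβ0
      (AlgState.le_next_beta hk hc hβ0 a σ) (betaBar_nonneg hc _) hr
      (fun j => AlgState.estimate_le_rpow hk hc (hβ₁.trans hβ) hG a σ j hqi h) ?_
    have := increment_cond hI hk hc hβ₁ hβ hq.1 hqi h
    simp only [AlgState.next]
    linarith
  -- A coordinate above `q_*` is the largest one and exceeds `1/2`, so `r i ≤ 1` is enough.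
  · have hi : i = I (s.q c (alphaOf k) β₁) := by
      by_contra hne
      exact absurd (le_qStar hI hq.1 hne) (not_le.2 h)
    have hr1 := mem_simplex_le_one hr.1 i
    rw [qStar, ← hi, min_lt_iff] at h
    rcases h with h | h
    · exact absurd h (lt_irrefl _)
    · linarith

/-- The value of the regularized problem, relative to the estimated loss of the action `a`. -/
noncomputable def AlgState.potential (c α β₁ : ℝ) (a : Fin k) (s : AlgState k) : ℝ :=
  ftrlObjective α s.β (betaBar k c α β₁) s.Lhat (s.q c α β₁) - s.Lhat a

/-- Compare with the vertex at `a`, where both entropies vanish. -/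
theorem AlgState.potential_nonpos (hk : 3 ≤ k) (a : Fin k) :
    s.potential c (alphaOf k) β₁ a ≤ 0 := by
  have h1 := alphaOf_lt_one hk
  have := (s.q_isMin (c := c) (β₁ := β₁) hk).2 _ (single_mem_stdSimplex ℝ a)
  have e : ftrlObjective (alphaOf k) s.β (betaBar k c (alphaOf k) β₁) s.Lhat (Pi.single a 1) =
      s.Lhat a := by
    rw [ftrlObjective, tsallis_single (alphaOf_pos hk), tsallis_single (by linarith)]
    simp [Pi.single_apply]
  rw [e] at this
  rw [AlgState.potential]
  linarith

theorem AlgState.neg_le_potential_init (hk : 3 ≤ k) (hc : 1 ≤ c)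
    (hβ₁ : 64 * c ^ 2 / (1 - alphaOf k) ≤ β₁) (a : Fin k) :
    -(β₁ * hUnif k (alphaOf k) + betaBar k c (alphaOf k) β₁ * hUnif k (1 - alphaOf k)) ≤
      (algState G c (alphaOf k) β₁ I []).potential c (alphaOf k) β₁ a := by
  have h0 := alphaOf_pos hk
  have h1 := alphaOf_lt_one hk
  have hq := ((algState G c (alphaOf k) β₁ I []).q_isMin (c := c) (β₁ := β₁) hk).1
  have t1 := mul_le_mul_of_nonneg_left (tsallis_le_hUnif (by omega) h0 h1.le hq)
    (betaOne_pos hk hc hβ₁).le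
  have t2 := mul_le_mul_of_nonneg_left
    (tsallis_le_hUnif (s := 1 - alphaOf k) (by omega) (by linarith) (by linarith) hq)
    (betaBar_nonneg (k := k) (β₁ := β₁) hc (alphaOf k))
  simp only [AlgState.potential, ftrlObjective]
  simp only [algState, zero_mul, Finset.sum_const_zero, zero_add, sub_zero] at t1 t2 ⊢
  linarith

/-- The change of the potential in a round. -/
theorem AlgState.potential_next (hI : IsArgmaxRule I) (hk : 3 ≤ k) (hc : 1 ≤ c)
    (hβ₁ : 64 * c ^ 2 / (1 - alphaOf k) ≤ β₁) (hβ : β₁ ≤ s.β)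
    (hG : ∀ a σ b, |G a σ b| ≤ c / k) (a b : Fin k) (σ : S) :
    ∑ i, G a σ i / s.p c (alphaOf k) β₁ I a * s.q c (alphaOf k) β₁ i
        - G a σ b / s.p c (alphaOf k) β₁ I a ≤
      (s.next G c (alphaOf k) β₁ I a σ).potential c (alphaOf k) β₁ b
        - s.potential c (alphaOf k) β₁ b
      + 9 * ((c / k) / s.p c (alphaOf k) β₁ I a) ^ 2 / (s.β * (1 - alphaOf k)) *
        ∑ i ∈ Finset.univ.filter (fun i => i ≠ I (s.q c (alphaOf k) β₁)),
          s.q c (alphaOf k) β₁ i ^ (2 - alphaOf k)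
      + 4 * (2 * Real.sqrt (zVal c (alphaOf k) I (s.q c (alphaOf k) β₁) / s.β) +
          uVal c (alphaOf k) I (s.q c (alphaOf k) β₁) / s.β) := by
  have h0 := alphaOf_pos hk
  have h1 := alphaOf_lt_one hk
  have hβ0 : 0 < s.β := (betaOne_pos hk hc hβ₁).trans_le hβ
  have hq := s.q_isMin (c := c) (β₁ := β₁) hk
  have hr := (s.next G c (alphaOf k) β₁ I a σ).q_isMin (c := c) (β₁ := β₁) hk
  have hrq := AlgState.next_q_le hI hk hc hβ₁ hβ hG a σ
  have hqp := fun i => AlgState.q_pos (β₁ := β₁) hk hc hβ0 i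
  have hbb := betaBar_nonneg (k := k) (β₁ := β₁) hc (alphaOf k)
  have hent := tsallis_le_mul h0 h1.le (by norm_num) hq.1 hr.1 hrq
  have hts := AlgState.tsallis_pos (β₁ := β₁) hI hk hc hβ0
  have hst := stability_le (y := fun i => G a σ i / s.p c (alphaOf k) β₁ I a) h0 h1 hβ0 hqp
    hr.1.1 (hq.1.2.trans hr.1.2.symm)
    (fun i => AlgState.estimate_le hk hc (hβ₁.trans hβ) hG a σ i)
    (I (s.q c (alphaOf k) β₁)) (fun i _ => hrq i)
  have hdiff := hq.objective_sub h0 h1 hβ0 hbb hr.1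
  rw [Finset.sum_add_distrib] at hdiff
  set q := s.q c (alphaOf k) β₁ with hqdef
  set r := (s.next G c (alphaOf k) β₁ I a σ).q c (alphaOf k) β₁ with hrdef
  have hpos : 0 ≤ ∑ i, betaBar k c (alphaOf k) β₁ * breg (1 - alphaOf k) (r i) (q i) :=
    Finset.sum_nonneg fun i _ => mul_nonneg hbb
      (breg_nonneg (by linarith) (by linarith) (hr.1.1 i) (hqp i))
  set D := 2 * Real.sqrt (zVal c (alphaOf k) I q / s.β) + uVal c (alphaOf k) I q / s.β with hD
  have hD0 : 0 ≤ D := by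
    have := uVal_nonneg (I := I) (by linarith : 0 ≤ c) h1 hq.1
    positivity
  -- The update rule cancels the entropy at `q`; the 4 comes from the closeness of consecutive
  -- iterates.
  have hpen : 1 / tsallis (alphaOf k) q * D * tsallis (alphaOf k) r ≤ 4 * D := by
    calc _ ≤ 1 / tsallis (alphaOf k) q * D * (4 * tsallis (alphaOf k) q) :=
          mul_le_mul_of_nonneg_left hent (by positivity)
      _ = _ := by field_simp
  have hobj : ftrlObjective (alphaOf k) (s.next G c (alphaOf k) β₁ I a σ).β
      (betaBar k c (alphaOf k) β₁) (s.next G c (alphaOf k) β₁ I a σ).Lhat r =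
      ftrlObjective (alphaOf k) s.β (betaBar k c (alphaOf k) β₁) s.Lhat r +
        ∑ i, G a σ i / s.p c (alphaOf k) β₁ I a * r i -
        1 / tsallis (alphaOf k) q * D * tsallis (alphaOf k) r := by
    simp only [ftrlObjective, AlgState.next, add_mul, Finset.sum_add_distrib, ← hqdef, ← hD]
    ring
  have hnL : (s.next G c (alphaOf k) β₁ I a σ).Lhat b =
    s.Lhat b + G a σ b / s.p c (alphaOf k) β₁ I a := rfl
  simp only [AlgState.potential]
  rw [← hqdef, ← hrdef, hobj, hnL]
  have hlin : ∑ i, G a σ i / s.p c (alphaOf k) β₁ I a * (q i - r i) =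
      ∑ i, G a σ i / s.p c (alphaOf k) β₁ I a * q i -
        ∑ i, G a σ i / s.p c (alphaOf k) β₁ I a * r i := by
    simp only [mul_sub, Finset.sum_sub_distrib]
  rw [hlin] at hst
  linarith

/-- The expected loss of a round relative to an action `b`, bounded by the expected change of
the potential and the cost of the round. -/
theorem AlgState.round_le (hI : IsArgmaxRule I) (hk : 3 ≤ k) (hc : 1 ≤ c)
    (hβ₁ : 64 * c ^ 2 / (1 - alphaOf k) ≤ β₁) (hβ : β₁ ≤ s.β)
    (hG : ∀ a σ b, |G a σ b| ≤ c / k) {ℓ : Fin k → ℝ} (hℓ : ∀ a, ℓ a ∈ Set.Icc (0 : ℝ) 1)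
    {σ : Fin k → S} (hσ : ∀ b b', ∑ a, (G a (σ a) b - G a (σ a) b') = ℓ b - ℓ b')
    (b : Fin k) :
    ∑ a, s.p c (alphaOf k) β₁ I a * (ℓ a - ℓ b) ≤
      ∑ a, s.p c (alphaOf k) β₁ I a *
        ((s.next G c (alphaOf k) β₁ I a (σ a)).potential c (alphaOf k) β₁ b
          - s.potential c (alphaOf k) β₁ b) + 12 * s.cost c (alphaOf k) β₁ I := by
  have h1 := alphaOf_lt_one hk
  have hy : 0 < 1 - alphaOf k := by linarith
  have hk' : (0 : ℝ) < k := by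
    have : 0 < k := by omega
    exact_mod_cast this
  have hβ0 : 0 < s.β := (betaOne_pos hk hc hβ₁).trans_le hβ
  have hq := (s.q_isMin (c := c) (β₁ := β₁) hk).1
  have hp := AlgState.p_mem (I := I) (β₁ := β₁) hk hc (hβ₁.trans hβ)
  have hpp := fun a => AlgState.p_pos (I := I) (β₁ := β₁) hk hc (hβ₁.trans hβ) a
  have hpge := fun a => AlgState.p_ge (I := I) (β₁ := β₁) hk hc (hβ₁.trans hβ) a
  have hcost := AlgState.cost_pos (I := I) (β₁ := β₁) hk hc hβ0
  have hcost1 := AlgState.cost_le (I := I) (β₁ := β₁) hk hc (hβ₁.trans hβ)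
  have hpot := fun a => AlgState.potential_next hI hk hc hβ₁ hβ hG a b (σ a)
  have hz0 := zVal_nonneg (I := I) (c := c) h1 hq
  have hu0 := uVal_nonneg (I := I) (by linarith : 0 ≤ c) h1 hq
  have hpdef : ∀ a, s.p c (alphaOf k) β₁ I a = (1 - s.cost c (alphaOf k) β₁ I) *
    s.q c (alphaOf k) β₁ a + s.cost c (alphaOf k) β₁ I * (1 / (k : ℝ)) := fun a => rfl
  have hzdef : zVal c (alphaOf k) I (s.q c (alphaOf k) β₁) = 4 * c ^ 2 / (1 - alphaOf k) *
    (∑ i ∈ Finset.univ.filter (fun i => i ≠ I (s.q c (alphaOf k) β₁)),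
      s.q c (alphaOf k) β₁ i ^ (2 - alphaOf k) +
      qStar I (s.q c (alphaOf k) β₁) ^ (2 - alphaOf k)) := rfl
  have hqs := Real.rpow_nonneg (qStar_nonneg (I := I) hq) (2 - alphaOf k)
  have hcd : s.cost c (alphaOf k) β₁ I =
    Real.sqrt (zVal c (alphaOf k) I (s.q c (alphaOf k) β₁) / s.β) +
      uVal c (alphaOf k) I (s.q c (alphaOf k) β₁) / s.β := rfl
  set p := s.p c (alphaOf k) β₁ I
  set q := s.q c (alphaOf k) β₁
  set γ := s.cost c (alphaOf k) β₁ I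
  set z := zVal c (alphaOf k) I q
  set u := uVal c (alphaOf k) I q
  set Z := ∑ i ∈ Finset.univ.filter (fun i => i ≠ I q), q i ^ (2 - alphaOf k)
  have hZ0 : 0 ≤ Z := Finset.sum_nonneg fun i _ => Real.rpow_nonneg (hq.1 i) _
  -- exploration
  have hexp : ∑ a, p a * (ℓ a - ℓ b) ≤ ∑ a, q a * (ℓ a - ℓ b) + γ := by
    have e : ∑ a, p a * (ℓ a - ℓ b) = ∑ a, q a * (ℓ a - ℓ b) +
        γ * (∑ a, (1 / (k : ℝ)) * ℓ a - ∑ a, q a * ℓ a) := by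
      have e1 : ∀ w : Fin k → ℝ, ∑ a, w a = 1 → ∑ a, w a * (ℓ a - ℓ b) = ∑ a, w a * ℓ a - ℓ b :=
        fun w hw => by
          simp only [mul_sub, Finset.sum_sub_distrib, ← Finset.sum_mul, hw, one_mul]
      rw [e1 p hp.2, e1 q hq.2]
      have : ∑ a, p a * ℓ a = (1 - γ) * ∑ a, q a * ℓ a + γ * ∑ a, (1 / (k : ℝ)) * ℓ a := by
        rw [Finset.mul_sum, Finset.mul_sum, ← Finset.sum_add_distrib]
        exact Finset.sum_congr rfl fun a _ => by rw [hpdef]; ring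
      rw [this]; ring
    have e2 : ∑ a, (1 / (k : ℝ)) * ℓ a ≤ 1 := by
      calc ∑ a, (1 / (k : ℝ)) * ℓ a ≤ ∑ _a : Fin k, 1 / (k : ℝ) :=
            Finset.sum_le_sum fun a _ => mul_le_of_le_one_right (by positivity) (hℓ a).2
        _ = 1 := by
            rw [Finset.sum_const, Finset.card_univ, Fintype.card_fin, nsmul_eq_mul]
            field_simp
    have e3 : 0 ≤ ∑ a, q a * ℓ a := Finset.sum_nonneg fun a _ => mul_nonneg (hq.1 a) (hℓ a).1
    rw [e]
    have := mul_le_mul_of_nonneg_left (by linarith : ∑ a, (1 / (k : ℝ)) * ℓ a - ∑ a, q a * ℓ a ≤ 1)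
      hcost.le
    linarith
  -- unbiasedness
  have hunb : ∑ a, p a * (∑ i, G a (σ a) i / p a * q i - G a (σ a) b / p a) =
      ∑ i, q i * (ℓ i - ℓ b) := by
    have e1 : ∀ a, p a * (∑ i, G a (σ a) i / p a * q i - G a (σ a) b / p a) =
        ∑ i, q i * (G a (σ a) i - G a (σ a) b) := fun a => by
      have hpa := (hpp a).ne'
      simp only [mul_sub, Finset.sum_sub_distrib, ← Finset.sum_mul, hq.2, one_mul, Finset.mul_sum]
      congr 1
      · exact Finset.sum_congr rfl fun i _ => by field_simp
      · field_simp
    rw [Finset.sum_congr rfl fun a _ => e1 a, Finset.sum_comm]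
    exact Finset.sum_congr rfl fun i _ => by rw [← Finset.mul_sum, hσ]
  -- second moments
  have hvar : ∑ a, p a * ((c / k) / p a) ^ 2 ≤ c ^ 2 / γ := by
    calc ∑ a, p a * ((c / k) / p a) ^ 2 ≤ ∑ _a : Fin k, c ^ 2 / (k * γ) := by
          refine Finset.sum_le_sum fun a _ => ?_
          have hpa := hpp a
          have e : p a * ((c / k) / p a) ^ 2 = (c / k) ^ 2 / p a := by field_simp
          have e' : c ^ 2 / (k * γ) = (c / k) ^ 2 / (γ / k) := by field_simp
          rw [e, e']
          exact div_le_div_of_nonneg_left (by positivity) (by positivity) (hpge a)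
      _ = c ^ 2 / γ := by
          rw [Finset.sum_const, Finset.card_univ, Fintype.card_fin, nsmul_eq_mul]
          field_simp
  -- The second moment contributes `c² / γ`, so the stability term is `(9/4) (z/β) / γ`, and `γ ≥
  -- √(z/β)` reduces it to a square root.
  have hstab : ∑ a, p a * (9 * ((c / k) / p a) ^ 2 / (s.β * (1 - alphaOf k)) * Z) ≤
      9 / 4 * Real.sqrt (z / s.β) := by
    have e : ∑ a, p a * (9 * ((c / k) / p a) ^ 2 / (s.β * (1 - alphaOf k)) * Z) =
        9 * Z / (s.β * (1 - alphaOf k)) * ∑ a, p a * ((c / k) / p a) ^ 2 := by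
      rw [Finset.mul_sum]
      exact Finset.sum_congr rfl fun a _ => by ring
    have hzS : 4 * c ^ 2 / (1 - alphaOf k) * Z ≤ z := by
      rw [hzdef]
      exact mul_le_mul_of_nonneg_left (by linarith) (by positivity)
    have hγ : Real.sqrt (z / s.β) ≤ γ := by
      rw [hcd]; exact le_add_of_nonneg_right (by positivity)
    rw [e]
    calc _ ≤ 9 * Z / (s.β * (1 - alphaOf k)) * (c ^ 2 / γ) :=
          mul_le_mul_of_nonneg_left hvar (by positivity)
      _ = 9 / 4 * ((4 * c ^ 2 / (1 - alphaOf k) * Z) / s.β / γ) := by field_simp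
      _ ≤ 9 / 4 * (z / s.β / γ) := by gcongr
      _ ≤ _ := by
          refine mul_le_mul_of_nonneg_left ?_ (by norm_num)
          rw [div_le_iff₀ hcost]
          have h0 : 0 ≤ z / s.β := by positivity
          calc z / s.β = Real.sqrt (z / s.β) * Real.sqrt (z / s.β) := (Real.mul_self_sqrt h0).symm
            _ ≤ _ := mul_le_mul_of_nonneg_left hγ (Real.sqrt_nonneg _)
  have hsum := Finset.sum_le_sum fun a (_ : a ∈ Finset.univ) =>
    mul_le_mul_of_nonneg_left (hpot a) (hpp a).le
  rw [hunb] at hsum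
  simp only [mul_add, Finset.sum_add_distrib, ← Finset.sum_mul, hp.2, one_mul] at hsum hstab ⊢
  have : 0 ≤ Real.sqrt (z / s.β) := Real.sqrt_nonneg _
  have : 0 ≤ u / s.β := by positivity
  -- The coefficient of `√(z/β)` is `1 + 9/4 + 8` and that of `u/β` is `1 + 4`, from exploration,
  -- stability and penalty.
  linarith

end Round

/-! ### Expectations along the interaction -/

section Expectation

variable {k d : ℕ} {S : Type*} {g : Game k d S} {π : Learner k S} {env : Environment k d}

/-- The learner's view of a history. -/
def observed (g : Game k d S) (h : List (Fin k × Fin d)) : List (Fin k × S) :=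
  h.map fun p => (p.1, g.feedback p.1 p.2)

theorem observed_cons (a : Fin k) (x : Fin d) (h : List (Fin k × Fin d)) :
    observed g ((a, x) :: h) = (a, g.feedback a x) :: observed g h := rfl

theorem expect_zero (f : List (Fin k × Fin d) → ℝ) : expect g π env 0 f = f [] := by
  simp [expect, historyProb]

/-- Histories have the latest round at the head, so conditioning on the past means peeling off the
head. -/
theorem expect_succ (T : ℕ) (f : List (Fin k × Fin d) → ℝ) :
    expect g π env (T + 1) f = expect g π env T fun h =>
      ∑ x, env h x * ∑ a, π (observed g h) a * f ((a, x) :: h) := by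
  rw [expect, ← (Fin.consEquiv fun _ : Fin (T + 1) => Fin k × Fin d).sum_comp,
    Fintype.sum_prod_type_right, expect]
  refine Finset.sum_congr rfl fun ω _ => ?_
  rw [Fintype.sum_prod_type_right, Finset.mul_sum]
  refine Finset.sum_congr rfl fun x _ => ?_
  rw [Finset.mul_sum, Finset.mul_sum]
  refine Finset.sum_congr rfl fun a _ => ?_
  have : List.ofFn ((Fin.consEquiv fun _ : Fin (T + 1) => Fin k × Fin d) ((a, x), ω)) =
      (a, x) :: List.ofFn ω := by
    rw [List.ofFn_succ]; rfl
  rw [this, historyProb, observed]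
  ring

theorem historyProb_nonneg (hπ : IsKernel π) (he : IsKernel env) :
    ∀ h : List (Fin k × Fin d), 0 ≤ historyProb g π env h
  | [] => zero_le_one
  | (a, x) :: h =>
    mul_nonneg (historyProb_nonneg hπ he h) (mul_nonneg ((he h).1 x) ((hπ _).1 a))

theorem expect_mono (hπ : IsKernel π) (he : IsKernel env) {T : ℕ}
    {f f' : List (Fin k × Fin d) → ℝ} (hf : ∀ h, h.length = T → f h ≤ f' h) :
    expect g π env T f ≤ expect g π env T f' :=
  Finset.sum_le_sum fun _ _ => mul_le_mul_of_nonneg_left (hf _ (List.length_ofFn ..))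
    (historyProb_nonneg hπ he _)

theorem expect_add (T : ℕ) (f f' : List (Fin k × Fin d) → ℝ) :
    expect g π env T (fun h => f h + f' h) = expect g π env T f + expect g π env T f' := by
  simp only [expect, mul_add, Finset.sum_add_distrib]

theorem expect_sub (T : ℕ) (f f' : List (Fin k × Fin d) → ℝ) :
    expect g π env T (fun h => f h - f' h) = expect g π env T f - expect g π env T f' := by
  simp only [expect, mul_sub, Finset.sum_sub_distrib]

theorem expect_const_mul (T : ℕ) (r : ℝ) (f : List (Fin k × Fin d) → ℝ) :
    expect g π env T (fun h => r * f h) = r * expect g π env T f := by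
  simp only [expect, Finset.mul_sum, mul_left_comm]

/-- The expectation of a supermartingale is at most its initial value. -/
theorem expect_le_of_step (hπ : IsKernel π) (he : IsKernel env)
    {f : List (Fin k × Fin d) → ℝ}
    (hf : ∀ h x, ∑ a, π (observed g h) a * f ((a, x) :: h) ≤ f h) (T : ℕ) :
    expect g π env T f ≤ f [] := by
  induction T with
  | zero => rw [expect_zero]
  | succ T ih =>
    rw [expect_succ]
    refine le_trans (expect_mono hπ he fun h _ => ?_) ih
    calc ∑ x, env h x * ∑ a, π (observed g h) a * f ((a, x) :: h)
        ≤ ∑ x, env h x * f h :=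
          Finset.sum_le_sum fun x _ => mul_le_mul_of_nonneg_left (hf h x) ((he h).1 x)
      _ = f h := by rw [← Finset.sum_mul, (he h).2, one_mul]

theorem expect_const (hπ : IsKernel π) (he : IsKernel env) (T : ℕ) (r : ℝ) :
    expect g π env T (fun _ => r) = r := by
  have step : ∀ (r : ℝ) (h : List (Fin k × Fin d)) (x : Fin d),
      ∑ a, π (observed g h) a * r ≤ r := fun r h x => by
    rw [← Finset.sum_mul, (hπ _).2, one_mul]
  refine le_antisymm (expect_le_of_step hπ he (step r) T) ?_
  have := expect_le_of_step (g := g) (f := fun _ => -r) hπ he (step (-r)) T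
  have e := expect_const_mul (g := g) (π := π) (env := env) T (-1) (fun _ => r)
  simp only [neg_mul, one_mul] at e
  rw [e] at this
  linarith

/-- The sum of `f` over the proper suffixes of a history. -/
def cum {ι : Type*} (f : List ι → ℝ) : List ι → ℝ
  | [] => 0
  | _ :: h => cum f h + f h

end Expectation

/-! ### Unbiasedness of the estimator -/

section Estimator

variable {k d : ℕ} {S : Type*} {g : Game k d S}

/-- The loss differences telescope along the path to the root. The estimator is thus unbiased up to
the loss of the root, a shift that disappears in all differences. -/
theorem sum_G_eq (t : g.EstimationTree) (x : Fin d) (b : Fin k) :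
    ∑ a, t.G a (g.feedback a x) b = g.loss b x - g.loss t.root x := by
  simp only [Game.EstimationTree.G]
  rw [Finset.sum_comm]
  have hd : t.parent^[t.depth b] b = t.root := Nat.find_spec (t.reaches_root b)
  rw [← hd]
  have step : ∀ i ∈ Finset.range (t.depth b), ∑ a, t.w (t.parent^[i] b) a (g.feedback a x) =
      -(g.loss (t.parent^[i + 1] b) x) - -(g.loss (t.parent^[i] b) x) := fun i hi => by
    have hne : t.parent^[i] b ≠ t.root :=
      Nat.find_min (t.reaches_root b) (Finset.mem_range.1 hi)
    rw [t.recovers _ hne x, Function.iterate_succ_apply']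
    ring
  rw [Finset.sum_congr rfl step, Finset.sum_range_sub fun i => -(g.loss (t.parent^[i] b) x)]
  simp only [Function.iterate_zero, id_eq]
  ring

theorem sum_G_sub (t : g.EstimationTree) (x : Fin d) (b b' : Fin k) :
    ∑ a, (t.G a (g.feedback a x) b - t.G a (g.feedback a x) b') =
      g.loss b x - g.loss b' x := by
  rw [Finset.sum_sub_distrib, sum_G_eq, sum_G_eq]; ring

end Estimator

/-! ### The regret of the algorithm -/

section Regret

variable {k d : ℕ} {S : Type*} [Fintype S] {g : Game k d S} {t : g.EstimationTree}
  {I : (Fin k → ℝ) → Fin k} {β₁ : ℝ}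

theorem one_le_cG (t : g.EstimationTree) : 1 ≤ t.cG := le_max_left _ _

theorem abs_G_le (hk : 0 < k) (t : g.EstimationTree) (a : Fin k) (σ : S) (b : Fin k) :
    |t.G a σ b| ≤ t.cG / k := by
  have hk' : (0 : ℝ) < k := by exact_mod_cast hk
  rw [le_div_iff₀ hk']
  have h1 : |t.G a σ b| ≤ ‖t.G‖ :=
    (norm_le_pi_norm (t.G a σ) b).trans
      ((norm_le_pi_norm (t.G a) σ).trans (norm_le_pi_norm t.G a))
  have h2 : (k : ℝ) * ‖t.G‖ ≤ t.cG := le_max_right _ _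
  have := mul_le_mul_of_nonneg_right h1 hk'.le
  linarith

theorem algorithm_isKernel (hk : 3 ≤ k) (hβ₁ : 64 * t.cG ^ 2 / (1 - alphaOf k) ≤ β₁) :
    IsKernel (algorithm t (alphaOf k) β₁ I) := fun h =>
  AlgState.p_mem hk (one_le_cG t) (hβ₁.trans (beta_ge hk (one_le_cG t) hβ₁ h))

/-- The accumulated cost of the rounds. -/
noncomputable def totalCost (t : g.EstimationTree) (α β₁ : ℝ) (I : (Fin k → ℝ) → Fin k) :
    List (Fin k × S) → ℝ :=
  cum fun l => (algState t.G t.cG α β₁ I l).cost t.cG α β₁ I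

/-- The accumulated suboptimality `1 - q_{t,a}` of the iterates. -/
noncomputable def totalGap (t : g.EstimationTree) (α β₁ : ℝ) (I : (Fin k → ℝ) → Fin k)
    (a : Fin k) : List (Fin k × S) → ℝ :=
  cum fun l => 1 - (algState t.G t.cG α β₁ I l).q t.cG α β₁ a

/-- Excess loss minus potential minus 12 times the cost is a supermartingale by `AlgState.round_le`;
the potential is then dropped at the end and bounded by the entropies at the start. -/
theorem expect_loss_sub_le (hk : 3 ≤ k) (hI : IsArgmaxRule I)
    (hβ₁ : 64 * t.cG ^ 2 / (1 - alphaOf k) ≤ β₁) {env : Environment k d} (he : IsKernel env)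
    (T : ℕ) (b : Fin k) :
    expect g (algorithm t (alphaOf k) β₁ I) env T
        (fun h => (h.map fun p => g.loss p.1 p.2).sum) -
      expect g (algorithm t (alphaOf k) β₁ I) env T
        (fun h => (h.map fun p => g.loss b p.2).sum) ≤
      12 * expect g (algorithm t (alphaOf k) β₁ I) env T
        (fun h => totalCost t (alphaOf k) β₁ I (observed g h)) +
      (β₁ * hUnif k (alphaOf k) +
        betaBar k t.cG (alphaOf k) β₁ * hUnif k (1 - alphaOf k)) := by
  have hπ : IsKernel (algorithm t (alphaOf k) β₁ I) := algorithm_isKernel hk hβ₁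
  have hc := one_le_cG t
  set Ψ : List (Fin k × Fin d) → ℝ := fun h =>
    (algState t.G t.cG (alphaOf k) β₁ I (observed g h)).potential t.cG (alphaOf k) β₁ b with hΨ
  have key := expect_le_of_step (g := g) hπ he (f := fun h =>
    ((h.map fun p => g.loss p.1 p.2).sum - (h.map fun p => g.loss b p.2).sum) - Ψ h -
      12 * totalCost t (alphaOf k) β₁ I (observed g h)) ?_ T
  · rw [expect_sub, expect_sub, expect_sub, expect_const_mul] at key
    have h1 : expect g (algorithm t (alphaOf k) β₁ I) env T Ψ ≤ 0 := by
      rw [← expect_const (g := g) hπ he T 0]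
      exact expect_mono hπ he fun h _ => AlgState.potential_nonpos hk b
    have h2 := AlgState.neg_le_potential_init (G := t.G) (I := I) hk hc hβ₁ b
    have h3 : Ψ [] = (algState t.G t.cG (alphaOf k) β₁ I []).potential t.cG (alphaOf k) β₁ b := rfl
    have h4 : totalCost t (alphaOf k) β₁ I (observed g []) = 0 := rfl
    rw [h3, h4] at key
    simp only [List.map_nil, List.sum_nil] at key
    linarith
  · intro h x
    have hβ := beta_ge (G := t.G) (I := I) hk hc hβ₁ (observed g h)
    have hr := AlgState.round_le hI hk hc hβ₁ hβ (abs_G_le (by omega) t)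
      (ℓ := fun a => g.loss a x) (fun a => g.loss_mem a x)
      (σ := fun a => g.feedback a x) (sum_G_sub t x) b
    have hp : ∑ a, algorithm t (alphaOf k) β₁ I (observed g h) a = 1 := (hπ _).2
    simp only [hΨ, observed_cons, algState_cons, totalCost, cum, List.map_cons, List.sum_cons]
    simp only [algorithm] at hp ⊢
    set s := algState t.G t.cG (alphaOf k) β₁ I (observed g h)
    set p := s.p t.cG (alphaOf k) β₁ I
    have e : ∀ A B D : ℝ, ∀ f f' : Fin k → ℝ,
        ∑ a, p a * (f a + A - (g.loss b x + B) - f' a - 12 * (D + s.cost t.cG (alphaOf k) β₁ I)) =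
        ∑ a, p a * (f a - g.loss b x) -
          ∑ a, p a * (f' a - s.potential t.cG (alphaOf k) β₁ b) -
          12 * s.cost t.cG (alphaOf k) β₁ I +
          (A - B - s.potential t.cG (alphaOf k) β₁ b - 12 * D) := fun A B D f f' => by
      have : ∀ r : ℝ, ∑ a, p a * r = r := fun r => by rw [← Finset.sum_mul, hp, one_mul]
      rw [← this (12 * s.cost t.cG (alphaOf k) β₁ I),
        ← this (A - B - s.potential t.cG (alphaOf k) β₁ b - 12 * D), ← Finset.sum_sub_distrib,
        ← Finset.sum_sub_distrib, ← Finset.sum_add_distrib]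
      refine Finset.sum_congr rfl fun a _ => ?_
      ring
    rw [e]
    linarith

theorem regret_le (hk : 3 ≤ k) (hI : IsArgmaxRule I)
    (hβ₁ : 64 * t.cG ^ 2 / (1 - alphaOf k) ≤ β₁) {env : Environment k d} (he : IsKernel env)
    (T : ℕ) :
    regret g (algorithm t (alphaOf k) β₁ I) env T ≤
      12 * expect g (algorithm t (alphaOf k) β₁ I) env T
        (fun h => totalCost t (alphaOf k) β₁ I (observed g h)) +
      (β₁ * hUnif k (alphaOf k) +
        betaBar k t.cG (alphaOf k) β₁ * hUnif k (1 - alphaOf k)) := by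
  have : Nonempty (Fin k) := ⟨⟨0, by omega⟩⟩
  rw [regret, sub_le_comm]
  refine le_ciInf fun b => ?_
  have := expect_loss_sub_le (t := t) hk hI hβ₁ he T b
  linarith

/-- Another supermartingale comparison: `γ ≤ 3/8`, so the played distribution keeps at least `5/8`
of the gap `1 - q_a`, and every action other than `a` costs at least `Δmin`. -/
theorem expect_totalGap_le (hk : 3 ≤ k)
    (hβ₁ : 64 * t.cG ^ 2 / (1 - alphaOf k) ≤ β₁) {env : Environment k d} (he : IsKernel env)
    {Δ : Fin k → ℝ} {Δmin : ℝ} (hΔ0 : 0 ≤ Δmin) (a : Fin k) (hΔa : 0 ≤ Δ a)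
    (hΔ : ∀ b, b ≠ a → Δmin ≤ Δ b) (T : ℕ) :
    5 / 8 * Δmin * expect g (algorithm t (alphaOf k) β₁ I) env T
        (fun h => totalGap t (alphaOf k) β₁ I a (observed g h)) ≤
      expect g (algorithm t (alphaOf k) β₁ I) env T
        (fun h => (h.map fun p => Δ p.1).sum) := by
  have hπ : IsKernel (algorithm t (alphaOf k) β₁ I) := algorithm_isKernel hk hβ₁
  have hc := one_le_cG t
  have key := expect_le_of_step (g := g) hπ he (f := fun h =>
    5 / 8 * Δmin * totalGap t (alphaOf k) β₁ I a (observed g h) -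
      (h.map fun p => Δ p.1).sum) ?_ T
  · rw [expect_sub, expect_const_mul] at key
    simp only [List.map_nil, List.sum_nil, observed, totalGap, cum] at key
    simp only [totalGap, observed]
    linarith
  · intro h x
    have hβ := hβ₁.trans (beta_ge (G := t.G) (I := I) hk hc hβ₁ (observed g h))
    have hgap := AlgState.gap_le (I := I) (β₁ := β₁) hk hc hβ a
    have hp := AlgState.p_mem (I := I) (β₁ := β₁) hk hc hβ
    simp only [observed_cons, totalGap, cum, List.map_cons, List.sum_cons, algorithm]
    set s := algState t.G t.cG (alphaOf k) β₁ I (observed g h)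
    set p := s.p t.cG (alphaOf k) β₁ I
    have hsum : Δmin * (1 - p a) ≤ ∑ b, p b * Δ b := by
      rw [← sum_ne_eq hp, Finset.mul_sum,
        ← Finset.add_sum_erase _ _ (Finset.mem_univ a), ← Finset.filter_ne']
      refine le_add_of_nonneg_of_le (mul_nonneg (hp.1 a) hΔa) (Finset.sum_le_sum fun b hb => ?_)
      rw [mul_comm]
      exact mul_le_mul_of_nonneg_left (hΔ b (Finset.mem_filter.1 hb).2) (hp.1 b)
    have := mul_le_mul_of_nonneg_left hgap hΔ0
    simp only [mul_sub, mul_add, Finset.sum_sub_distrib, Finset.sum_add_distrib,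
      ← Finset.sum_mul, hp.2, one_mul]
    linarith

end Regret

/-! ### Stability-penalty-bias matching learning rates -/

section Cum

variable {ι : Type*} {f f' : List ι → ℝ}

theorem cum_nonneg (hf : ∀ l, 0 ≤ f l) : ∀ l, 0 ≤ cum f l
  | [] => le_rfl
  | _ :: l => add_nonneg (cum_nonneg hf l) (hf l)

theorem cum_mono (hf : ∀ l, f l ≤ f' l) : ∀ l, cum f l ≤ cum f' l
  | [] => le_rfl
  | _ :: l => add_le_add (cum_mono hf l) (hf l)

theorem cum_add : ∀ l, cum (fun l => f l + f' l) l = cum f l + cum f' l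
  | [] => by simp [cum]
  | _ :: l => by simp only [cum, cum_add l]; ring

theorem cum_const_mul (r : ℝ) : ∀ l, cum (fun l => r * f l) l = r * cum f l
  | [] => by simp [cum]
  | _ :: l => by simp only [cum, cum_const_mul r l]; ring

theorem cum_le_mul {B : ℝ} (hf : ∀ l, f l ≤ B) : ∀ l, cum f l ≤ l.length * B
  | [] => by simp [cum]
  | _ :: l => by
    have := cum_le_mul hf l
    simp only [cum, List.length_cons]
    push_cast
    linarith [hf l]

/-- Telescoping along a history. -/
theorem cum_le_sub {F : List ι → ℝ} (hF : ∀ x l, f l ≤ F (x :: l) - F l) :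
    ∀ l, cum f l ≤ F l - F []
  | [] => by simp [cum]
  | x :: l => by
    have := cum_le_sub hF l
    simp only [cum]
    linarith [hF x l]

end Cum

/-- Positive components `z`, `u`, `η` with upper bounds `Z`, `U`, `H`, and the learning rate
`b` that grows by `(2 √(z / b) + u / b) / η` in each round. -/
structure MatchingRate {ι : Type*} (b z u η : List ι → ℝ) (Z U H : ℝ) : Prop where
  b_pos : ∀ l, 0 < b l
  z_pos : ∀ l, 0 < z l
  u_pos : ∀ l, 0 < u l
  η_pos : ∀ l, 0 < η l
  z_le : ∀ l, z l ≤ Z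
  u_le : ∀ l, u l ≤ U
  η_le : ∀ l, η l ≤ H
  b_cons : ∀ x l, b (x :: l) = b l + 1 / η l * (2 * Real.sqrt (z l / b l) + u l / b l)

namespace MatchingRate

variable {ι : Type*} {b z u η η' : List ι → ℝ} {Z U H : ℝ}

/-- The learning rate after a round. -/
noncomputable def nextRate (b z u η : List ι → ℝ) (l : List ι) : ℝ :=
  b l + 1 / η l * (2 * Real.sqrt (z l / b l) + u l / b l)

theorem le_nextRate (M : MatchingRate b z u η Z U H) (l : List ι) : b l ≤ nextRate b z u η l := by
  have h1 := M.b_pos l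
  have h2 := M.z_pos l
  have h3 := M.u_pos l
  have h4 := M.η_pos l
  rw [nextRate]
  exact le_add_of_nonneg_right (by positivity)

theorem nextRate_pos (M : MatchingRate b z u η Z U H) (l : List ι) : 0 < nextRate b z u η l :=
  (M.b_pos l).trans_le (M.le_nextRate l)

/-- Exchanging the current rate for the next one costs at most `√Z (1/√b - 1/√b')` in a round, which
telescopes. The growth estimates below speak about the next rate. -/
theorem cum_sqrt_le (M : MatchingRate b z u η Z U H) (l : List ι) :
    cum (fun l => Real.sqrt (z l / b l)) l ≤ Real.sqrt (Z / b []) +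
      cum (fun l => Real.sqrt (z l) / Real.sqrt (nextRate b z u η l)) l := by
  have h := cum_le_sub (f := fun l => Real.sqrt (z l / b l)) (F := fun l =>
    cum (fun l => Real.sqrt (z l) / Real.sqrt (nextRate b z u η l)) l
      - Real.sqrt Z * (1 / Real.sqrt (b l))) (fun x l => ?_) l
  · have hb := Real.sqrt_pos.2 (M.b_pos l)
    have h2 : 0 ≤ Real.sqrt Z * (1 / Real.sqrt (b l)) := by positivity
    have h3 : Real.sqrt (Z / b []) = Real.sqrt Z * (1 / Real.sqrt (b [])) := by
      rw [Real.sqrt_div' _ (M.b_pos []).le, div_eq_mul_one_div]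
    rw [h3]
    simp only [cum] at h
    linarith
  · have e : b (x :: l) = nextRate b z u η l := M.b_cons x l
    simp only [cum]
    rw [e, Real.sqrt_div (M.z_pos l).le]
    have h1 := Real.sqrt_le_sqrt (M.z_le l)
    have h2 : 1 / Real.sqrt (nextRate b z u η l) ≤ 1 / Real.sqrt (b l) :=
      one_div_le_one_div_of_le (Real.sqrt_pos.2 (M.b_pos l))
        (Real.sqrt_le_sqrt (M.le_nextRate l))
    rw [div_eq_mul_one_div, div_eq_mul_one_div (Real.sqrt (z l))]
    nlinarith [mul_nonneg (sub_nonneg.2 h1) (sub_nonneg.2 h2)]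

theorem cum_div_le (M : MatchingRate b z u η Z U H) (l : List ι) :
    cum (fun l => u l / b l) l ≤ U / b [] + cum (fun l => u l / nextRate b z u η l) l := by
  have h := cum_le_sub (f := fun l => u l / b l) (F := fun l =>
    cum (fun l => u l / nextRate b z u η l) l - U * (1 / b l)) (fun x l => ?_) l
  · have hb := M.b_pos l
    have hU : 0 < U := (M.u_pos l).trans_le (M.u_le l)
    have h2 : 0 ≤ U * (1 / b l) := by positivity
    rw [div_eq_mul_one_div U]
    simp only [cum] at h
    linarith
  · have e : b (x :: l) = nextRate b z u η l := M.b_cons x l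
    simp only [cum]
    rw [e, div_eq_mul_one_div, div_eq_mul_one_div (u l)]
    have h2 : 1 / nextRate b z u η l ≤ 1 / b l :=
      one_div_le_one_div_of_le (M.b_pos l) (M.le_nextRate l)
    nlinarith [mul_nonneg (sub_nonneg.2 (M.u_le l)) (sub_nonneg.2 h2)]

/-- With `x = √b`, `y = √b'` and `w = √z/η'`, the update gives `y² - x² ≥ 2w/x`; the discrete form
of `d(x³) = (3/2) x d(x²)` follows because the difference of the two sides is `(y - x)² (y + x/2)`.
Any `η'` above `η` is allowed, which leaves room for truncation. -/
theorem cube_nextRate_ge (M : MatchingRate b z u η Z U H) (hη : ∀ l, η l ≤ η' l) (l : List ι) :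
    Real.sqrt (b l) ^ 3 + 3 * (Real.sqrt (z l) / η' l) ≤
      Real.sqrt (nextRate b z u η l) ^ 3 := by
  have hb := M.b_pos l
  have hx := Real.sqrt_pos.2 hb
  have hx2 := Real.sq_sqrt hb.le
  have hy2 := Real.sq_sqrt (M.nextRate_pos l).le
  have hxy := Real.sqrt_le_sqrt (M.le_nextRate l)
  have hη0 := M.η_pos l
  have h1 : Real.sqrt (nextRate b z u η l) ^ 2 ≥ Real.sqrt (b l) ^ 2 +
      2 * (Real.sqrt (z l) / η' l) / Real.sqrt (b l) := by
    rw [hx2, hy2, nextRate, Real.sqrt_div (M.z_pos l).le]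
    have hu : 0 ≤ u l / b l := (div_pos (M.u_pos l) hb).le
    have h2 : Real.sqrt (z l) / η' l ≤ Real.sqrt (z l) / η l :=
      div_le_div_of_nonneg_left (Real.sqrt_nonneg _) hη0 (hη l)
    have h3 : 2 * (Real.sqrt (z l) / η' l) / Real.sqrt (b l) ≤
        2 * (Real.sqrt (z l) / η l) / Real.sqrt (b l) :=
      div_le_div_of_nonneg_right (by linarith) hx.le
    have h4 : 1 / η l * (2 * (Real.sqrt (z l) / Real.sqrt (b l))) =
      2 * (Real.sqrt (z l) / η l) / Real.sqrt (b l) := by ring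
    have h5 : 0 ≤ 1 / η l * (u l / b l) := by positivity
    rw [mul_add]
    linarith
  set x := Real.sqrt (b l)
  set y := Real.sqrt (nextRate b z u η l)
  set w := Real.sqrt (z l) / η' l
  have h6 : 2 * w ≤ x * (y ^ 2 - x ^ 2) := by
    calc 2 * w = x * (2 * w / x) := by field_simp
      _ ≤ _ := mul_le_mul_of_nonneg_left (by linarith) hx.le
  have h7 : 0 ≤ (y - x) ^ 2 * (y + x / 2) := mul_nonneg (sq_nonneg _) (by linarith)
  nlinarith

theorem cum_le_cube (M : MatchingRate b z u η Z U H) (hη : ∀ l, η l ≤ η' l) (l : List ι) :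
    3 * cum (fun l => Real.sqrt (z l) / η' l) l ≤ Real.sqrt (b l) ^ 3 := by
  have h := cum_le_sub (f := fun l => 3 * (Real.sqrt (z l) / η' l))
    (F := fun l => Real.sqrt (b l) ^ 3) (fun x l => ?_) l
  · rw [cum_const_mul] at h
    have : 0 ≤ Real.sqrt (b []) ^ 3 := pow_nonneg (Real.sqrt_nonneg _) 3
    linarith
  · have e : b (x :: l) = nextRate b z u η l := M.b_cons x l
    rw [e]
    linarith [M.cube_nextRate_ge hη l]

/-- The bias part of the update alone raises `b` by `u/(η b)`, hence `b²` by twice `u/η`. -/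
theorem sq_nextRate_ge (M : MatchingRate b z u η Z U H) (hη : ∀ l, η l ≤ η' l) (l : List ι) :
    b l ^ 2 + 2 * (u l / η' l) ≤ nextRate b z u η l ^ 2 := by
  have hb := M.b_pos l
  have hη0 := M.η_pos l
  have h2 : u l / η' l ≤ u l / η l := div_le_div_of_nonneg_left (M.u_pos l).le hη0 (hη l)
  have h3 : b l + u l / η l / b l ≤ nextRate b z u η l := by
    have e : u l / η l / b l = 1 / η l * (u l / b l) := by ring
    have h5 : 0 ≤ 1 / η l * (2 * Real.sqrt (z l / b l)) := by positivity
    rw [nextRate, mul_add, e]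
    linarith
  have h4 : 0 ≤ u l / η l / b l := by
    have := M.u_pos l
    positivity
  have h6 : b l * (u l / η l / b l) = u l / η l := by field_simp
  nlinarith [M.le_nextRate l]

theorem cum_le_sq (M : MatchingRate b z u η Z U H) (hη : ∀ l, η l ≤ η' l) (l : List ι) :
    2 * cum (fun l => u l / η' l) l ≤ b l ^ 2 := by
  have h := cum_le_sub (f := fun l => 2 * (u l / η' l)) (F := fun l => b l ^ 2)
    (fun x l => ?_) l
  · rw [cum_const_mul] at h
    linarith [sq_nonneg (b [])]
  · have e : b (x :: l) = nextRate b z u η l := M.b_cons x l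
    rw [e]
    linarith [M.sq_nextRate_ge hη l]

/-- The stability term of a round against the increment of a power of the accumulated
stability. -/
theorem sqrt_div_le_rpow_sub (M : MatchingRate b z u η Z U H)
    (hη : ∀ l, η l ≤ η' l) (hη' : ∀ l, η' l ≤ H) (x : ι) (l : List ι) :
    Real.sqrt (z l) / Real.sqrt (nextRate b z u η l) ≤
      H / 2 * ((3 * cum (fun l => Real.sqrt (z l) / η' l) (x :: l)) ^ (2 / 3 : ℝ) -
        (3 * cum (fun l => Real.sqrt (z l) / η' l) l) ^ (2 / 3 : ℝ)) := by
  have hη0 := (M.η_pos l).trans_le (hη l)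
  have hz := Real.sqrt_pos.2 (M.z_pos l)
  have hy := Real.sqrt_pos.2 (M.nextRate_pos l)
  have hW' := M.cum_le_cube hη (x :: l)
  have hW0 := cum_nonneg (f := fun l => Real.sqrt (z l) / η' l)
    (fun l => div_nonneg (Real.sqrt_nonneg _) ((M.η_pos l).le.trans (hη l))) l
  rw [show b (x :: l) = nextRate b z u η l from M.b_cons x l] at hW'
  simp only [cum] at hW' ⊢
  set W := cum (fun l => Real.sqrt (z l) / η' l) l
  set w := Real.sqrt (z l) / η' l with hw
  have hw0 : 0 < w := by positivity
  set y := Real.sqrt (nextRate b z u η l)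
  have hX : 0 < 3 * (W + w) := by linarith
  have hroot : (3 * (W + w)) ^ (1 / 3 : ℝ) ≤ y := by
    calc (3 * (W + w)) ^ (1 / 3 : ℝ) ≤ (y ^ 3) ^ (1 / 3 : ℝ) :=
          Real.rpow_le_rpow hX.le hW' (by norm_num)
      _ = y := by
          rw [← Real.rpow_natCast, ← Real.rpow_mul hy.le]; norm_num
  -- The tangent of the concave function `X ↦ X ^ (2/3)` at the larger endpoint bounds the increment
  -- from below.
  have hB := rpow_one_add_le_one_add_mul_self (s := 3 * W / (3 * (W + w)) - 1)
    (by have : 0 ≤ 3 * W / (3 * (W + w)) := by positivity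
        linarith) (show (0 : ℝ) ≤ 2 / 3 by norm_num) (by norm_num)
  rw [add_sub_cancel, Real.div_rpow (by positivity) hX.le,
    div_le_iff₀ (Real.rpow_pos_of_pos hX _)] at hB
  have hsplit : (3 * (W + w)) ^ (2 / 3 : ℝ) = 3 * (W + w) / (3 * (W + w)) ^ (1 / 3 : ℝ) := by
    rw [eq_div_iff (Real.rpow_pos_of_pos hX _).ne', ← Real.rpow_add hX]
    norm_num
  set R := (3 * (W + w)) ^ (1 / 3 : ℝ)
  have hR : 0 < R := Real.rpow_pos_of_pos hX _
  have hdiff : 2 * w / R ≤ (3 * (W + w)) ^ (2 / 3 : ℝ) - (3 * W) ^ (2 / 3 : ℝ) := by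
    have e : (1 + 2 / 3 * (3 * W / (3 * (W + w)) - 1)) * (3 * (W + w)) ^ (2 / 3 : ℝ) =
        (3 * (W + w)) ^ (2 / 3 : ℝ) - 2 * w / R := by
      rw [hsplit]; field_simp; ring
    rw [e] at hB
    linarith
  have hH : 0 < H := hη0.trans_le (hη' l)
  calc Real.sqrt (z l) / y = η' l * w / y := by rw [hw]; field_simp
    _ ≤ H * w / R := div_le_div₀ (by positivity) (mul_le_mul_of_nonneg_right (hη' l) hw0.le) hR
        hroot
    _ = H / 2 * (2 * w / R) := by ring
    _ ≤ _ := mul_le_mul_of_nonneg_left hdiff (by linarith)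

/-- The square-root counterpart for the bias: `√(2V) ≤ b'` turns the summand into `w/√(2V)`, an
increment of `√(2V)`. -/
theorem div_le_sqrt_sub (M : MatchingRate b z u η Z U H)
    (hη : ∀ l, η l ≤ η' l) (hη' : ∀ l, η' l ≤ H) (x : ι) (l : List ι) :
    u l / nextRate b z u η l ≤
      H * (Real.sqrt (2 * cum (fun l => u l / η' l) (x :: l)) -
        Real.sqrt (2 * cum (fun l => u l / η' l) l)) := by
  have hη0 := (M.η_pos l).trans_le (hη l)
  have hu := M.u_pos l
  have hy := M.nextRate_pos l
  have hV' := M.cum_le_sq hη (x :: l)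
  have hV0 := cum_nonneg (f := fun l => u l / η' l)
    (fun l => div_nonneg (M.u_pos l).le ((M.η_pos l).le.trans (hη l))) l
  rw [show b (x :: l) = nextRate b z u η l from M.b_cons x l] at hV'
  simp only [cum] at hV' ⊢
  set V := cum (fun l => u l / η' l) l
  set w := u l / η' l with hw
  have hw0 : 0 < w := by positivity
  set y := nextRate b z u η l
  have hroot : Real.sqrt (2 * (V + w)) ≤ y := Real.sqrt_le_iff.2 ⟨hy.le, hV'⟩
  have hs := Real.sqrt_pos.2 (show 0 < 2 * (V + w) by linarith)
  have hs2 := Real.sq_sqrt (show 0 ≤ 2 * (V + w) by linarith)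
  have hr2 := Real.sq_sqrt (show 0 ≤ 2 * V by linarith)
  set R := Real.sqrt (2 * (V + w))
  set r := Real.sqrt (2 * V)
  have hdiff : w / R ≤ R - r := by
    rw [div_le_iff₀ hs]
    nlinarith [sq_nonneg (R - r)]
  have hH : 0 < H := hη0.trans_le (hη' l)
  calc u l / y = η' l * w / y := by rw [hw]; field_simp
    _ ≤ H * w / R := div_le_div₀ (by positivity) (mul_le_mul_of_nonneg_right (hη' l) hw0.le) hs
        hroot
    _ = H * (w / R) := by ring
    _ ≤ _ := mul_le_mul_of_nonneg_left hdiff hH.le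

/-- The bound on the accumulated cost that does not depend on the components of the rounds. -/
theorem cum_cost_le (M : MatchingRate b z u η Z U H) (l : List ι) :
    cum (fun l => Real.sqrt (z l / b l) + u l / b l) l ≤
      Real.sqrt (Z / b []) + U / b [] + 2 * (Z * H) ^ (1 / 3 : ℝ) * l.length ^ (2 / 3 : ℝ) +
        2 * Real.sqrt (U * H * l.length) := by
  have hZ : 0 < Z := (M.z_pos l).trans_le (M.z_le l)
  have hU : 0 < U := (M.u_pos l).trans_le (M.u_le l)
  have hH : 0 < H := (M.η_pos l).trans_le (M.η_le l)
  rw [cum_add]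
  have h1 := M.cum_sqrt_le l
  have h2 := M.cum_div_le l
  have h3 := cum_le_sub (F := fun l =>
      H / 2 * (3 * cum (fun l => Real.sqrt (z l) / H) l) ^ (2 / 3 : ℝ)) (fun x l => by
    have := M.sqrt_div_le_rpow_sub (η' := fun _ => H) M.η_le (fun _ => le_rfl) x l
    rw [mul_sub] at this
    exact this) l
  have h4 := cum_le_sub (F := fun l =>
      H * Real.sqrt (2 * cum (fun l => u l / H) l)) (fun x l => by
    have := M.div_le_sqrt_sub (η' := fun _ => H) M.η_le (fun _ => le_rfl) x l
    rw [mul_sub] at this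
    exact this) l
  have e1 : cum (fun l => Real.sqrt (z l) / H) l ≤ l.length * (Real.sqrt Z / H) :=
    cum_le_mul (fun l => div_le_div_of_nonneg_right (Real.sqrt_le_sqrt (M.z_le l)) hH.le) l
  have e2 : cum (fun l => u l / H) l ≤ l.length * (U / H) :=
    cum_le_mul (fun l => div_le_div_of_nonneg_right (M.u_le l) hH.le) l
  have p1 := cum_nonneg (f := fun l => Real.sqrt (z l) / H)
    (fun l => div_nonneg (Real.sqrt_nonneg _) hH.le) l
  have p2 := cum_nonneg (f := fun l => u l / H) (fun l => div_nonneg (M.u_pos l).le hH.le) l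
  set n : ℝ := (l.length : ℝ)
  have hn : 0 ≤ n := Nat.cast_nonneg _
  have f1 : H / 2 * (3 * cum (fun l => Real.sqrt (z l) / H) l) ^ (2 / 3 : ℝ) ≤
      2 * (Z * H) ^ (1 / 3 : ℝ) * n ^ (2 / 3 : ℝ) := by
    calc _ ≤ H / 2 * (n * (3 * (Real.sqrt Z / H))) ^ (2 / 3 : ℝ) := by
          refine mul_le_mul_of_nonneg_left (Real.rpow_le_rpow (by linarith) (by linarith)
            (by norm_num)) (by linarith)
      _ = (H / 2 * 3 ^ (2 / 3 : ℝ) * (Z ^ (1 / 3 : ℝ) / H ^ (2 / 3 : ℝ))) *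
            n ^ (2 / 3 : ℝ) := by
          rw [Real.mul_rpow hn (by positivity), Real.mul_rpow (by norm_num) (by positivity),
            Real.div_rpow (Real.sqrt_nonneg _) hH.le, Real.sqrt_eq_rpow, ← Real.rpow_mul hZ.le]
          norm_num
          ring
      _ ≤ _ := by
          refine mul_le_mul_of_nonneg_right ?_ (by positivity)
          have h3 : (3 : ℝ) ^ (2 / 3 : ℝ) ≤ 3 := by
            simpa using Real.rpow_le_rpow_of_exponent_le (show (1 : ℝ) ≤ 3 by norm_num)
              (show (2 / 3 : ℝ) ≤ 1 by norm_num)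
          have hHH : H = H ^ (1 / 3 : ℝ) * H ^ (2 / 3 : ℝ) := by
            rw [← Real.rpow_add hH]; norm_num
          have e : H / 2 * 3 ^ (2 / 3 : ℝ) * (Z ^ (1 / 3 : ℝ) / H ^ (2 / 3 : ℝ)) =
              3 ^ (2 / 3 : ℝ) / 2 * (Z * H) ^ (1 / 3 : ℝ) := by
            rw [Real.mul_rpow hZ.le hH.le]
            have := (Real.rpow_pos_of_pos hH (2 / 3)).ne'
            field_simp
            rw [mul_comm (H ^ (1 / 3 : ℝ)) (H ^ (2 / 3 : ℝ))] at hHH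
            exact hHH
          rw [e]
          exact mul_le_mul_of_nonneg_right (by linarith) (by positivity)
  have f2 : H * Real.sqrt (2 * cum (fun l => u l / H) l) ≤ 2 * Real.sqrt (U * H * n) := by
    calc _ ≤ H * Real.sqrt (2 * (n * (U / H))) :=
          mul_le_mul_of_nonneg_left (Real.sqrt_le_sqrt (by linarith)) hH.le
      _ = Real.sqrt (H ^ 2 * (2 * (n * (U / H)))) := by
          rw [Real.sqrt_mul (sq_nonneg H), Real.sqrt_sq hH.le]
      _ ≤ Real.sqrt (2 ^ 2 * (U * H * n)) := by
          refine Real.sqrt_le_sqrt ?_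
          have e : H ^ 2 * (2 * (n * (U / H))) = 2 * (U * H * n) := by field_simp
          have : 0 ≤ U * H * n := by positivity
          rw [e]; linarith
      _ = _ := by rw [Real.sqrt_mul (by norm_num), Real.sqrt_sq (by norm_num)]
  have g1 : 0 ≤ H / 2 * (3 * cum (fun l => Real.sqrt (z l) / H) ([] : List ι)) ^ (2 / 3 : ℝ) := by
    simp [cum]
  have g2 : 0 ≤ H * Real.sqrt (2 * cum (fun l => u l / H) ([] : List ι)) := by positivity
  linarith

/-- Either `y ≤ θ a`, or `y² ≥ (θ a)²` and the second term dominates. For `y = √z/√b'` and `a = √(z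
η')` the quotient `y³/a²` becomes `(√z/η') / b'^{3/2}`, a relative increment of the accumulated
weight. -/
theorem le_add_cube_div {θ a y : ℝ} (hθ : 0 < θ) (ha : 0 < a) (hy : 0 ≤ y) :
    y ≤ θ * a + θ⁻¹ ^ 2 * (y ^ 3 / a ^ 2) := by
  have hpos : 0 ≤ θ⁻¹ ^ 2 * (y ^ 3 / a ^ 2) := by positivity
  rcases le_total y (θ * a) with h | h
  · linarith
  · have e : θ⁻¹ ^ 2 * (y ^ 3 / a ^ 2) = y ^ 3 / (θ * a) ^ 2 := by field_simp
    have : y ≤ y ^ 3 / (θ * a) ^ 2 := by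
      rw [le_div_iff₀ (by positivity)]
      have h2 : (θ * a) ^ 2 ≤ y ^ 2 := pow_le_pow_left₀ (by positivity) h 2
      nlinarith
    rw [e]
    have : 0 ≤ θ * a := by positivity
    linarith

theorem le_add_sq_div {θ a y : ℝ} (hθ : 0 < θ) (ha : 0 < a) (hy : 0 ≤ y) :
    y ≤ θ * a + θ⁻¹ * (y ^ 2 / a) := by
  have hpos : 0 ≤ θ⁻¹ * (y ^ 2 / a) := by positivity
  rcases le_total y (θ * a) with h | h
  · linarith
  · have e : θ⁻¹ * (y ^ 2 / a) = y ^ 2 / (θ * a) := by field_simp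
    have : y ≤ y ^ 2 / (θ * a) := by
      rw [le_div_iff₀ (by positivity)]
      nlinarith
    rw [e]
    have : 0 ≤ θ * a := by positivity
    linarith

/-- An increment beyond the threshold `w₀` against the increment of a logarithm. -/
theorem sub_div_le_log {w₀ W W' : ℝ} (h0 : 0 < w₀) (hW : 0 ≤ W) (hWW : W ≤ W')
    (hw : w₀ ≤ W') : (W' - W) / W' ≤ 2 * (Real.log (w₀ + W') - Real.log (w₀ + W)) := by
  have hp : 0 < w₀ + W := by linarith
  have hp' : 0 < w₀ + W' := by linarith
  have hl := Real.one_sub_inv_le_log_of_pos (div_pos hp' hp)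
  rw [Real.log_div hp'.ne' hp.ne', inv_div] at hl
  have e : 1 - (w₀ + W) / (w₀ + W') = (W' - W) / (w₀ + W') := by field_simp; ring
  rw [e] at hl
  -- The 2 arises from `w₀ + W' ≤ 2 W'`, which needs the threshold to be passed.
  have h2 : (W' - W) / W' ≤ 2 * ((W' - W) / (w₀ + W')) := by
    rw [← mul_div_assoc, div_le_div_iff₀ (by linarith) hp']
    nlinarith
  linarith

/-- Rounds before the accumulated weight passes `w₀` are paid by the power bound, later ones by
Young's inequality and a logarithm. The truncated power `min (·) w₀` in the telescoping function
switches between the two regimes. -/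
theorem cum_sqrt_div_le (M : MatchingRate b z u η Z U H)
    (hη : ∀ l, η l ≤ η' l) (hη' : ∀ l, η' l ≤ H) {θ w₀ : ℝ} (hθ : 0 < θ)
    (hw₀ : 0 < w₀) (l : List ι) :
    cum (fun l => Real.sqrt (z l) / Real.sqrt (nextRate b z u η l)) l ≤
      H / 2 * w₀ ^ (2 / 3 : ℝ) + θ * cum (fun l => Real.sqrt (z l * η' l)) l +
        θ⁻¹ ^ 2 * (2 / 3) *
          Real.log (1 + 3 * cum (fun l => Real.sqrt (z l) / η' l) l / w₀) := by
  have hη0 : ∀ l, 0 < η' l := fun l => (M.η_pos l).trans_le (hη l)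
  have hH : 0 < H := (hη0 l).trans_le (hη' l)
  have hW0 := cum_nonneg (f := fun l => Real.sqrt (z l) / η' l)
    (fun l => div_nonneg (Real.sqrt_nonneg _) (hη0 l).le)
  have key := cum_le_sub
    (f := fun l => Real.sqrt (z l) / Real.sqrt (nextRate b z u η l)) (F := fun l =>
      H / 2 * (min (3 * cum (fun l => Real.sqrt (z l) / η' l) l) w₀) ^ (2 / 3 : ℝ) +
      θ * cum (fun l => Real.sqrt (z l * η' l)) l +
      θ⁻¹ ^ 2 * (2 / 3) * Real.log (w₀ + 3 * cum (fun l => Real.sqrt (z l) / η' l) l))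
    (fun x l => ?_) l
  · have hm : (min (3 * cum (fun l => Real.sqrt (z l) / η' l) l) w₀) ^ (2 / 3 : ℝ) ≤
        w₀ ^ (2 / 3 : ℝ) :=
      Real.rpow_le_rpow (le_min (by linarith [hW0 l]) hw₀.le) (min_le_right _ _) (by norm_num)
    have hm2 := mul_le_mul_of_nonneg_left hm (by linarith : 0 ≤ H / 2)
    have e0 : cum (fun l => Real.sqrt (z l) / η' l) ([] : List ι) = 0 := rfl
    have e1 : cum (fun l => Real.sqrt (z l * η' l)) ([] : List ι) = 0 := rfl
    rw [e0, e1, mul_zero, min_eq_left hw₀.le, Real.zero_rpow (by norm_num), add_zero] at key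
    have hl : Real.log (1 + 3 * cum (fun l => Real.sqrt (z l) / η' l) l / w₀) =
        Real.log (w₀ + 3 * cum (fun l => Real.sqrt (z l) / η' l) l) - Real.log w₀ := by
      rw [← Real.log_div (by have := hW0 l; positivity) hw₀.ne']
      congr 1
      field_simp
    rw [hl]
    linarith
  · have hstep := M.sqrt_div_le_rpow_sub hη hη' x l
    have hz := M.z_pos l
    have hzs := Real.sqrt_pos.2 hz
    have hy := Real.sqrt_pos.2 (M.nextRate_pos l)
    have hW' := M.cum_le_cube hη (x :: l)
    rw [show b (x :: l) = nextRate b z u η l from M.b_cons x l] at hW'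
    have hWl := hW0 l
    have hηl := hη0 l
    have ha : 0 < Real.sqrt (z l * η' l) := Real.sqrt_pos.2 (by positivity)
    simp only [cum] at hW' hstep ⊢
    set W := cum (fun l => Real.sqrt (z l) / η' l) l
    set w := Real.sqrt (z l) / η' l with hw
    have hw0 : 0 < w := by positivity
    have hlog : Real.log (w₀ + 3 * W) ≤ Real.log (w₀ + 3 * (W + w)) :=
      Real.log_le_log (by linarith) (by linarith)
    have hlog' := mul_nonneg (by positivity : 0 ≤ θ⁻¹ ^ 2 * (2 / 3)) (sub_nonneg.2 hlog)
    have hθa : 0 ≤ θ * Real.sqrt (z l * η' l) := by positivity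
    rcases le_or_gt (3 * (W + w)) w₀ with h | h
    · rw [min_eq_left h, min_eq_left (by linarith : 3 * W ≤ w₀)]
      linarith
    · have hmm : (min (3 * W) w₀) ^ (2 / 3 : ℝ) ≤ (min (3 * (W + w)) w₀) ^ (2 / 3 : ℝ) :=
        Real.rpow_le_rpow (le_min (by linarith) hw₀.le)
          (min_le_min_right _ (by linarith)) (by norm_num)
      have hmm' := mul_nonneg (by linarith : 0 ≤ H / 2) (sub_nonneg.2 hmm)
      have hyoung := le_add_cube_div hθ ha (by positivity :
        0 ≤ Real.sqrt (z l) / Real.sqrt (nextRate b z u η l))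
      have e : (Real.sqrt (z l) / Real.sqrt (nextRate b z u η l)) ^ 3 /
          Real.sqrt (z l * η' l) ^ 2 = w / Real.sqrt (nextRate b z u η l) ^ 3 := by
        rw [Real.sq_sqrt (by positivity), div_pow, pow_succ, Real.sq_sqrt hz.le, hw]
        field_simp
      rw [e] at hyoung
      have h2 : w / Real.sqrt (nextRate b z u η l) ^ 3 ≤ w / (3 * (W + w)) :=
        div_le_div_of_nonneg_left hw0.le (by linarith) hW'
      have h3 := sub_div_le_log hw₀ (by linarith : 0 ≤ 3 * W)
        (by linarith : 3 * W ≤ 3 * (W + w)) h.le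
      have h4 : (3 * (W + w) - 3 * W) / (3 * (W + w)) = 3 * (w / (3 * (W + w))) := by ring
      rw [h4] at h3
      have h5 : w / Real.sqrt (nextRate b z u η l) ^ 3 ≤
          2 / 3 * (Real.log (w₀ + 3 * (W + w)) - Real.log (w₀ + 3 * W)) := by linarith
      have h6 := mul_le_mul_of_nonneg_left h5 (by positivity : 0 ≤ θ⁻¹ ^ 2)
      linarith

/-- The same scheme for the bias, with squares in place of cubes; it is later used with `θ²`, so
that the logarithm again carries `θ⁻²`. -/
theorem cum_div_next_le (M : MatchingRate b z u η Z U H)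
    (hη : ∀ l, η l ≤ η' l) (hη' : ∀ l, η' l ≤ H) {θ v₀ : ℝ} (hθ : 0 < θ)
    (hv₀ : 0 < v₀) (l : List ι) :
    cum (fun l => u l / nextRate b z u η l) l ≤
      H * Real.sqrt v₀ + θ * cum (fun l => u l * η' l) l +
        θ⁻¹ * Real.log (1 + 2 * cum (fun l => u l / η' l) l / v₀) := by
  have hη0 : ∀ l, 0 < η' l := fun l => (M.η_pos l).trans_le (hη l)
  have hH : 0 < H := (hη0 l).trans_le (hη' l)
  have hV0 := cum_nonneg (f := fun l => u l / η' l)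
    (fun l => div_nonneg (M.u_pos l).le (hη0 l).le)
  have key := cum_le_sub (f := fun l => u l / nextRate b z u η l) (F := fun l =>
      H * Real.sqrt (min (2 * cum (fun l => u l / η' l) l) v₀) +
      θ * cum (fun l => u l * η' l) l +
      θ⁻¹ * Real.log (v₀ + 2 * cum (fun l => u l / η' l) l)) (fun x l => ?_) l
  · have hm : Real.sqrt (min (2 * cum (fun l => u l / η' l) l) v₀) ≤ Real.sqrt v₀ :=
      Real.sqrt_le_sqrt (min_le_right _ _)
    have hm2 := mul_le_mul_of_nonneg_left hm hH.le
    have e0 : cum (fun l => u l / η' l) ([] : List ι) = 0 := rfl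
    have e1 : cum (fun l => u l * η' l) ([] : List ι) = 0 := rfl
    rw [e0, e1, mul_zero, min_eq_left hv₀.le, Real.sqrt_zero, add_zero] at key
    have hl : Real.log (1 + 2 * cum (fun l => u l / η' l) l / v₀) =
        Real.log (v₀ + 2 * cum (fun l => u l / η' l) l) - Real.log v₀ := by
      rw [← Real.log_div (by have := hV0 l; positivity) hv₀.ne']
      congr 1
      field_simp
    rw [hl]
    linarith
  · have hstep := M.div_le_sqrt_sub hη hη' x l
    have hu := M.u_pos l
    have hy := M.nextRate_pos l
    have hV' := M.cum_le_sq hη (x :: l)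
    rw [show b (x :: l) = nextRate b z u η l from M.b_cons x l] at hV'
    have hVl := hV0 l
    have hηl := hη0 l
    have ha : 0 < u l * η' l := by positivity
    simp only [cum] at hV' hstep ⊢
    set V := cum (fun l => u l / η' l) l
    set w := u l / η' l with hw
    have hw0 : 0 < w := by positivity
    have hlog : Real.log (v₀ + 2 * V) ≤ Real.log (v₀ + 2 * (V + w)) :=
      Real.log_le_log (by linarith) (by linarith)
    have hlog' := mul_nonneg (by positivity : 0 ≤ θ⁻¹) (sub_nonneg.2 hlog)
    have hθa : 0 ≤ θ * (u l * η' l) := by positivity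
    rcases le_or_gt (2 * (V + w)) v₀ with h | h
    · rw [min_eq_left h, min_eq_left (by linarith : 2 * V ≤ v₀)]
      linarith
    · have hmm : Real.sqrt (min (2 * V) v₀) ≤ Real.sqrt (min (2 * (V + w)) v₀) :=
        Real.sqrt_le_sqrt (min_le_min_right _ (by linarith))
      have hmm' := mul_nonneg hH.le (sub_nonneg.2 hmm)
      have hyoung := le_add_sq_div hθ ha (by positivity : 0 ≤ u l / nextRate b z u η l)
      have e : (u l / nextRate b z u η l) ^ 2 / (u l * η' l) =
          w / nextRate b z u η l ^ 2 := by
        rw [hw]; field_simp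
      rw [e] at hyoung
      have h2 : w / nextRate b z u η l ^ 2 ≤ w / (2 * (V + w)) :=
        div_le_div_of_nonneg_left hw0.le (by linarith) hV'
      have h3 := sub_div_le_log hv₀ (by linarith : 0 ≤ 2 * V)
        (by linarith : 2 * V ≤ 2 * (V + w)) h.le
      have h4 : (2 * (V + w) - 2 * V) / (2 * (V + w)) = 2 * (w / (2 * (V + w))) := by ring
      rw [h4] at h3
      have h5 : w / nextRate b z u η l ^ 2 ≤
          Real.log (v₀ + 2 * (V + w)) - Real.log (v₀ + 2 * V) := by linarith
      have h6 := mul_le_mul_of_nonneg_left h5 (by positivity : 0 ≤ θ⁻¹)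
      linarith

/-- The bound on the accumulated cost in terms of `√(z η)` and `u η`. -/
theorem cum_cost_le_log (M : MatchingRate b z u η Z U H)
    {θ τ T : ℝ} (hθ : 0 < θ) (hτ : 0 < τ) (hτT : τ ≤ T) (l : List ι)
    (hl : l.length ≤ T) :
    cum (fun l => Real.sqrt (z l / b l) + u l / b l) l ≤
      Real.sqrt (Z / b []) + U / b [] + (Z * H) ^ (1 / 3 : ℝ) * τ ^ (2 / 3 : ℝ) +
        Real.sqrt (U * H * τ) +
        θ * (cum (fun l => Real.sqrt (z l * η l)) l + Real.sqrt (Z * H) * τ) +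
        θ ^ 2 * (cum (fun l => u l * η l) l + U * H * τ) +
        2 * θ⁻¹ ^ 2 * Real.log (1 + 3 * (T / τ) ^ 3) := by
  have hZ : 0 < Z := (M.z_pos l).trans_le (M.z_le l)
  have hU : 0 < U := (M.u_pos l).trans_le (M.u_le l)
  have hH : 0 < H := (M.η_pos l).trans_le (M.η_le l)
  have hT : 0 < T := hτ.trans_le hτT
  -- Truncating `η` at `ε` bounds the accumulated weights, so the logarithms see only `(T/τ)³`. The
  -- square is chosen so that `√(Z ε) T = √(Z H) τ`: over all rounds the truncation costs only a
  -- term linear in `τ`.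
  set ε := H * (τ / T) ^ 2 with hε
  have hε0 : 0 < ε := by positivity
  have hεH : ε ≤ H := by
    refine mul_le_of_le_one_right hH.le (pow_le_one₀ (by positivity) ?_)
    rw [div_le_one hT]; exact hτT
  have hη : ∀ l, η l ≤ max (η l) ε := fun l => le_max_left _ _
  have hη' : ∀ l, max (η l) ε ≤ H := fun l => max_le (M.η_le l) hεH
  have hsZ := Real.sqrt_pos.2 hZ
  have h1 := M.cum_sqrt_le l
  have h2 := M.cum_div_le l
  -- The thresholds `√Z τ / H` and `U τ / H` bound the weights that `τ` rounds of maximal components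
  -- would accumulate, so the part below them costs what the power bounds give for horizon `τ`.
  have h3 := M.cum_sqrt_div_le (η' := fun l => max (η l) ε) hη hη' hθ
    (show 0 < Real.sqrt Z * τ / H by positivity) l
  have h4 := M.cum_div_next_le (η' := fun l => max (η l) ε) hη hη' (show 0 < θ ^ 2 by positivity)
    (show 0 < U * τ / H by positivity) l
  -- logarithms
  have c1 : cum (fun l => Real.sqrt (z l) / max (η l) ε) l ≤ T * (Real.sqrt Z / ε) := by
    refine (cum_le_mul (fun l => div_le_div₀ hsZ.le (Real.sqrt_le_sqrt (M.z_le l)) hε0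
      (le_max_right (η l) ε)) l).trans ?_
    exact mul_le_mul_of_nonneg_right hl (by positivity)
  have c2 : cum (fun l => u l / max (η l) ε) l ≤ T * (U / ε) := by
    refine (cum_le_mul (fun l => div_le_div₀ hU.le (M.u_le l) hε0
      (le_max_right (η l) ε)) l).trans ?_
    exact mul_le_mul_of_nonneg_right hl (by positivity)
  have d1 := cum_nonneg (f := fun l => Real.sqrt (z l) / max (η l) ε)
    (fun l => div_nonneg (Real.sqrt_nonneg _) (hε0.le.trans (le_max_right _ _))) l
  have d2 := cum_nonneg (f := fun l => u l / max (η l) ε)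
    (fun l => div_nonneg (M.u_pos l).le (hε0.le.trans (le_max_right _ _))) l
  have l1 : Real.log (1 + 3 * cum (fun l => Real.sqrt (z l) / max (η l) ε) l /
      (Real.sqrt Z * τ / H)) ≤ Real.log (1 + 3 * (T / τ) ^ 3) := by
    refine Real.log_le_log (by positivity) ?_
    have e : 3 * (T / τ) ^ 3 = 3 * (T * (Real.sqrt Z / ε)) / (Real.sqrt Z * τ / H) := by
      rw [hε]; field_simp
    rw [e]
    gcongr
  have l2 : Real.log (1 + 2 * cum (fun l => u l / max (η l) ε) l / (U * τ / H)) ≤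
      Real.log (1 + 3 * (T / τ) ^ 3) := by
    refine Real.log_le_log (by positivity) ?_
    have e : 3 * (T / τ) ^ 3 = 3 * (T * (U / ε)) / (U * τ / H) := by
      rw [hε]; field_simp
    rw [e]
    gcongr
    norm_num
  -- weights
  have w1 : cum (fun l => Real.sqrt (z l * max (η l) ε)) l ≤
      cum (fun l => Real.sqrt (z l * η l)) l + Real.sqrt (Z * H) * τ := by
    have p : ∀ l, Real.sqrt (z l * max (η l) ε) ≤
        Real.sqrt (z l * η l) + Real.sqrt (Z * H) * (τ / T) := fun l => by
      have e : Real.sqrt (Z * H) * (τ / T) = Real.sqrt (Z * ε) := by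
        rw [hε, ← mul_assoc, Real.sqrt_mul (by positivity) ((τ / T) ^ 2),
          Real.sqrt_sq (by positivity)]
      rw [e]
      rcases max_cases (η l) ε with ⟨h, -⟩ | ⟨h, -⟩
      · rw [h]; exact le_add_of_nonneg_right (Real.sqrt_nonneg _)
      · rw [h]
        exact (Real.sqrt_le_sqrt (mul_le_mul_of_nonneg_right (M.z_le l) hε0.le)).trans
          (le_add_of_nonneg_left (Real.sqrt_nonneg _))
    refine (cum_mono p l).trans ?_
    rw [cum_add]
    have := cum_le_mul (f := fun _ : List ι => Real.sqrt (Z * H) * (τ / T)) (fun _ => le_rfl) l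
    have h5 : (l.length : ℝ) * (Real.sqrt (Z * H) * (τ / T)) ≤ Real.sqrt (Z * H) * τ := by
      calc _ ≤ T * (Real.sqrt (Z * H) * (τ / T)) :=
            mul_le_mul_of_nonneg_right hl (by positivity)
        _ = _ := by field_simp
    linarith
  have w2 : cum (fun l => u l * max (η l) ε) l ≤
      cum (fun l => u l * η l) l + U * H * τ := by
    have p : ∀ l, u l * max (η l) ε ≤ u l * η l + U * H * (τ / T) := fun l => by
      have hul := M.u_pos l
      have hηl := M.η_pos l
      have hr : (τ / T) ^ 2 ≤ τ / T := by
        have h0 : 0 ≤ τ / T := by positivity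
        have h1 : τ / T ≤ 1 := by rw [div_le_one hT]; exact hτT
        nlinarith
      have hpos : 0 ≤ u l * η l := by positivity
      rcases max_cases (η l) ε with ⟨h, -⟩ | ⟨h, -⟩
      · rw [h]; exact le_add_of_nonneg_right (by positivity)
      · rw [h]
        calc u l * ε ≤ U * (H * (τ / T)) :=
              mul_le_mul (M.u_le l) (mul_le_mul_of_nonneg_left hr hH.le) hε0.le hU.le
          _ = U * H * (τ / T) := by ring
          _ ≤ _ := le_add_of_nonneg_left hpos
    refine (cum_mono p l).trans ?_
    rw [cum_add]
    have := cum_le_mul (f := fun _ : List ι => U * H * (τ / T)) (fun _ => le_rfl) l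
    have h5 : (l.length : ℝ) * (U * H * (τ / T)) ≤ U * H * τ := by
      calc _ ≤ T * (U * H * (τ / T)) :=
            mul_le_mul_of_nonneg_right hl (by positivity)
        _ = _ := by field_simp
    linarith
  -- leading terms
  have f1 : H / 2 * (Real.sqrt Z * τ / H) ^ (2 / 3 : ℝ) ≤
      (Z * H) ^ (1 / 3 : ℝ) * τ ^ (2 / 3 : ℝ) := by
    have hHH : H = H ^ (2 / 3 : ℝ) * H ^ (1 / 3 : ℝ) := by
      rw [← Real.rpow_add hH]; norm_num
    have hHp := (Real.rpow_pos_of_pos hH (2 / 3)).ne'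
    have e : H * (Real.sqrt Z * τ / H) ^ (2 / 3 : ℝ) =
        (Z * H) ^ (1 / 3 : ℝ) * τ ^ (2 / 3 : ℝ) := by
      rw [Real.div_rpow (by positivity) hH.le, Real.mul_rpow hsZ.le hτ.le, Real.sqrt_eq_rpow,
        ← Real.rpow_mul hZ.le, Real.mul_rpow hZ.le hH.le,
        show (1 / 2 : ℝ) * (2 / 3) = 1 / 3 by norm_num]
      field_simp
      exact hHH
    have : 0 ≤ (Z * H) ^ (1 / 3 : ℝ) * τ ^ (2 / 3 : ℝ) := by positivity
    linarith
  have f2 : H * Real.sqrt (U * τ / H) = Real.sqrt (U * H * τ) := by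
    rw [← Real.sqrt_sq hH.le, ← Real.sqrt_mul (sq_nonneg H), Real.sqrt_sq hH.le]
    congr 1
    field_simp
  have hθ2 : (θ ^ 2)⁻¹ = θ⁻¹ ^ 2 := (inv_pow θ 2).symm
  rw [hθ2] at h4
  have m1 := mul_le_mul_of_nonneg_left w1 hθ.le
  have m2 := mul_le_mul_of_nonneg_left w2 (sq_nonneg θ)
  have m3 := mul_le_mul_of_nonneg_left l1 (by positivity : 0 ≤ θ⁻¹ ^ 2 * (2 / 3))
  have m4 := mul_le_mul_of_nonneg_left l2 (by positivity : 0 ≤ θ⁻¹ ^ 2)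
  have hlog0 : 0 ≤ θ⁻¹ ^ 2 * Real.log (1 + 3 * (T / τ) ^ 3) := by
    refine mul_nonneg (by positivity) (Real.log_nonneg ?_)
    exact le_add_of_nonneg_right (by positivity)
  rw [cum_add]
  linarith

end MatchingRate

/-! ### Bounds for the constants -/

section Constants

variable {k : ℕ} {c β₁ : ℝ}

theorem zMax_alphaOf (k : ℕ) (c : ℝ) : zMax c (alphaOf k) = 4 * c ^ 2 * Real.log k := by
  rw [zMax, one_sub_alphaOf, div_div_eq_mul_div, div_one]

theorem uMax_alphaOf (k : ℕ) (c : ℝ) : uMax c (alphaOf k) = 8 * c * Real.log k := by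
  rw [uMax, one_sub_alphaOf, div_div_eq_mul_div, div_one]

theorem one_le_zMax_mul (hk : 3 ≤ k) (hc : 1 ≤ c) :
    1 ≤ zMax c (alphaOf k) * hUnif k (alphaOf k) := by
  have hL := log_ge_of_three_le hk
  have hc2 : 1 ≤ c ^ 2 := one_le_pow₀ hc
  have : 1 ≤ zMax c (alphaOf k) := by
    rw [zMax_alphaOf]
    nlinarith
  exact one_le_mul_of_one_le_of_one_le this (one_le_hUnif hk)

theorem zMax_mul_le (hk : 3 ≤ k) (c : ℝ) :
    zMax c (alphaOf k) * hUnif k (alphaOf k) ≤ 92 * (c ^ 2 * Real.log k) := by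
  have hL := log_ge_of_three_le hk
  have h := hUnif_le hk
  rw [zMax_alphaOf]
  have : 0 ≤ c ^ 2 * Real.log k := by positivity
  nlinarith

theorem uMax_mul_le (hk : 3 ≤ k) (hc : 1 ≤ c) :
    uMax c (alphaOf k) * hUnif k (alphaOf k) ≤ 184 * (c * Real.log k) := by
  have hL := log_ge_of_three_le hk
  have h := hUnif_le hk
  rw [uMax_alphaOf]
  have : 0 ≤ c * Real.log k := by positivity
  nlinarith

theorem rpow_zMax_mul_le (hk : 3 ≤ k) (hc : 1 ≤ c) :
    (zMax c (alphaOf k) * hUnif k (alphaOf k)) ^ (1 / 3 : ℝ) ≤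
      5 * (c ^ (2 / 3 : ℝ) * Real.log k ^ (1 / 3 : ℝ)) := by
  have hL := log_ge_of_three_le hk
  have h1 := one_le_zMax_mul hk hc
  calc _ ≤ (5 ^ 3 * (c ^ 2 * Real.log k)) ^ (1 / 3 : ℝ) := by
        refine Real.rpow_le_rpow (by linarith) ((zMax_mul_le hk c).trans ?_) (by norm_num)
        have : 0 ≤ c ^ 2 * Real.log k := by positivity
        linarith
    _ = _ := by
        rw [Real.mul_rpow (by norm_num) (by positivity),
          Real.mul_rpow (by positivity) (by linarith), ← Real.rpow_natCast,
          ← Real.rpow_natCast, ← Real.rpow_mul (by norm_num), ← Real.rpow_mul (by linarith)]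
        norm_num

theorem sqrt_uMax_mul_le (hk : 3 ≤ k) (hc : 1 ≤ c) :
    Real.sqrt (uMax c (alphaOf k) * hUnif k (alphaOf k)) ≤
      14 * Real.sqrt (c * Real.log k) := by
  have hL := log_ge_of_three_le hk
  have : 0 ≤ c * Real.log k := by positivity
  calc _ ≤ Real.sqrt (14 ^ 2 * (c * Real.log k)) :=
        Real.sqrt_le_sqrt ((uMax_mul_le hk hc).trans (by linarith))
    _ = _ := by rw [Real.sqrt_mul (by norm_num), Real.sqrt_sq (by norm_num)]

/-- The bound by `log k` lets `κ` absorb lower-order terms of that size. -/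
theorem kappa_parts (hk : 3 ≤ k) (hc : 1 ≤ c) (hβ₁ : 64 * c ^ 2 / (1 - alphaOf k) ≤ β₁) :
    0 ≤ Real.sqrt (zMax c (alphaOf k) / β₁) ∧ 0 ≤ uMax c (alphaOf k) / β₁ ∧
      Real.log k ≤ β₁ * hUnif k (alphaOf k) ∧
      0 ≤ betaBar k c (alphaOf k) β₁ * hUnif k (1 - alphaOf k) := by
  have hL := log_ge_of_three_le hk
  have hβ0 := betaOne_pos hk hc hβ₁
  refine ⟨Real.sqrt_nonneg _, ?_, ?_, mul_nonneg (betaBar_nonneg hc _) (hUnif_one_sub_nonneg hk)⟩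
  · rw [uMax_alphaOf]; positivity
  · rw [one_sub_alphaOf, div_div_eq_mul_div, div_one] at hβ₁
    have hc2 : 1 ≤ c ^ 2 := one_le_pow₀ hc
    have h1 := one_le_hUnif hk
    nlinarith

theorem kappa_le (hk : 3 ≤ k) (hc : 1 ≤ c) (hβ₁ : β₁ = 64 * c ^ 2 / (1 - alphaOf k)) :
    kappa k c (alphaOf k) β₁ ≤
      1500 * (c ^ 2 * Real.log k + (k : ℝ) ^ (3 / 2 : ℝ) * Real.log k ^ (5 / 2 : ℝ)) := by
  have hL := log_ge_of_three_le hk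
  have hL0 : 0 < Real.log k := by linarith
  have hk0 : (0 : ℝ) < k := by
    have : 0 < k := by omega
    exact_mod_cast this
  have h1 := alphaOf_lt_one hk
  have hβ0 := betaOne_pos hk hc hβ₁.ge
  have a1 : Real.sqrt (zMax c (alphaOf k) / β₁) ≤ 1 / 4 :=
    Real.sqrt_le_iff.2 ⟨by norm_num, zMax_div_le hc h1 hβ₁.ge⟩
  have a2 := uMax_div_le hc h1 hβ₁.ge
  have hβe : β₁ = 64 * c ^ 2 * Real.log k := by
    rw [hβ₁, one_sub_alphaOf, div_div_eq_mul_div, div_one]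
  have hcL : 1 ≤ c ^ 2 * Real.log k := by
    have hc2 : 1 ≤ c ^ 2 := one_le_pow₀ hc
    nlinarith
  have a3 : β₁ * hUnif k (alphaOf k) ≤ 1472 * (c ^ 2 * Real.log k) := by
    rw [hβe]
    nlinarith [hUnif_le hk]
  have a4 : betaBar k c (alphaOf k) β₁ * hUnif k (1 - alphaOf k) ≤
      4 * ((k : ℝ) ^ (3 / 2 : ℝ) * Real.log k ^ (5 / 2 : ℝ)) := by
    have hs : Real.sqrt β₁ = 8 * c * Real.sqrt (Real.log k) := by
      rw [hβe, show 64 * c ^ 2 * Real.log k = (8 * c) ^ 2 * Real.log k by ring,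
        Real.sqrt_mul (sq_nonneg _), Real.sqrt_sq (by linarith)]
    have hsL := Real.sqrt_pos.2 hL0
    have hsL2 := Real.sq_sqrt hL0.le
    have e1 : (k : ℝ) ^ (3 / 2 : ℝ) = k * Real.sqrt k := by
      rw [show (3 / 2 : ℝ) = 1 + 1 / 2 by norm_num, Real.rpow_add hk0, Real.rpow_one,
        Real.sqrt_eq_rpow]
    have e2 : Real.log k ^ (5 / 2 : ℝ) = Real.log k ^ 2 * Real.sqrt (Real.log k) := by
      rw [show (5 / 2 : ℝ) = 2 + 1 / 2 by norm_num, Real.rpow_add hL0, Real.sqrt_eq_rpow]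
      norm_num
    have e3 : betaBar k c (alphaOf k) β₁ =
        4 * Real.sqrt k * (Real.log k * Real.sqrt (Real.log k)) := by
      rw [betaBar, hs, one_sub_alphaOf]
      rw [div_eq_iff (by positivity)]
      field_simp
      nlinarith
    calc _ ≤ betaBar k c (alphaOf k) β₁ * (Real.log k * k) :=
          mul_le_mul_of_nonneg_left (hUnif_one_sub_le hk) (betaBar_nonneg hc _)
      _ = _ := by rw [e1, e2, e3]; ring
  have a5 : 0 ≤ (k : ℝ) ^ (3 / 2 : ℝ) * Real.log k ^ (5 / 2 : ℝ) := by positivity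
  rw [kappa]
  linarith

theorem tau_pos {Δmin C : ℝ} (hΔ : 0 < Δmin) (hC : 0 ≤ C) : 0 < tau Δmin C := by
  rw [tau]
  positivity

theorem kappa'_le (hk : 3 ≤ k) (hc : 1 ≤ c) {Δmin C : ℝ} (hΔ : 0 < Δmin) (hC : 0 ≤ C) :
    kappa' k c (alphaOf k) β₁ Δmin C ≤ kappa k c (alphaOf k) β₁ +
      14 * ((c ^ (2 / 3 : ℝ) * Real.log k ^ (1 / 3 : ℝ) + Real.sqrt (c * Real.log k)) *
        (1 / Δmin ^ 3 + C / Δmin) ^ (2 / 3 : ℝ)) := by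
  have hL := log_ge_of_three_le hk
  have hτ := Real.rpow_nonneg (tau_pos hΔ hC).le (2 / 3)
  have h1 := rpow_zMax_mul_le hk hc
  have h2 := sqrt_uMax_mul_le hk hc
  have h3 : 0 ≤ c ^ (2 / 3 : ℝ) * Real.log k ^ (1 / 3 : ℝ) := by positivity
  have h4 := mul_le_mul_of_nonneg_right (by linarith :
    (zMax c (alphaOf k) * hUnif k (alphaOf k)) ^ (1 / 3 : ℝ) +
      Real.sqrt (uMax c (alphaOf k) * hUnif k (alphaOf k)) ≤
      14 * (c ^ (2 / 3 : ℝ) * Real.log k ^ (1 / 3 : ℝ) + Real.sqrt (c * Real.log k))) hτ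
  rw [kappa']
  rw [tau] at h4 ⊢
  linarith

end Constants

/-! ### Regret bounds -/

section Bounds

variable {k d : ℕ} {S : Type*} [Fintype S] {g : Game k d S} {t : g.EstimationTree}
  {I : (Fin k → ℝ) → Fin k} {β₁ : ℝ}

theorem matchingRate (hk : 3 ≤ k) (hI : IsArgmaxRule I)
    (hβ₁ : 64 * t.cG ^ 2 / (1 - alphaOf k) ≤ β₁) :
    MatchingRate (fun l => (algState t.G t.cG (alphaOf k) β₁ I l).β)
      (fun l => zVal t.cG (alphaOf k) I
        ((algState t.G t.cG (alphaOf k) β₁ I l).q t.cG (alphaOf k) β₁))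
      (fun l => uVal t.cG (alphaOf k) I
        ((algState t.G t.cG (alphaOf k) β₁ I l).q t.cG (alphaOf k) β₁))
      (fun l => tsallis (alphaOf k)
        ((algState t.G t.cG (alphaOf k) β₁ I l).q t.cG (alphaOf k) β₁))
      (zMax t.cG (alphaOf k)) (uMax t.cG (alphaOf k)) (hUnif k (alphaOf k)) := by
  have hc := one_le_cG t
  have h1 := alphaOf_lt_one hk
  have hb : ∀ l, 0 < (algState t.G t.cG (alphaOf k) β₁ I l).β := fun l =>
    (betaOne_pos hk hc hβ₁).trans_le (beta_ge hk hc hβ₁ l)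
  have hq := fun l => ((algState t.G t.cG (alphaOf k) β₁ I l).q_isMin
    (c := t.cG) (β₁ := β₁) hk).1
  exact
    { b_pos := hb
      z_pos := fun l => AlgState.zVal_pos hk hc (hb l)
      u_pos := fun l => AlgState.uVal_pos hk hc (hb l)
      η_pos := fun l => AlgState.tsallis_pos hI hk hc (hb l)
      z_le := fun l => zVal_le_zMax h1 (hq l)
      u_le := fun l => uVal_le_uMax (by linarith) h1 (hq l)
      η_le := fun l => tsallis_le_hUnif (by omega) (alphaOf_pos hk) h1.le (hq l)
      b_cons := fun _ _ => rfl }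

/-- The adversarial bound in terms of the maximal components. -/
theorem regret_le_rpow (hk : 3 ≤ k) (hI : IsArgmaxRule I)
    (hβ₁ : 64 * t.cG ^ 2 / (1 - alphaOf k) ≤ β₁) {env : Environment k d} (he : IsKernel env)
    (T : ℕ) :
    regret g (algorithm t (alphaOf k) β₁ I) env T ≤
      12 * kappa k t.cG (alphaOf k) β₁ +
      24 * ((zMax t.cG (alphaOf k) * hUnif k (alphaOf k)) ^ (1 / 3 : ℝ) * (T : ℝ) ^ (2 / 3 : ℝ) +
        Real.sqrt (uMax t.cG (alphaOf k) * hUnif k (alphaOf k) * T)) := by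
  have hπ : IsKernel (algorithm t (alphaOf k) β₁ I) := algorithm_isKernel hk hβ₁
  have h := regret_le (t := t) hk hI hβ₁ he T
  have hM := matchingRate (t := t) hk hI hβ₁
  have hX := expect_mono (g := g) hπ he (T := T)
    (f := fun h => totalCost t (alphaOf k) β₁ I (observed g h)) (f' := fun _ =>
      Real.sqrt (zMax t.cG (alphaOf k) / β₁) + uMax t.cG (alphaOf k) / β₁ +
        2 * (zMax t.cG (alphaOf k) * hUnif k (alphaOf k)) ^ (1 / 3 : ℝ) * (T : ℝ) ^ (2 / 3 : ℝ) +
        2 * Real.sqrt (uMax t.cG (alphaOf k) * hUnif k (alphaOf k) * T))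
    (fun h hh => by
      have := hM.cum_cost_le (observed g h)
      rw [show (observed g h).length = T by rw [observed, List.length_map, hh]] at this
      exact this)
  rw [expect_const hπ he] at hX
  obtain ⟨-, -, k3, k4⟩ := kappa_parts hk (one_le_cG t) hβ₁
  have hL := log_ge_of_three_le hk
  rw [kappa]
  linarith

/-- The bias contributes order `√(c T ln k)`; it is below the main rate when `c T ≥ ln k` and below
`ln k` otherwise. -/
theorem sqrt_mul_le_rpow_add {x L : ℝ} (hx : 0 ≤ x) (hL : 0 < L) :
    Real.sqrt (x * L) ≤ x ^ (2 / 3 : ℝ) * L ^ (1 / 3 : ℝ) + L := by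
  have h0 : 0 ≤ x ^ (2 / 3 : ℝ) * L ^ (1 / 3 : ℝ) := by positivity
  rcases le_total x L with h | h
  · have : Real.sqrt (x * L) ≤ L := by
      refine Real.sqrt_le_iff.2 ⟨hL.le, ?_⟩
      nlinarith
    linarith
  · have hx' : 0 < x := hL.trans_le h
    have : Real.sqrt (x * L) ≤ x ^ (2 / 3 : ℝ) * L ^ (1 / 3 : ℝ) := by
      rw [Real.sqrt_eq_rpow, Real.mul_rpow hx hL.le]
      have e1 : x ^ (2 / 3 : ℝ) = x ^ (1 / 2 : ℝ) * x ^ (1 / 6 : ℝ) := by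
        rw [← Real.rpow_add hx']; norm_num
      have e2 : L ^ (1 / 2 : ℝ) = L ^ (1 / 6 : ℝ) * L ^ (1 / 3 : ℝ) := by
        rw [← Real.rpow_add hL]; norm_num
      rw [e1, e2, mul_assoc]
      refine mul_le_mul_of_nonneg_left (mul_le_mul_of_nonneg_right ?_ (by positivity))
        (by positivity)
      exact Real.rpow_le_rpow hL.le h (by norm_num)
    linarith

theorem regret_le_adversarial (hk : 3 ≤ k) (hI : IsArgmaxRule I)
    (hβ₁ : 64 * t.cG ^ 2 / (1 - alphaOf k) ≤ β₁) {env : Environment k d} (he : IsKernel env)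
    (T : ℕ) :
    regret g (algorithm t (alphaOf k) β₁ I) env T ≤
      500 * ((t.cG * T) ^ (2 / 3 : ℝ) * Real.log k ^ (1 / 3 : ℝ) +
        kappa k t.cG (alphaOf k) β₁) := by
  have hc := one_le_cG t
  have hL := log_ge_of_three_le hk
  have hT : (0 : ℝ) ≤ T := Nat.cast_nonneg T
  obtain ⟨k1, k2, k3, k4⟩ := kappa_parts hk hc hβ₁
  have h := regret_le_rpow (t := t) hk hI hβ₁ he T
  have e1 := mul_le_mul_of_nonneg_right (rpow_zMax_mul_le hk hc)
    (Real.rpow_nonneg hT (2 / 3))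
  have e2 : 5 * (t.cG ^ (2 / 3 : ℝ) * Real.log k ^ (1 / 3 : ℝ)) * (T : ℝ) ^ (2 / 3 : ℝ) =
      5 * ((t.cG * T) ^ (2 / 3 : ℝ) * Real.log k ^ (1 / 3 : ℝ)) := by
    rw [Real.mul_rpow (by linarith) hT]; ring
  have e3 : Real.sqrt (uMax t.cG (alphaOf k) * hUnif k (alphaOf k) * T) ≤
      14 * Real.sqrt (t.cG * T * Real.log k) := by
    rw [Real.sqrt_mul' _ hT, show t.cG * T * Real.log k = t.cG * Real.log k * T by ring,
      Real.sqrt_mul' _ hT, ← mul_assoc]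
    exact mul_le_mul_of_nonneg_right (sqrt_uMax_mul_le hk hc) (Real.sqrt_nonneg _)
  have e4 := sqrt_mul_le_rpow_add (by positivity : 0 ≤ t.cG * T)
    (by linarith : 0 < Real.log k)
  have e5 : 0 ≤ (t.cG * T) ^ (2 / 3 : ℝ) * Real.log k ^ (1 / 3 : ℝ) := by positivity
  have e6 : Real.log k ≤ kappa k t.cG (alphaOf k) β₁ := by rw [kappa]; linarith
  linarith

/-- The exponents `2 - α` and `α` add up to 2, so the square root is exactly linear in the gap. The
constant is `8 · 13 · e ≤ 17²`. -/
theorem sqrt_mul_tsallis_le (hk : 3 ≤ k) (hI : IsArgmaxRule I) {c : ℝ} (hc : 1 ≤ c)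
    {q : Fin k → ℝ} (hq : q ∈ stdSimplex ℝ (Fin k)) (a : Fin k) :
    Real.sqrt (zVal c (alphaOf k) I q * tsallis (alphaOf k) q) ≤
      17 * (c * Real.sqrt (Real.log k)) * (1 - q a) := by
  have hL := log_ge_of_three_le hk
  have h1 := alphaOf_lt_one hk
  have h0 := alphaOf_pos hk
  have hρ : 0 ≤ 1 - q a := sub_nonneg.2 (mem_simplex_le_one hq a)
  have hz := zVal_le_gap (c := c) hI h1 hq a
  have ht := tsallis_le_gap h0 h1.le hq a
  rw [one_sub_alphaOf, div_div_eq_mul_div, div_one] at hz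
  rw [rpow_one_sub_alphaOf hk] at ht
  have hs := Real.sq_sqrt (by linarith : 0 ≤ Real.log k)
  refine Real.sqrt_le_iff.2 ⟨by positivity, ?_⟩
  have hee := Real.exp_one_lt_d9
  have hα := one_div_alphaOf_le hk
  have hα0 : 0 < 1 / alphaOf k := by positivity
  have e : (1 - q a) ^ (2 - alphaOf k) * (1 - q a) ^ alphaOf k = (1 - q a) ^ 2 := by
    rw [← Real.rpow_add_of_nonneg hρ (by linarith) h0.le]; norm_num
  calc _ ≤ 8 * c ^ 2 * Real.log k * (1 - q a) ^ (2 - alphaOf k) *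
        (1 / alphaOf k * (Real.exp 1 * (1 - q a) ^ alphaOf k)) :=
        mul_le_mul hz ht (tsallis_nonneg h0 h1.le hq) (by positivity)
    _ = 8 * (1 / alphaOf k * Real.exp 1) * (c ^ 2 * Real.log k *
        ((1 - q a) ^ (2 - alphaOf k) * (1 - q a) ^ alphaOf k)) := by ring
    _ = 8 * (1 / alphaOf k * Real.exp 1) * (c ^ 2 * Real.log k * (1 - q a) ^ 2) := by rw [e]
    _ ≤ 289 * (c ^ 2 * Real.log k * (1 - q a) ^ 2) := by
        refine mul_le_mul_of_nonneg_right ?_ (by positivity)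
        nlinarith [Real.exp_pos 1]
    _ = _ := by rw [← hs]; simp only [Real.sqrt_sq (Real.sqrt_nonneg _)]; ring

/-- Here the exponents `1 - α` and `α` add up to 1, so no root is needed. -/
theorem uVal_mul_tsallis_le (hk : 3 ≤ k) (hI : IsArgmaxRule I) {c : ℝ} (hc : 1 ≤ c)
    {q : Fin k → ℝ} (hq : q ∈ stdSimplex ℝ (Fin k)) (a : Fin k) :
    uVal c (alphaOf k) I q * tsallis (alphaOf k) q ≤
      289 * (c * Real.log k) * (1 - q a) := by
  have hL := log_ge_of_three_le hk
  have h1 := alphaOf_lt_one hk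
  have h0 := alphaOf_pos hk
  have hρ : 0 ≤ 1 - q a := sub_nonneg.2 (mem_simplex_le_one hq a)
  have hu := uVal_le_gap (c := c) hI (by linarith) h1 hq a
  have ht := tsallis_le_gap h0 h1.le hq a
  rw [rpow_one_sub_alphaOf hk] at ht
  have hee := Real.exp_one_lt_d9
  have hα := one_div_alphaOf_le hk
  have hα0 : 0 < 1 / alphaOf k := by positivity
  have e : (1 - q a) ^ (1 - alphaOf k) * (1 - q a) ^ alphaOf k = 1 - q a := by
    rw [← Real.rpow_add_of_nonneg hρ (by linarith) h0.le]; norm_num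
  have e' : 8 * c / (1 - alphaOf k) = 8 * c * Real.log k := by
    rw [one_sub_alphaOf, div_div_eq_mul_div, div_one]
  rw [e'] at hu
  calc _ ≤ 8 * c * Real.log k * (1 - q a) ^ (1 - alphaOf k) *
        (1 / alphaOf k * (Real.exp 1 * (1 - q a) ^ alphaOf k)) :=
        mul_le_mul hu ht (tsallis_nonneg h0 h1.le hq) (by positivity)
    _ = 8 * (1 / alphaOf k * Real.exp 1) * (c * Real.log k *
        ((1 - q a) ^ (1 - alphaOf k) * (1 - q a) ^ alphaOf k)) := by ring
    _ = 8 * (1 / alphaOf k * Real.exp 1) * (c * Real.log k * (1 - q a)) := by rw [e]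
    _ ≤ 289 * (c * Real.log k * (1 - q a)) := by
        refine mul_le_mul_of_nonneg_right ?_ (by positivity)
        nlinarith [Real.exp_pos 1]
    _ = _ := by ring

/-- The regret in terms of the expected suboptimality of the iterates. -/
theorem regret_le_gap (hk : 3 ≤ k) (hI : IsArgmaxRule I)
    (hβ₁ : 64 * t.cG ^ 2 / (1 - alphaOf k) ≤ β₁) {env : Environment k d} (he : IsKernel env)
    (T : ℕ) (a : Fin k) {θ τ : ℝ} (hθ : 0 < θ) (hτ : 0 < τ) (hτT : τ ≤ T)
    (hθL : θ * Real.sqrt (Real.log k) ≤ 1) :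
    regret g (algorithm t (alphaOf k) β₁ I) env T ≤
      12 * kappa k t.cG (alphaOf k) β₁ +
      12 * ((zMax t.cG (alphaOf k) * hUnif k (alphaOf k)) ^ (1 / 3 : ℝ) * τ ^ (2 / 3 : ℝ) +
        Real.sqrt (uMax t.cG (alphaOf k) * hUnif k (alphaOf k) * τ)) +
      12 * (θ * (t.cG * Real.sqrt (Real.log k))) *
        (306 * expect g (algorithm t (alphaOf k) β₁ I) env T
          (fun h => totalGap t (alphaOf k) β₁ I a (observed g h)) + 194 * τ) +
      24 * θ⁻¹ ^ 2 * Real.log (1 + 3 * (T / τ) ^ 3) := by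
  have hc := one_le_cG t
  have hL := log_ge_of_three_le hk
  have hπ : IsKernel (algorithm t (alphaOf k) β₁ I) := algorithm_isKernel hk hβ₁
  have hreg := regret_le (t := t) hk hI hβ₁ he T
  have hM := matchingRate (t := t) hk hI hβ₁
  have hq := fun l => ((algState t.G t.cG (alphaOf k) β₁ I l).q_isMin
    (c := t.cG) (β₁ := β₁) hk).1
  set s := Real.sqrt (Real.log k) with hsdef
  have hs := Real.sq_sqrt (by linarith : 0 ≤ Real.log k)
  rw [← hsdef] at hs
  have hs0 : 0 < s := Real.sqrt_pos.2 (by linarith)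
  -- The condition on `θ` puts the bias terms, of order `θ²`, under the same factor as the stability
  -- terms; hence `306 = 17 + 289` and `194 = 10 + 184`.
  have hθu : θ ^ 2 * (t.cG * Real.log k) ≤ θ * (t.cG * s) := by
    have e : θ ^ 2 * (t.cG * Real.log k) = θ * (t.cG * s) * (θ * s) := by rw [← hs]; ring
    rw [e]
    exact mul_le_of_le_one_right (by positivity) hθL
  have hZH : Real.sqrt (zMax t.cG (alphaOf k) * hUnif k (alphaOf k)) ≤ 10 * (t.cG * s) := by
    refine Real.sqrt_le_iff.2 ⟨by positivity, (zMax_mul_le hk t.cG).trans ?_⟩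
    rw [← hs]
    nlinarith [sq_nonneg (t.cG * s)]
  have hUH := uMax_mul_le hk hc
  have hX : ∀ h : List (Fin k × Fin d), h.length = T →
      totalCost t (alphaOf k) β₁ I (observed g h) ≤
      (Real.sqrt (zMax t.cG (alphaOf k) / β₁) + uMax t.cG (alphaOf k) / β₁ +
        (zMax t.cG (alphaOf k) * hUnif k (alphaOf k)) ^ (1 / 3 : ℝ) * τ ^ (2 / 3 : ℝ) +
        Real.sqrt (uMax t.cG (alphaOf k) * hUnif k (alphaOf k) * τ) +
        θ * (t.cG * s) * (194 * τ) + 2 * θ⁻¹ ^ 2 * Real.log (1 + 3 * (T / τ) ^ 3)) +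
        θ * (t.cG * s) * 306 * totalGap t (alphaOf k) β₁ I a (observed g h) := fun h hh => by
    have hlen : (observed g h).length = T := by rw [observed, List.length_map, hh]
    have key := hM.cum_cost_le_log hθ hτ hτT (observed g h) (by rw [hlen])
    have hb0 : (algState t.G t.cG (alphaOf k) β₁ I []).β = β₁ := rfl
    rw [hb0] at key
    have g0 : 0 ≤ totalGap t (alphaOf k) β₁ I a (observed g h) :=
      cum_nonneg (fun l => sub_nonneg.2 (mem_simplex_le_one (hq l) a)) _
    have g1 := cum_mono (fun l => sqrt_mul_tsallis_le hk hI hc (hq l) a) (observed g h)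
    have g2 := cum_mono (fun l => uVal_mul_tsallis_le hk hI hc (hq l) a) (observed g h)
    rw [cum_const_mul] at g1 g2
    have n1 := mul_le_mul_of_nonneg_left (add_le_add g1 (mul_le_mul_of_nonneg_right hZH hτ.le))
      hθ.le
    have n2 := mul_le_mul_of_nonneg_left (add_le_add g2 (mul_le_mul_of_nonneg_right hUH hτ.le))
      (sq_nonneg θ)
    have n3 := mul_le_mul_of_nonneg_right hθu (by positivity :
      0 ≤ 289 * totalGap t (alphaOf k) β₁ I a (observed g h) + 184 * τ)
    have n4 : totalCost t (alphaOf k) β₁ I (observed g h) ≤ _ := key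
    simp only [totalGap] at n3 g0 ⊢
    linarith
  have hE := expect_mono (g := g) hπ he hX
  rw [expect_add, expect_const hπ he, expect_const_mul] at hE
  obtain ⟨-, -, k3, k4⟩ := kappa_parts hk hc hβ₁
  rw [kappa]
  linarith

/-- For such short horizons the adversarial bound is already of the size of `κ'`. -/
theorem regret_le_of_lt_two_mul (hk : 3 ≤ k) (hI : IsArgmaxRule I)
    (hβ₁ : 64 * t.cG ^ 2 / (1 - alphaOf k) ≤ β₁) {env : Environment k d} (he : IsKernel env)
    {T : ℕ} {D C : ℝ} (hτ1 : 1 ≤ tau D C) (hT2 : T < 2 * tau D C) :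
    regret g (algorithm t (alphaOf k) β₁ I) env T ≤
      48 * kappa' k t.cG (alphaOf k) β₁ D C := by
  have hc := one_le_cG t
  have hL := log_ge_of_three_le hk
  have hT : (0 : ℝ) ≤ T := Nat.cast_nonneg T
  have hτ : 0 < tau D C := by linarith
  have h := regret_le_rpow (t := t) hk hI hβ₁ he T
  have hZH1 := one_le_zMax_mul hk hc
  obtain ⟨k1, k2, k3, k4⟩ := kappa_parts hk hc hβ₁
  have hκ : 0 ≤ kappa k t.cG (alphaOf k) β₁ := by rw [kappa]; linarith
  have hτ23 : Real.sqrt (tau D C) ≤ tau D C ^ (2 / 3 : ℝ) := by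
    rw [Real.sqrt_eq_rpow]
    exact Real.rpow_le_rpow_of_exponent_le hτ1 (by norm_num)
  have hτ230 : 0 ≤ tau D C ^ (2 / 3 : ℝ) := by positivity
  rw [kappa']
  set ZH := zMax t.cG (alphaOf k) * hUnif k (alphaOf k)
  set UH := uMax t.cG (alphaOf k) * hUnif k (alphaOf k)
  have a1 : (T : ℝ) ^ (2 / 3 : ℝ) ≤ 2 * tau D C ^ (2 / 3 : ℝ) := by
    calc (T : ℝ) ^ (2 / 3 : ℝ) ≤ (2 * tau D C) ^ (2 / 3 : ℝ) :=
          Real.rpow_le_rpow hT hT2.le (by norm_num)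
      _ = 2 ^ (2 / 3 : ℝ) * tau D C ^ (2 / 3 : ℝ) := Real.mul_rpow (by norm_num) hτ.le
      _ ≤ _ := by
          refine mul_le_mul_of_nonneg_right ?_ hτ230
          simpa using Real.rpow_le_rpow_of_exponent_le (show (1 : ℝ) ≤ 2 by norm_num)
            (show (2 / 3 : ℝ) ≤ 1 by norm_num)
  have a2 : Real.sqrt (UH * T) ≤ Real.sqrt UH * (2 * tau D C ^ (2 / 3 : ℝ)) := by
    rw [Real.sqrt_mul' _ hT]
    refine mul_le_mul_of_nonneg_left ?_ (Real.sqrt_nonneg _)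
    calc Real.sqrt T ≤ Real.sqrt (2 ^ 2 * tau D C) := Real.sqrt_le_sqrt (by linarith)
      _ = 2 * Real.sqrt (tau D C) := by
          rw [Real.sqrt_mul (by norm_num), Real.sqrt_sq (by norm_num)]
      _ ≤ _ := by linarith
  have a3 := mul_le_mul_of_nonneg_left a1
    (Real.rpow_nonneg (by linarith) _ : 0 ≤ ZH ^ (1 / 3 : ℝ))
  linarith

/-- The choice of the parameter that balances the two parts of the self-bounding argument. -/
theorem exists_balance {M A C Λ : ℝ} (hM : 0 < M) (hA : 0 < A) (hC : 0 ≤ C) (hΛ : 0 < Λ) :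
    ∃ θ : ℝ, 0 < θ ∧ θ * A ≤ 1 / M ∧ θ * A * C ≤ (C ^ 2 * A ^ 2 * Λ) ^ (1 / 3 : ℝ) ∧
      θ⁻¹ ^ 2 * Λ ≤ M ^ 2 * (A ^ 2 * Λ) + (C ^ 2 * A ^ 2 * Λ) ^ (1 / 3 : ℝ) := by
  have hB : 0 ≤ (C ^ 2 * A ^ 2 * Λ) ^ (1 / 3 : ℝ) := by positivity
  have e0 : (1 / (M * A)) * A = 1 / M := by field_simp
  have e1 : (1 / (M * A))⁻¹ ^ 2 * Λ = M ^ 2 * (A ^ 2 * Λ) := by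
    rw [one_div, inv_inv]; ring
  rcases hC.eq_or_lt with rfl | hC
  · exact ⟨1 / (M * A), by positivity, e0.le, by simp, by rw [e1]; linarith⟩
  -- This value solves `θ A C = θ⁻² Λ`; both sides then equal the cube root in the statement.
  set s := (Λ / (A * C)) ^ (1 / 3 : ℝ) with hs
  have hs0 : 0 < s := by positivity
  have hs3 : s ^ 3 = Λ / (A * C) := by
    rw [hs, ← Real.rpow_natCast, ← Real.rpow_mul (by positivity)]; norm_num
  have hBs : (C ^ 2 * A ^ 2 * Λ) ^ (1 / 3 : ℝ) = s * A * C := by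
    have : C ^ 2 * A ^ 2 * Λ = (s * A * C) ^ 3 := by
      rw [mul_pow, mul_pow, hs3]; field_simp
    rw [this, ← Real.rpow_natCast, ← Real.rpow_mul (by positivity)]; norm_num
  have hsΛ : s⁻¹ ^ 2 * Λ = s * A * C := by
    have : Λ = s ^ 3 * (A * C) := by rw [hs3]; field_simp
    rw [this]; field_simp
  have hmin : 0 < min (1 / (M * A)) s := lt_min (by positivity) hs0
  refine ⟨min (1 / (M * A)) s, hmin, ?_, ?_, ?_⟩
  · rw [← e0]
    exact mul_le_mul_of_nonneg_right (min_le_left _ _) hA.le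
  · rw [hBs]
    exact mul_le_mul_of_nonneg_right (mul_le_mul_of_nonneg_right (min_le_right _ _) hA.le) hC.le
  · rcases min_cases (1 / (M * A)) s with ⟨h, -⟩ | ⟨h, -⟩
    · rw [h, e1]; linarith
    · rw [h, hsΛ, hBs]
      have : 0 ≤ M ^ 2 * (A ^ 2 * Λ) := by positivity
      linarith

/-- The arithmetic of the self-bounding argument: `R` is the regret, `D` the minimal gap, `Q` the
accumulated suboptimality. -/
theorem le_of_selfBounding {θ A D Q R C B Λ τ κ x y z u v l : ℝ} (hθ : 0 < θ) (hA : 0 < A)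
    (hκ : 0 ≤ κ) (hu : 0 ≤ u) (hz : 1 ≤ z) (hx : 0 ≤ x) (hR : 0 ≤ R) (hΛ : 0 ≤ Λ) (hB : 0 ≤ B)
    (hgap : R ≤ 12 * κ + 12 * (z * x + v) + 12 * (θ * (A * D)) * (306 * Q + 194 * τ) +
      24 * θ⁻¹ ^ 2 * l)
    (hv : v ≤ u * x) (hDQ : D * Q ≤ 8 / 5 * (R + C)) (hDτ : D * τ = y + C) (hy : y ≤ x)
    (hθA : θ * A ≤ 1 / 12000) (hθC : θ * A * C ≤ B)
    (hθΛ : θ⁻¹ ^ 2 * Λ ≤ 12000 ^ 2 * (A ^ 2 * Λ) + B) (hl : l ≤ 5 * Λ) :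
    R ≤ 10 ^ 11 * (A ^ 2 * Λ + B + (κ + (z + u) * x)) := by
  have hθA0 : 0 < θ * A := by positivity
  have p1 : θ * A * (D * Q) ≤ 8 / 5 * (1 / 12000 * R + B) := by
    have h1 := mul_le_mul_of_nonneg_left hDQ hθA0.le
    have h2 := mul_le_mul_of_nonneg_right hθA hR
    linarith
  have p2 : θ * A * (D * τ) ≤ 1 / 12000 * x + B := by
    rw [hDτ, mul_add]
    have h1 := mul_le_mul_of_nonneg_left hy hθA0.le
    have h2 := mul_le_mul_of_nonneg_right hθA hx
    linarith
  have p3 : 24 * θ⁻¹ ^ 2 * l ≤ 120 * (12000 ^ 2 * (A ^ 2 * Λ) + B) := by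
    have := mul_le_mul_of_nonneg_left hl (by positivity : 0 ≤ 24 * θ⁻¹ ^ 2)
    linarith
  have p5 : x ≤ z * x := le_mul_of_one_le_left hx hz
  have p6 : 12 * (θ * (A * D)) * (306 * Q + 194 * τ) =
      3672 * (θ * A * (D * Q)) + 2328 * (θ * A * (D * τ)) := by ring
  have p7 : 0 ≤ u * x := by positivity
  have p8 : 0 ≤ A ^ 2 * Λ := by positivity
  rw [p6] at hgap
  rw [add_mul]
  -- The regret appears on the right with coefficient `3672 · (8/5) / 12000 < 1/2`. The dominating
  -- constant is `120 · 12000²`, and twice it is below `10 ^ 11`.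
  linarith

theorem gapMin_spec (hk : 3 ≤ k) {Δ : Fin k → ℝ} (hΔ : ∀ a, Δ a ∈ Set.Icc (0 : ℝ) 1)
    {astar : Fin k} (hpos : ∀ a, a ≠ astar → 0 < Δ a) :
    0 < gapMin Δ astar ∧ gapMin Δ astar ≤ 1 ∧ ∀ a, a ≠ astar → gapMin Δ astar ≤ Δ a := by
  have : Nontrivial (Fin k) := Fin.nontrivial_iff_two_le.2 (by omega)
  obtain ⟨j, hj⟩ := exists_ne astar
  have : Nonempty {a : Fin k // a ≠ astar} := ⟨⟨j, hj⟩⟩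
  have hle : ∀ a, a ≠ astar → gapMin Δ astar ≤ Δ a := fun a ha =>
    ciInf_le (f := fun a : {a : Fin k // a ≠ astar} => Δ a) (Set.finite_range _).bddBelow ⟨a, ha⟩
  obtain ⟨i, hi⟩ := exists_eq_ciInf_of_finite (f := fun a : {a : Fin k // a ≠ astar} => Δ a)
  refine ⟨?_, (hle j hj).trans (hΔ j).2, hle⟩
  rw [gapMin, ← hi]
  exact hpos i i.2

/-- The argument produces `ln (T/τ)`; since `τ` is at least each of its two summands, this is below
both `ln (T Δ_min³)` and `ln (T Δ_min / C)`. -/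
theorem regret_le_selfBounding (hk : 3 ≤ k) (hI : IsArgmaxRule I)
    (hβ₁ : 64 * t.cG ^ 2 / (1 - alphaOf k) ≤ β₁) {env : Environment k d} (he : IsKernel env)
    {T : ℕ} {Δ : Fin k → ℝ} {C : ℝ} {astar : Fin k} (hΔ : ∀ a, Δ a ∈ Set.Icc (0 : ℝ) 1)
    (hC : 0 ≤ C) (hpos : ∀ a, a ≠ astar → 0 < Δ a) (hsb : SelfBounding g env Δ C T)
    (hT : tau (gapMin Δ astar) C ≤ T) :
    regret g (algorithm t (alphaOf k) β₁ I) env T ≤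
      10 ^ 11 * (t.cG ^ 2 * Real.log k / gapMin Δ astar ^ 2 *
          Real.log (T * gapMin Δ astar ^ 3) +
        (C ^ 2 * t.cG ^ 2 * Real.log k / gapMin Δ astar ^ 2 *
          Real.log (T * gapMin Δ astar / C)) ^ (1 / 3 : ℝ) +
        kappa' k t.cG (alphaOf k) β₁ (gapMin Δ astar) C) := by
  obtain ⟨hD0, hD1, hDle⟩ := gapMin_spec hk hΔ hpos
  set D := gapMin Δ astar
  have hc := one_le_cG t
  have hL := log_ge_of_three_le hk
  have hπ : IsKernel (algorithm t (alphaOf k) β₁ I) := algorithm_isKernel hk hβ₁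
  have hτ := tau_pos hD0 hC
  have hτD : 1 / D ^ 3 ≤ tau D C := by
    rw [tau]; exact le_add_of_nonneg_right (by positivity)
  have hτC : C / D ≤ tau D C := by
    rw [tau]; exact le_add_of_nonneg_left (by positivity)
  have hτ1 : 1 ≤ tau D C := by
    refine le_trans ?_ hτD
    rw [le_div_iff₀ (by positivity), one_mul]
    exact pow_le_one₀ hD0.le hD1
  have hTpos : (0 : ℝ) < T := by linarith
  set ZH := zMax t.cG (alphaOf k) * hUnif k (alphaOf k) with hZH
  set UH := uMax t.cG (alphaOf k) * hUnif k (alphaOf k) with hUH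
  have hZH1 : 1 ≤ ZH := one_le_zMax_mul hk hc
  have hZH13 : 1 ≤ ZH ^ (1 / 3 : ℝ) := Real.one_le_rpow hZH1 (by norm_num)
  obtain ⟨k1, k2, k3, k4⟩ := kappa_parts hk hc hβ₁
  have hκ : 0 ≤ kappa k t.cG (alphaOf k) β₁ := by rw [kappa]; linarith
  have hκ' : kappa' k t.cG (alphaOf k) β₁ D C = kappa k t.cG (alphaOf k) β₁ +
    (ZH ^ (1 / 3 : ℝ) + Real.sqrt UH) * tau D C ^ (2 / 3 : ℝ) := rfl
  have hτ23 : Real.sqrt (tau D C) ≤ tau D C ^ (2 / 3 : ℝ) := by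
    rw [Real.sqrt_eq_rpow]
    exact Real.rpow_le_rpow_of_exponent_le hτ1 (by norm_num)
  have hτ230 : 0 ≤ tau D C ^ (2 / 3 : ℝ) := by positivity
  have hlog1 : Real.log (T / tau D C) ≤ Real.log (T * D ^ 3) := by
    refine Real.log_le_log (by positivity) ?_
    rw [div_le_iff₀ hτ]
    calc (T : ℝ) = T * D ^ 3 * (1 / D ^ 3) := by field_simp
      _ ≤ _ := mul_le_mul_of_nonneg_left hτD (by positivity)
  have hlog2 : 0 < C → Real.log (T / tau D C) ≤ Real.log (T * D / C) := fun hC0 => by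
    refine Real.log_le_log (by positivity) ?_
    rw [div_le_iff₀ hτ]
    calc (T : ℝ) = T * D / C * (C / D) := by field_simp
      _ ≤ _ := mul_le_mul_of_nonneg_left hτC (by positivity)
  have hΛ0 : 0 ≤ Real.log (T / tau D C) := Real.log_nonneg (by rw [le_div_iff₀ hτ]; linarith)
  have hmain0 : 0 ≤ t.cG ^ 2 * Real.log k / D ^ 2 * Real.log (T * D ^ 3) :=
    mul_nonneg (by positivity) (hΛ0.trans hlog1)
  have hmidle : C ^ 2 * (t.cG * Real.sqrt (Real.log k) / D) ^ 2 * Real.log (T / tau D C) ≤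
      C ^ 2 * t.cG ^ 2 * Real.log k / D ^ 2 * Real.log (T * D / C) := by
    have e : C ^ 2 * (t.cG * Real.sqrt (Real.log k) / D) ^ 2 =
        C ^ 2 * t.cG ^ 2 * Real.log k / D ^ 2 := by
      rw [div_pow, mul_pow, Real.sq_sqrt (by linarith)]; ring
    rw [e]
    rcases hC.eq_or_lt with h | h
    -- For `C = 0` the factor `C ^ 2` makes both sides 0, whatever the value of the logarithm.
    · rw [← h]; simp
    · exact mul_le_mul_of_nonneg_left (hlog2 h) (by positivity)
  have hmid0 : 0 ≤ (C ^ 2 * t.cG ^ 2 * Real.log k / D ^ 2 *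
      Real.log (T * D / C)) ^ (1 / 3 : ℝ) :=
    Real.rpow_nonneg (le_trans (by positivity) hmidle) _
  -- Near `T = τ` the logarithm `ln (T/τ)` vanishes and cannot absorb constants, so that range is
  -- treated separately.
  rcases lt_or_ge (T : ℝ) (2 * tau D C) with hT2 | hT2
  · have h := regret_le_of_lt_two_mul (t := t) hk hI hβ₁ he hτ1 hT2
    have : 0 ≤ kappa' k t.cG (alphaOf k) β₁ D C := by
      rw [hκ']
      positivity
    linarith
  -- The absorption multiplies an upper bound on `θ A` by the regret and so needs it to be
  -- nonnegative.
  rcases le_total (regret g (algorithm t (alphaOf k) β₁ I) env T) 0 with hneg | hreg0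
  · refine hneg.trans ?_
    have a4 : 0 ≤ (ZH ^ (1 / 3 : ℝ) + Real.sqrt UH) * tau D C ^ (2 / 3 : ℝ) := by positivity
    rw [hκ']
    have : 0 ≤ t.cG ^ 2 * Real.log k / D ^ 2 * Real.log (T * D ^ 3) + (C ^ 2 * t.cG ^ 2 *
      Real.log k / D ^ 2 * Real.log (T * D / C)) ^ (1 / 3 : ℝ) + (kappa k t.cG (alphaOf k) β₁ +
      (ZH ^ (1 / 3 : ℝ) + Real.sqrt UH) * tau D C ^ (2 / 3 : ℝ)) := by linarith
    positivity
  set s := Real.sqrt (Real.log k) with hsdef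
  have hs0 : 0 < s := Real.sqrt_pos.2 (by linarith)
  have hs2 : s ^ 2 = Real.log k := Real.sq_sqrt (by linarith)
  set A := t.cG * s / D with hA
  have hA0 : 0 < A := by positivity
  set Λ := Real.log (T / tau D C) with hΛ
  have hΛ2 : Real.log 2 ≤ Λ :=
    Real.log_le_log (by norm_num) (by rw [le_div_iff₀ hτ]; exact hT2)
  have hΛpos : 0 < Λ := lt_of_lt_of_le (Real.log_pos (by norm_num)) hΛ2
  obtain ⟨θ, hθ, hθA, hθC, hθΛ⟩ := exists_balance (M := 12000) (by norm_num) hA0 hC hΛpos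
  have hAs : A * D = t.cG * s := by rw [hA]; field_simp
  have hθs : θ * s ≤ 1 := by
    have : s ≤ A := by
      rw [hA, le_div_iff₀ hD0]; nlinarith
    have := mul_le_mul_of_nonneg_left this hθ.le
    linarith
  have hgap := regret_le_gap (t := t) hk hI hβ₁ he T astar hθ hτ hT hθs
  rw [← hZH, ← hUH, ← hsdef, ← hAs] at hgap
  have hQ := expect_totalGap_le (t := t) (I := I) hk hβ₁ he hD0.le astar (hΔ astar).1 hDle T
  have hSB := hsb _ hπ
  rw [expect_sub, expect_const hπ he] at hSB
  set R := regret g (algorithm t (alphaOf k) β₁ I) env T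
  set Q := expect g (algorithm t (alphaOf k) β₁ I) env T
    (fun h => totalGap t (alphaOf k) β₁ I astar (observed g h))
  have hDQ : D * Q ≤ 8 / 5 * (R + C) := by linarith
  -- The constant `2 ln 2` is absorbed by `2 Λ`, because `T ≥ 2 τ`.
  have hlog5 : Real.log (1 + 3 * (T / tau D C) ^ 3) ≤ 5 * Λ := by
    have hr : 1 ≤ (T / tau D C) ^ 3 := one_le_pow₀ (by rw [le_div_iff₀ hτ]; linarith)
    have : Real.log (1 + 3 * (T / tau D C) ^ 3) ≤ Real.log (2 ^ 2 * (T / tau D C) ^ 3) :=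
      Real.log_le_log (by positivity) (by linarith)
    rw [Real.log_mul (by norm_num) (by positivity), Real.log_pow, Real.log_pow] at this
    push_cast at this
    linarith
  set B := (C ^ 2 * A ^ 2 * Λ) ^ (1 / 3 : ℝ) with hB
  have hBle : B ≤ (C ^ 2 * t.cG ^ 2 * Real.log k / D ^ 2 *
      Real.log (T * D / C)) ^ (1 / 3 : ℝ) :=
    Real.rpow_le_rpow (by positivity) hmidle (by norm_num)
  have hAΛ : A ^ 2 * Λ ≤ t.cG ^ 2 * Real.log k / D ^ 2 * Real.log (T * D ^ 3) := by
    have e : A ^ 2 = t.cG ^ 2 * Real.log k / D ^ 2 := by rw [hA, div_pow, mul_pow, hs2]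
    rw [e]
    exact mul_le_mul_of_nonneg_left hlog1 (by positivity)
  have hDτ : D * tau D C = 1 / D ^ 2 + C := by rw [tau]; field_simp
  have hD2 : 1 / D ^ 2 ≤ tau D C ^ (2 / 3 : ℝ) := by
    have e : 1 / D ^ 2 = (1 / D ^ 3) ^ (2 / 3 : ℝ) := by
      rw [one_div, one_div, Real.inv_rpow (by positivity), ← Real.rpow_natCast D 3,
        ← Real.rpow_mul hD0.le]
      norm_num
    rw [e]
    exact Real.rpow_le_rpow (by positivity) hτD (by norm_num)
  have p4 : Real.sqrt (UH * tau D C) ≤ Real.sqrt UH * tau D C ^ (2 / 3 : ℝ) := by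
    rw [Real.sqrt_mul' _ hτ.le]
    exact mul_le_mul_of_nonneg_left hτ23 (Real.sqrt_nonneg _)
  refine (le_of_selfBounding hθ hA0 hκ (Real.sqrt_nonneg UH) hZH13 hτ230 hreg0 hΛpos.le
    (by positivity) hgap p4 hDQ hDτ hD2 hθA hθC hθΛ hlog5).trans ?_
  rw [hκ']
  exact mul_le_mul_of_nonneg_left (by linarith) (by norm_num)

end Bounds

end PartialMonitoring

theorem corollary6 :
    ∃ K : ℝ, 0 < K ∧
      ∀ (k d : ℕ) (S : Type*) [Fintype S] (g : Game k d S) (t : g.EstimationTree)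
        (I : (Fin k → ℝ) → Fin k) (β₁ : ℝ),
        3 ≤ k → g.NoDuplicates → (∀ a, g.ParetoOptimal a) → g.GloballyObservable →
        IsArgmaxRule I → 64 * t.cG ^ 2 / (1 - alphaOf k) ≤ β₁ →
        -- adversarial regime
        (∀ (T : ℕ) (env : Environment k d), IsKernel env →
          regret g (algorithm t (alphaOf k) β₁ I) env T ≤
            K * ((t.cG * T) ^ (2 / 3 : ℝ) * Real.log k ^ (1 / 3 : ℝ) +
              kappa k t.cG (alphaOf k) β₁)) ∧
        -- adversarial regime with a self-bounding constraint
        (∀ (T : ℕ) (env : Environment k d) (Δ : Fin k → ℝ) (C : ℝ) (astar : Fin k),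
          IsKernel env → (∀ a, Δ a ∈ Set.Icc (0 : ℝ) 1) → 0 ≤ C →
          (∀ a, a ≠ astar → 0 < Δ a) → SelfBounding g env Δ C T →
          tau (gapMin Δ astar) C ≤ T →
          regret g (algorithm t (alphaOf k) β₁ I) env T ≤
            K * (t.cG ^ 2 * Real.log k / gapMin Δ astar ^ 2 *
                Real.log (T * gapMin Δ astar ^ 3) +
              (C ^ 2 * t.cG ^ 2 * Real.log k / gapMin Δ astar ^ 2 *
                Real.log (T * gapMin Δ astar / C)) ^ (1 / 3 : ℝ) +
              kappa' k t.cG (alphaOf k) β₁ (gapMin Δ astar) C)) ∧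
        -- the constants for the smallest admissible `β₁`
        (β₁ = 64 * t.cG ^ 2 / (1 - alphaOf k) →
          kappa k t.cG (alphaOf k) β₁ ≤
            K * (t.cG ^ 2 * Real.log k + (k : ℝ) ^ (3 / 2 : ℝ) * Real.log k ^ (5 / 2 : ℝ)) ∧
          ∀ Δmin C : ℝ, 0 < Δmin → 0 ≤ C →
            kappa' k t.cG (alphaOf k) β₁ Δmin C ≤
              kappa k t.cG (alphaOf k) β₁ +
                K * ((t.cG ^ (2 / 3 : ℝ) * Real.log k ^ (1 / 3 : ℝ) +
                    Real.sqrt (t.cG * Real.log k)) *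
                  (1 / Δmin ^ 3 + C / Δmin) ^ (2 / 3 : ℝ))) := by
  -- The constant is dictated by the self-bounding regime; the other claims hold with 500, 1500 and
  -- 14.
  refine ⟨10 ^ 11, by norm_num, ?_⟩
  intro k d S _ g t I β₁ hk _ _ _ hI hβ₁
  have hc := one_le_cG t
  have hL := log_ge_of_three_le hk
  obtain ⟨k1, k2, k3, k4⟩ := kappa_parts hk hc hβ₁
  have hκ : 0 ≤ kappa k t.cG (alphaOf k) β₁ := by rw [kappa]; linarith
  refine ⟨fun T env he => ?_, fun T env Δ C astar he hΔ hC hpos hsb hT =>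
    regret_le_selfBounding hk hI hβ₁ he hΔ hC hpos hsb hT, fun hβ => ⟨?_, fun Δmin C hΔ hC => ?_⟩⟩
  · refine (regret_le_adversarial hk hI hβ₁ he T).trans ?_
    exact mul_le_mul_of_nonneg_right (by norm_num) (by positivity)
  · refine (kappa_le hk hc hβ).trans ?_
    exact mul_le_mul_of_nonneg_right (by norm_num) (by positivity)
  · refine (kappa'_le hk hc hΔ hC).trans ?_
    exact add_le_add_right (mul_le_mul_of_nonneg_right (by norm_num) (by positivity)) _
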